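/- Let $(R,\mathfrak m)$ be a regular local ring with $\dim R\ge 2$ and fraction field $K$, and let $I$ be an $\mathfrak m$-primary ideal of $R$. A local subring $T$ of $K$ *dominates* a local subring $S$ if $S\subseteq T$ and $\mathfrak m_T\cap S=\mathfrak m_S$. For a subring $A$ of $K$ and a nonzero ideal $J$ of $A$, $\operatorname{Proj} A[Jt]$ is identified with the set of local rings $A[J/a]_P$, where $0\ne a\in J$ and $P\in\operatorname{Spec}A[J/a]$. The normalized blowup $\operatorname{Proj}\overline{R[It]}$ of $I$ is the set of local rings $B_P$, where $B$ is the integral closure in $K$ of $R[I/a]$, $0\ne a\in I$, and $P\in\operatorname{Spec}B$. The set $\operatorname{Rees} I$ of Rees valuation rings of $I$ consists of those $B_P$ for which $P$ is a minimal prime of $IB$. A *local quadratic transform* of a local ring $S$ is a local ring on $\operatorname{Proj}S[\mathfrak m_St]$ that dominates $S$. A regular local ring $S$ is *infinitely near* to $R$ if $\dim S\ge 2$ and $S$ is obtained from $R$ by a finite (possibly empty) sequence of local quadratic transforms. It is a *base point* of $I$ if the transform $I^S=a^{-1}IS$ is a proper ideal of $S$, where $aS$ is the smallest principal ideal of $S$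 containing $IS$. Let $\Gamma$ be the set of base points of $I$, and assume that $\Gamma$ is finite. For $R_i\in\Gamma$ let $\operatorname{ord}_{R_i}$ denote the valuation ring in $K$ of the order function $x\mapsto\sup\{n: x\in\mathfrak m_{R_i}^n\}$. Let $X_\Gamma$ be the model obtained from $\operatorname{Spec}R$ by successively blowing up the points of $\Gamma$: $X_0=\operatorname{Spec}R$ (the set of all $R_P$), $X_{k+1}$ is obtained from $X_k$ by blowing up the maximal ideals of the points in $\Gamma\cap X_k$, and $X_\Gamma=X_k$ for $k\gg0$. Let $f:X_\Gamma\to\operatorname{Proj}\overline{R[It]}$ be the morphism that sends $T$ to the local ring dominated by $T$; $f$ is *biregular at* $S$ if $f^{-1}(S)=\{S\}$. Assume that $\operatorname{ord}_{R_i}\in\operatorname{Rees}I$ for every $R_i\in\Gamma$. If $S\in\operatorname{Proj}\overline{R[It]}$ is contained in $\operatorname{ord}_{R_i}$ for at most one $R_i\in\Gamma$, then the divisor class group of $S$ (Weil divisors modulo principal divisors) is a torsion group, and $f$ is biregular at $S$. -/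

import Mathlib

open IsLocalRing

namespace BlowupModel

noncomputable section

variable {K : Type*} [Field K]

/-! Models are sets of local subrings of a fixed field `K`. The order `S ≤ T` on
`LocalSubring K` is domination: `S ⊆ T` and the maximal ideal of `T` contracts to that of `S`. -/

/-- The affine model of a subring `A` of `K`: all localizations `A_P`, `P ∈ Spec A`. -/
def affineModel (A : Subring K) : Set (LocalSubring K) :=
  {S | ∃ (P : Ideal A) (_ : P.IsPrime), S = LocalSubring.ofPrime A P}

/-- The extension `J B` of an ideal `J` of `A` to a subring `B` of `K` containing `A`. -/
def extendIdeal (A : Subring K) (J : Ideal A) (B : Subring K) : Ideal B :=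
  Ideal.span {b : B | ∃ x ∈ J, (b : K) = (x : K)}

/-- The chart `A[J/a]` of the blowup of `J`. -/
def blowupChart (A : Subring K) (J : Ideal A) (a : A) : Subring K :=
  (Algebra.adjoin A {z : K | ∃ x ∈ J, z = (x : K) / (a : K)}).toSubring

/-- The integral closure in `K` of the chart `A[J/a]`. -/
def normalizedChart (A : Subring K) (J : Ideal A) (a : A) : Subring K :=
  (integralClosure (blowupChart A J a) K).toSubring

/-- The blowup `Proj A[Jt]`: the union of the affine models of the charts `A[J/a]`,
`0 ≠ a ∈ J`. -/
def blowup (A : Subring K) (J : Ideal A) : Set (LocalSubring K) :=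
  {S | ∃ a ∈ J, a ≠ 0 ∧ S ∈ affineModel (blowupChart A J a)}

/-- The normalized blowup (the `Proj` of the integral closure of the Rees algebra `A[Jt]`, for `A`
normal with fraction field `K`): the degree-zero part of the localization of that integral closure
at `at` is the integral closure of `A[J/a]`, so this is the union of the affine models of the
integral closures of the charts. -/
def normalizedBlowup (A : Subring K) (J : Ideal A) : Set (LocalSubring K) :=
  {S | ∃ a ∈ J, a ≠ 0 ∧ S ∈ affineModel (normalizedChart A J a)}

/-- The Rees valuation rings of `J`: localizations of the normalized charts at the minimal primes
of the extension of `J`. -/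
def reesValuationRings (A : Subring K) (J : Ideal A) : Set (LocalSubring K) :=
  {V | ∃ a ∈ J, a ≠ 0 ∧ ∃ (P : Ideal (normalizedChart A J a)) (_ : P.IsPrime),
    P ∈ (extendIdeal A J (normalizedChart A J a)).minimalPrimes ∧
      V = LocalSubring.ofPrime (normalizedChart A J a) P}

/-- `T` is a local quadratic transform of `S`: a point of the blowup of the maximal ideal of `S`
that dominates `S`. -/
def IsLocalQuadraticTransform (S T : LocalSubring K) : Prop :=
  S ≤ T ∧ T ∈ blowup S.toSubring (maximalIdeal S.toSubring)

/-- `S` is infinitely near to `R`: a regular local ring of dimension at least two obtained from `R`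
by a finite, possibly empty, sequence of local quadratic transforms. -/
def IsInfinitelyNear (R S : LocalSubring K) : Prop :=
  IsRegularLocalRing S.toSubring ∧ 2 ≤ ringKrullDim S.toSubring ∧
    Relation.ReflTransGen IsLocalQuadraticTransform R S

/-- `J = a⁻¹ I S`, where `a S` is the smallest principal ideal of `S` containing `I S`. -/
def IsTransform (R S : LocalSubring K) (I : Ideal R.toSubring) (J : Ideal S.toSubring) : Prop :=
  ∃ a : S.toSubring, a ≠ 0 ∧
    IsLeast {L : Ideal S.toSubring | extendIdeal R.toSubring I S.toSubring ≤ L ∧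
      ∃ b, L = Ideal.span {b}} (Ideal.span {a}) ∧
    extendIdeal R.toSubring I S.toSubring = Ideal.span {a} * J

/-- The set `BP(I)` of base points of `I`: infinitely near points in which the transform of `I`
is a proper ideal. -/
def basePoints (R : LocalSubring K) (I : Ideal R.toSubring) : Set (LocalSubring K) :=
  {S | IsInfinitelyNear R S ∧ ∃ J : Ideal S.toSubring, IsTransform R S I J ∧ J ≠ ⊤}

/-- The order function of a local ring, `x ↦ sup {n | x ∈ 𝔪ⁿ}`. -/
def order (S : LocalSubring K) (x : S.toSubring) : ℕ∞ :=
  ⨆ n ∈ {n : ℕ | x ∈ maximalIdeal S.toSubring ^ n}, (n : ℕ∞)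

/-- The order valuation ring: the quotients `x / y` with `ord y ≤ ord x`. -/
def orderValuationRing (S : LocalSubring K) : Set K :=
  {z | ∃ x y : S.toSubring, y ≠ 0 ∧ order S y ≤ order S x ∧ z = (x : K) / (y : K)}

/-- Blow up the points of the model `M` that lie in `Γ`: each such point is replaced by
its local quadratic transforms, the other points are kept. (Stalkwise, this is the blowup of the
ideal sheaf whose stalk is the maximal ideal at the points in `Γ`, and the unit ideal elsewhere.) -/
def blowupPoints (Γ M : Set (LocalSubring K)) : Set (LocalSubring K) :=
  {T | (T ∈ M ∧ T ∉ Γ) ∨ ∃ S ∈ M, S ∈ Γ ∧ IsLocalQuadraticTransform S T}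

/-- `X₀ = Spec R`, and `Xₖ₊₁` is obtained from `Xₖ` by blowing up the points of `Γ` on `Xₖ`. -/
def stage (R : LocalSubring K) (Γ : Set (LocalSubring K)) : ℕ → Set (LocalSubring K)
  | 0 => affineModel R.toSubring
  | k + 1 => blowupPoints Γ (stage R Γ k)

/-- The saturated regular model `X_Γ`: the final value of the sequence `Xₖ`, which for the finite
set of base points of an ideal is constant once every point of `Γ` has been blown up. -/
def saturatedModel (R : LocalSubring K) (Γ : Set (LocalSubring K)) : Set (LocalSubring K) :=
  {T | ∀ᶠ k in Filter.atTop, T ∈ stage R Γ k}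

/-- The fibre over `S` of the domination morphism from the model `X`, which sends `T` to
the point dominated by `T`. -/
def fiber (X : Set (LocalSubring K)) (S : LocalSubring K) : Set (LocalSubring K) :=
  {T | T ∈ X ∧ S ≤ T}

/-- The domination morphism from `X` is biregular at the point `S` of its target. -/
def IsBiregularAt (X : Set (LocalSubring K)) (S : LocalSubring K) : Prop :=
  fiber X S = {S}

/-- The height one primes of a ring. -/
def HeightOnePrime (A : Type*) [CommRing A] : Type _ :=
  {P : Ideal A // P.IsPrime ∧ P.height = 1}

/-- The order of vanishing of `x` along a height one prime `P`, i.e. the length of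
`A_P / x A_P`; for `A` normal this is the normalized discrete valuation of `A_P`. -/
def ordAlong {A : Type*} [CommRing A] (P : HeightOnePrime A) (x : A) : ℕ∞ :=
  haveI := P.2.1
  Ring.ord (Localization.AtPrime P.1) (algebraMap A (Localization.AtPrime P.1) x)

/-- The group of principal divisors, generated by the divisors of the nonzero elements of `A`
(so it contains the divisors of all nonzero fractions). -/
def principalDivisors (A : Type*) [CommRing A] : AddSubgroup (HeightOnePrime A →₀ ℤ) :=
  AddSubgroup.closure {D | ∃ x : A, x ≠ 0 ∧ ∀ P, ∃ n : ℕ, ordAlong P x = n ∧ D P = n}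

/-- The divisor class group of a normal domain: Weil divisors modulo principal divisors. -/
abbrev DivisorClassGroup (A : Type*) [CommRing A] : Type _ :=
  (HeightOnePrime A →₀ ℤ) ⧸ principalDivisors A

end

end BlowupModel

/-! ### Regular local rings: quotients, domains, normality -/

section RegularBasic

variable {R : Type*} [CommRing R]

/-! The class group is in fact trivial: `S` is itself a point of some stage of the blowup sequence,
so it is a localization of `R` or a regular local ring, and both are factorial.

Two facts about the stages carry this. First, let a valuation ring `V` dominate `S`. Its centres on
the stages leave the finite set `Γ`, because a local quadratic transform of a regular local ring of
dimension at least two is strictly larger. At a centre `T` outside `Γ` the ideal `I T` is principal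
and `T` is normal, so `T` contains the normalized chart and dominates `S`
(`exists_mem_stage_notMem_le_of_le`). Secondly, a discrete valuation ring that is a localization of
a point of a stage is a localization of `R` or the order valuation ring of a point of `Γ`, since
blowing up a regular local ring adds one exceptional divisor, whose valuation is the order function.
Together they show that `S` is the intersection of the divisorial rings containing it
(`mem_of_forall_mem_divisorialRings`).

The core is `eq_of_mem_stage_of_le`: a point `T` of a stage that dominates `S` equals `S`. Let `y /
w` be an element of `T`, reduced over `R`, and let `a` be the denominator of a chart containing `S`.
The localizations of `R` among the divisorial rings over `S` invert `a`, as `I` is primary to the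
maximal ideal, and invert one of `y`, `w`. By hypothesis at most one order valuation ring contains
`S`; there a positive power of whichever of `y`, `w` has the smaller value has the value of a power
of `a`. Hence, for suitable `N > 0` and `j`, the elements `c = w ^ N / a ^ j` and `d = y ^ N / a ^
j` lie in every divisorial ring over `S`, so in `S`, and one of them is a unit in each such ring.
Were `c` a nonunit of `S`, it would be a nonunit of `T`, and a height one prime of `T` over `c`
would also contain `d = (y / w) ^ N * c`, which is impossible. So `(y / w) ^ N` lies in `S`, and
normality gives `y / w` in `S`.

The commutative algebra behind this is that regular local rings are normal and factorial
(`IsRegularLocalRing.uniqueFactorizationMonoid`), that their local quadratic transforms are regular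
(`IsBlowupChart.isRegularLocalRing`), and that the order function is the adic order along the
exceptional divisor (`IsBlowupChart.mem_pow_iff`). -/

theorem IsLocalRing.exists_generator_isUnit_coeff [IsLocalRing R] {ι : Type*} (s : Finset ι)
    (g : ι → R) (hg : ∀ i ∈ s, g i ∈ maximalIdeal R) (c : ι → R)
    (hx : ∑ i ∈ s, c i * g i ∉ maximalIdeal R ^ 2) : ∃ i ∈ s, IsUnit (c i) := by
  by_contra! h
  refine hx (Ideal.sum_mem _ fun i hi ↦ ?_)
  rw [pow_two]
  exact Ideal.mul_mem_mul ((mem_maximalIdeal _).2 (h i hi)) (hg i hi)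

theorem IsLocalRing.map_maximalIdeal_eq_of_surjective {S : Type*} [CommRing S] [IsLocalRing R]
    [IsLocalRing S] (f : R →+* S) (hf : Function.Surjective f) :
    (maximalIdeal R).map f = maximalIdeal S := by
  refine le_antisymm ?_ fun y hy ↦ ?_
  · have := IsLocalHom.of_surjective f hf
    exact Ideal.map_le_iff_le_comap.2 (maximalIdeal_comap f).ge
  · obtain ⟨y, rfl⟩ := hf y
    exact Ideal.mem_map_of_mem _ ((mem_maximalIdeal _).2 fun h ↦
      (mem_maximalIdeal _).1 hy (h.map f))

/-- As `x` avoids the square of the maximal ideal, it can replace a minimal generator, so the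
embedding dimension drops by at least one. The Krull dimension drops by at most one, and regularity
of `R` forces equality throughout. -/
theorem IsRegularLocalRing.quotient_span_singleton [IsRegularLocalRing R] {x : R}
    (hx : x ∈ maximalIdeal R) (hx2 : x ∉ maximalIdeal R ^ 2) :
    ∃ _ : IsRegularLocalRing (R ⧸ Ideal.span {x}),
      (maximalIdeal (R ⧸ Ideal.span {x})).spanFinrank + 1 = (maximalIdeal R).spanFinrank := by
  classical
  have hne : Ideal.span {x} ≠ ⊤ := by
    rwa [Ne, Ideal.span_singleton_eq_top, ← mem_nonunits_iff, ← mem_maximalIdeal]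
  have : Nontrivial (R ⧸ Ideal.span {x}) := Ideal.Quotient.nontrivial_iff.2 hne
  have : IsLocalRing (R ⧸ Ideal.span {x}) := .of_surjective' _ Ideal.Quotient.mk_surjective
  obtain ⟨s, hs, hspan⟩ := Submodule.FG.exists_span_finset_card_eq_spanFinrank
    (maximalIdeal R).fg_of_isNoetherianRing
  have hsm : ∀ i ∈ s, i ∈ maximalIdeal R := fun i hi ↦ hspan ▸ Submodule.subset_span hi
  obtain ⟨c, hc⟩ : ∃ c : R → R, ∑ i ∈ s, c i * i = x := by
    have : x ∈ Submodule.span R (s : Set R) := hspan ▸ hx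
    obtain ⟨c, -, hc⟩ := Submodule.mem_span_finset.1 this
    exact ⟨c, by simpa using hc⟩
  obtain ⟨g, hgs, hgu⟩ := IsLocalRing.exists_generator_isUnit_coeff s id hsm c (by simpa [hc])
  set mk := Ideal.Quotient.mk (Ideal.span {x})
  have hmap : maximalIdeal (R ⧸ Ideal.span {x}) = (maximalIdeal R).map mk :=
    (IsLocalRing.map_maximalIdeal_eq_of_surjective mk Ideal.Quotient.mk_surjective).symm
  have hle : maximalIdeal (R ⧸ Ideal.span {x}) ≤
      Ideal.span (((s.erase g).image mk : Finset _) : Set (R ⧸ Ideal.span {x})) := by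
    rw [hmap, ← hspan]
    change (Ideal.span _).map mk ≤ _
    rw [Ideal.map_span, Ideal.span_le]
    rintro _ ⟨i, hi, rfl⟩
    by_cases hig : i = g
    · subst hig
      -- The relation expressing `x` vanishes modulo `x`, and its unit coefficient solves for the
      -- image of the removed generator.
      have h0 : mk (∑ i ∈ s, c i * i) = 0 := by
        rw [hc]; exact Ideal.Quotient.eq_zero_iff_mem.2 (Ideal.mem_span_singleton_self x)
      rw [← Finset.add_sum_erase _ _ hgs, map_add, map_mul, map_sum] at h0
      have : mk (c i) * mk i ∈ Ideal.span (((s.erase i).image mk : Finset _) :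
          Set (R ⧸ Ideal.span {x})) := by
        rw [eq_neg_of_add_eq_zero_left h0]
        refine Ideal.neg_mem_iff _ |>.2 (Ideal.sum_mem _ fun j hj ↦ ?_)
        rw [map_mul]
        exact Ideal.mul_mem_left _ _ (Ideal.subset_span (by
          simpa using ⟨j, by simpa [and_comm] using hj, rfl⟩))
      exact (Ideal.unit_mul_mem_iff_mem _ (hgu.map mk)).1 this
    · exact Ideal.subset_span (by simpa using ⟨i, ⟨hi, hig⟩, rfl⟩)
  have heq : maximalIdeal (R ⧸ Ideal.span {x}) =
      Ideal.span (((s.erase g).image mk : Finset _) : Set (R ⧸ Ideal.span {x})) := by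
    refine hle.antisymm ?_
    rw [Ideal.span_le, hmap]
    intro y hy
    obtain ⟨i, hi, rfl⟩ := Finset.mem_image.1 (Finset.mem_coe.1 hy)
    exact Ideal.mem_map_of_mem _ (hsm _ (Finset.mem_of_mem_erase hi))
  have hrank : (maximalIdeal (R ⧸ Ideal.span {x})).spanFinrank + 1 ≤
      (maximalIdeal R).spanFinrank := by
    have h1 : (maximalIdeal (R ⧸ Ideal.span {x})).spanFinrank ≤ (s.erase g).card := by
      rw [heq]
      refine (Submodule.spanFinrank_span_le_ncard_of_finite (Finset.finite_toSet _)).trans ?_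
      rw [Set.ncard_coe_finset]
      exact Finset.card_image_le
    rw [← hs, ← Finset.card_erase_add_one hgs]
    omega
  have hdim : ringKrullDim R ≤ ringKrullDim (R ⧸ Ideal.span {x}) + 1 := by
    have := ringKrullDim_le_ringKrullDim_quotient_add_encard ({x} : Set R)
      (by simpa [IsLocalRing.ringJacobson_eq_maximalIdeal] using! hx)
    simpa using this
  have hreg := (isRegularLocalRing_iff R).1 inferInstance
  have hdim2 := ringKrullDim_le_spanFinrank_maximalIdeal (R ⧸ Ideal.span {x})
  rw [← hreg] at hdim
  have h3 : ((maximalIdeal R).spanFinrank : WithBot ℕ∞) ≤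
      ((maximalIdeal (R ⧸ Ideal.span {x})).spanFinrank + 1 : ℕ) := by
    push_cast
    exact hdim.trans (by gcongr)
  have h4 : (maximalIdeal R).spanFinrank ≤
      (maximalIdeal (R ⧸ Ideal.span {x})).spanFinrank + 1 := by exact_mod_cast h3
  refine ⟨IsRegularLocalRing.of_spanFinrank_maximalIdeal_le _ ?_, le_antisymm hrank h4⟩
  have h5 : (((maximalIdeal (R ⧸ Ideal.span {x})).spanFinrank + 1 : ℕ) : WithBot ℕ∞) ≤
      ringKrullDim (R ⧸ Ideal.span {x}) + 1 := le_trans (by exact_mod_cast hrank) hdim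
  push_cast at h5
  exact (ENat.WithBot.add_le_add_one_right_iff).1 h5

theorem IsRegularLocalRing.spanFinrank_eq_zero_iff [IsRegularLocalRing R] :
    (maximalIdeal R).spanFinrank = 0 ↔ IsField R := by
  rw [isField_iff_maximalIdeal_eq]
  exact Submodule.spanFinrank_eq_zero_iff_eq_bot (maximalIdeal R).fg_of_isNoetherianRing

/-- Prime avoidance, with the square of the maximal ideal as the permitted non-prime. If the maximal
ideal equals its square, Nakayama makes it zero; if it is a minimal prime, the dimension is zero.
Either way `R` is a field. -/
theorem IsRegularLocalRing.exists_mem_maximalIdeal [IsRegularLocalRing R] (h : ¬ IsField R) :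
    ∃ x ∈ maximalIdeal R, x ∉ maximalIdeal R ^ 2 ∧ ∀ P ∈ minimalPrimes R, x ∉ P := by
  by_contra! H
  have hsub : (maximalIdeal R : Set R) ⊆
      ⋃ i ∈ insert (maximalIdeal R ^ 2) (minimalPrimes R), (id i : Ideal R) := by
    intro x hx
    simp only [Set.mem_iUnion]
    by_cases hx2 : x ∈ maximalIdeal R ^ 2
    · exact ⟨_, Set.mem_insert _ _, hx2⟩
    · obtain ⟨P, hP, hxP⟩ := H x hx hx2
      exact ⟨P, Set.mem_insert_of_mem _ hP, hxP⟩
  rw [Ideal.subset_union_prime_finite (f := id)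
    ((minimalPrimes.finite_of_isNoetherianRing R).insert _)
    (maximalIdeal R ^ 2) (maximalIdeal R ^ 2)
    fun i hi hne _ ↦ (hi.resolve_left hne).1.1] at hsub
  obtain ⟨P, rfl | hP, hle⟩ := hsub
  · refine h (isField_iff_maximalIdeal_eq.2 ?_)
    refine Submodule.eq_bot_of_le_smul_of_le_jacobson_bot (maximalIdeal R) _
      (maximalIdeal R).fg_of_isNoetherianRing ?_ (maximalIdeal_le_jacobson _)
    simpa [pow_two] using hle
  · have := hP.1.1
    have hPm : P = maximalIdeal R := (le_maximalIdeal this.ne_top).antisymm hle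
    have h0 : (maximalIdeal R).height = 0 := by
      rw [Ideal.height_eq_zero_iff]
      exact hPm ▸ hP
    refine h (spanFinrank_eq_zero_iff.1 ?_)
    have h1 := (isRegularLocalRing_iff R).1 inferInstance
    rw [← maximalIdeal_height_eq_ringKrullDim, h0] at h1
    exact_mod_cast h1

/-- By induction `R/x` is a domain, so `(x)` is prime. A minimal prime `P` inside `(x)` does not
contain `x`, hence `P = xP`, and Nakayama gives `P = 0`. -/
theorem IsRegularLocalRing.isDomain_and_forall_prime (n : ℕ) : ∀ (R : Type*) [CommRing R]
    [IsRegularLocalRing R], (maximalIdeal R).spanFinrank = n → IsDomain R := by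
  induction n with
  | zero =>
    intro R _ _ h
    exact (spanFinrank_eq_zero_iff.1 h).isDomain
  | succ n ih =>
    intro R _ _ h
    have hf : ¬ IsField R := by rw [← spanFinrank_eq_zero_iff]; omega
    obtain ⟨x, hx, hx2, hxP⟩ := exists_mem_maximalIdeal hf
    obtain ⟨_, hq⟩ := quotient_span_singleton hx hx2
    have := ih (R ⧸ Ideal.span {x}) (by omega)
    have hprime : (Ideal.span {x}).IsPrime := (Ideal.Quotient.isDomain_iff_prime _).1 this
    obtain ⟨P, hP, hPx⟩ := Ideal.exists_minimalPrimes_le (I := ⊥) (J := Ideal.span {x}) bot_le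
    have hPp := hP.1.1
    have hbot : P = ⊥ := by
      refine Submodule.eq_bot_of_le_smul_of_le_jacobson_bot (maximalIdeal R) _
        P.fg_of_isNoetherianRing (fun p hp ↦ ?_) (maximalIdeal_le_jacobson _)
      obtain ⟨r, rfl⟩ := Ideal.mem_span_singleton.1 (hPx hp)
      have : r ∈ P := (hPp.mem_or_mem hp).resolve_left (hxP P hP)
      exact Ideal.mul_mem_mul hx this
    have : (⊥ : Ideal R).IsPrime := hbot ▸ hPp
    exact IsDomain.of_bot_isPrime R

instance IsRegularLocalRing.isDomain [IsRegularLocalRing R] : IsDomain R :=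
  isDomain_and_forall_prime _ R rfl

theorem IsRegularLocalRing.prime_of_mem_of_notMem [IsRegularLocalRing R] {x : R}
    (hx : x ∈ maximalIdeal R) (hx2 : x ∉ maximalIdeal R ^ 2) : Prime x := by
  obtain ⟨_, -⟩ := quotient_span_singleton hx hx2
  have h0 : x ≠ 0 := by rintro rfl; simp at hx2
  rw [← Ideal.span_singleton_prime h0, ← Ideal.Quotient.isDomain_iff_prime]
  infer_instance

/-- Complete integral closedness, stated without fractions so that it lifts from `R/x`. The point is
to write `a` as `b * c + x ^ n * r` for every `n`: each step strips the powers of `x` from the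
remainder, `b` and `d` and divides modulo `x`. Krull's intersection theorem in `R/b` then gives `b ∣
a`. -/
theorem Prime.dvd_of_forall_pow_dvd [IsDomain R] [IsLocalRing R] [IsNoetherianRing R] {x : R}
    (hxp : Prime x)
    (H : ∀ a b d : R ⧸ Ideal.span {x}, b ≠ 0 → d ≠ 0 → (∀ k : ℕ, b ^ k ∣ d * a ^ k) → b ∣ a)
    {a b d : R} (hb : b ≠ 0) (hd : d ≠ 0) (h : ∀ k : ℕ, b ^ k ∣ d * a ^ k) : b ∣ a := by
  have hfin : ∀ y : R, y ≠ 0 → ∃ (n : ℕ) (y0 : R), ¬ x ∣ y0 ∧ y = x ^ n * y0 := fun y hy ↦ by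
    obtain ⟨c, hc, hxc⟩ := (FiniteMultiplicity.of_not_isUnit
      hxp.not_isUnit hy).exists_eq_pow_mul_and_not_dvd
    exact ⟨_, c, hxc, hc⟩
  have key : ∀ n : ℕ, ∃ c r, a = b * c + x ^ n * r := by
    intro n
    induction n with
    | zero => exact ⟨0, a, by simp⟩
    | succ n ih =>
      obtain ⟨c, r, hcr⟩ := ih
      obtain ⟨a', ha'⟩ : ∃ a', a' = a - b * c := ⟨_, rfl⟩
      -- By the binomial theorem, subtracting a multiple of `b` from `a` preserves the hypothesis.
      have h' : ∀ k : ℕ, b ^ k ∣ d * a' ^ k := by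
        intro k
        rw [ha', sub_eq_add_neg, add_pow, Finset.mul_sum]
        refine Finset.dvd_sum fun i hi ↦ ?_
        have hik : i + (k - i) = k := by have := Finset.mem_range.1 hi; omega
        rw [show d * (a ^ i * (-(b * c)) ^ (k - i) * (k.choose i)) =
          (d * a ^ i) * (b ^ (k - i) * ((-c) ^ (k - i) * (k.choose i))) by
            rw [← mul_neg, mul_pow]; ring]
        conv_lhs => rw [← hik, pow_add]
        exact mul_dvd_mul (h i) (dvd_mul_right _ _)
      by_cases ha0 : a' = 0
      · exact ⟨c, 0, by rw [mul_zero, add_zero]; exact sub_eq_zero.1 (ha' ▸ ha0)⟩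
      obtain ⟨p, a0, hxa, hpa⟩ := hfin a' ha0
      obtain ⟨q, b0, hxb, hqb⟩ := hfin b hb
      obtain ⟨s, d0, hxd, hsd⟩ := hfin d hd
      have hnp : n ≤ p := by
        have : x ^ n ∣ x ^ p * a0 := by
          rw [← hpa, ha']; exact ⟨r, by rw [hcr]; ring⟩
        have := hxp.pow_dvd_of_dvd_mul_right n hxa this
        exact (pow_dvd_pow_iff hxp.ne_zero hxp.not_isUnit).1 this
      have hda : ∀ k, ¬ x ∣ d0 * a0 ^ k := fun k hk ↦
        (hxp.dvd_or_dvd hk).elim hxd fun h ↦ hxa (hxp.dvd_of_dvd_pow h)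
      have hexp : ∀ k, d * a' ^ k = x ^ (s + p * k) * (d0 * a0 ^ k) := fun k ↦ by
        rw [hsd, hpa]; ring
      have hbk : ∀ k, b ^ k = x ^ (q * k) * b0 ^ k := fun k ↦ by rw [hqb]; ring
      have hle : ∀ k, q * k ≤ s + p * k := by
        intro k
        have : x ^ (q * k) ∣ x ^ (s + p * k) * (d0 * a0 ^ k) := by
          rw [← hexp]; exact (Dvd.intro _ (hbk k).symm).trans (h' k)
        have := hxp.pow_dvd_of_dvd_mul_right _ (hda k) this
        exact (pow_dvd_pow_iff hxp.ne_zero hxp.not_isUnit).1 this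
      have hqp : q ≤ p := by
        by_contra! hlt
        -- If `p + 1 ≤ q`, the exponent `k = s + 1` gives `(p + 1) * (s + 1) ≤ s + p * (s + 1)`,
        -- that is `s + 1 ≤ s`.
        have := hle (s + 1)
        nlinarith
      have hdvd : ∀ k, b0 ^ k ∣ d0 * a0 ^ k := by
        intro k
        obtain ⟨e, he⟩ := h' k
        obtain ⟨t, ht⟩ := Nat.exists_eq_add_of_le (hle k)
        rw [hexp, hbk, ht, pow_add, mul_assoc, mul_assoc] at he
        have he := mul_left_cancel₀ (pow_ne_zero _ hxp.ne_zero) he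
        have hxt : x ^ t ∣ b0 ^ k * e := ⟨_, he.symm⟩
        obtain ⟨e', rfl⟩ := hxp.pow_dvd_of_dvd_mul_left t
          (fun h ↦ hxb (hxp.dvd_of_dvd_pow h)) hxt
        refine ⟨e', mul_left_cancel₀ (pow_ne_zero t hxp.ne_zero) ?_⟩
        rw [he]; ring
      have hmk : ∀ y : R, Ideal.Quotient.mk (Ideal.span {x}) y = 0 ↔ x ∣ y := fun y ↦ by
        rw [Ideal.Quotient.eq_zero_iff_mem, Ideal.mem_span_singleton]
      obtain ⟨c', hc'⟩ := H (Ideal.Quotient.mk _ a0) (Ideal.Quotient.mk _ b0)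
        (Ideal.Quotient.mk _ d0) (by rwa [Ne, hmk]) (by rwa [Ne, hmk]) (fun k ↦ by
          simpa using map_dvd (Ideal.Quotient.mk (Ideal.span {x})) (hdvd k))
      obtain ⟨c', rfl⟩ := Ideal.Quotient.mk_surjective c'
      rw [← map_mul, ← sub_eq_zero, ← map_sub, hmk] at hc'
      obtain ⟨r', hr'⟩ := hc'
      obtain ⟨t, rfl⟩ := Nat.exists_eq_add_of_le hqp
      obtain ⟨u, hu⟩ := Nat.exists_eq_add_of_le hnp
      refine ⟨c + x ^ t * c', x ^ u * r', ?_⟩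
      have h1 : a = b * c + a' := by rw [ha']; ring
      have h2 : a0 = b0 * c' + x * r' := by rw [← hr']; ring
      have e1 : x ^ (q + t) * (x * r') = x ^ (n + 1) * (x ^ u * r') := by rw [hu]; ring
      have e2 : x ^ (q + t) * (b0 * c') = b * (x ^ t * c') := by rw [hqb]; ring
      rw [h1, hpa, h2, mul_add, mul_add, e1, e2, add_assoc]
  by_cases hbu : IsUnit b
  · exact hbu.dvd
  rw [← Ideal.mem_span_singleton, ← Ideal.Quotient.eq_zero_iff_mem]
  have : Nontrivial (R ⧸ Ideal.span {b}) := Ideal.Quotient.nontrivial_iff.2 (by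
    rwa [Ne, Ideal.span_singleton_eq_top])
  have : IsLocalRing (R ⧸ Ideal.span {b}) := .of_surjective' _ Ideal.Quotient.mk_surjective
  have hbot := Ideal.iInf_pow_eq_bot_of_isLocalRing (maximalIdeal (R ⧸ Ideal.span {b}))
    (maximalIdeal.isMaximal _).ne_top
  rw [← Ideal.mem_bot, ← hbot, Ideal.mem_iInf]
  intro n
  obtain ⟨c, r, hcr⟩ := key n
  have hb0 : Ideal.Quotient.mk (Ideal.span {b}) b = 0 :=
    Ideal.Quotient.eq_zero_iff_mem.2 (Ideal.mem_span_singleton_self b)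
  rw [hcr, map_add, map_mul, hb0, zero_mul, zero_add, map_mul, map_pow]
  refine Ideal.mul_mem_right _ _ (Ideal.pow_mem_pow ?_ n)
  rw [← IsLocalRing.map_maximalIdeal_eq_of_surjective _ Ideal.Quotient.mk_surjective]
  exact Ideal.mem_map_of_mem _ ((mem_maximalIdeal _).2 hxp.not_isUnit)

theorem IsRegularLocalRing.dvd_of_forall_pow_dvd (n : ℕ) : ∀ (R : Type*) [CommRing R]
    [IsRegularLocalRing R], (maximalIdeal R).spanFinrank = n → ∀ a b d : R, b ≠ 0 → d ≠ 0 →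
      (∀ k : ℕ, b ^ k ∣ d * a ^ k) → b ∣ a := by
  induction n with
  | zero =>
    intro R _ _ h a b d hb _ _
    obtain ⟨c, hc⟩ := (spanFinrank_eq_zero_iff.1 h).mul_inv_cancel hb
    exact (IsUnit.of_mul_eq_one _ hc).dvd
  | succ n ih =>
    intro R _ _ h a b d hb hd hk
    have hf : ¬ IsField R := by rw [← spanFinrank_eq_zero_iff]; omega
    obtain ⟨x, hx, hx2, -⟩ := exists_mem_maximalIdeal hf
    obtain ⟨_, hq⟩ := quotient_span_singleton hx hx2
    exact (prime_of_mem_of_notMem hx hx2).dvd_of_forall_pow_dvd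
      (ih (R ⧸ Ideal.span {x}) (by omega)) hb hd hk

theorem IsRegularLocalRing.isIntegrallyClosed [IsRegularLocalRing R] : IsIntegrallyClosed R := by
  rw [isIntegrallyClosed_iff (FractionRing R)]
  intro z hz
  obtain ⟨d, hd, h⟩ := hz.isAlmostIntegral
  obtain ⟨a, b, hb, rfl⟩ := IsFractionRing.div_surjective (A := R) z
  have hb0 : algebraMap R (FractionRing R) b ≠ 0 :=
    IsFractionRing.to_map_ne_zero_of_mem_nonZeroDivisors hb
  obtain ⟨c, rfl⟩ := dvd_of_forall_pow_dvd _ R rfl a b d (nonZeroDivisors.ne_zero hb)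
    (nonZeroDivisors.ne_zero hd) fun k ↦ by
      obtain ⟨e, he⟩ := h k
      refine ⟨e, FaithfulSMul.algebraMap_injective R (FractionRing R) ?_⟩
      rw [map_mul, map_mul, map_pow, map_pow, he, Algebra.smul_def, div_pow]
      field_simp
  exact ⟨c, by rw [map_mul]; field_simp⟩

end RegularBasic

/-! ### Noetherian normal domains -/

section NormalNoetherian

variable {R : Type*} [CommRing R] [IsDomain R] [IsNoetherianRing R]

/-- If multiplication by `z / a` mapped `P` into itself, then `w * (z / a) ^ k` would lie in `R` for
all `k`, so `z / a` would be almost integral, hence integral, hence in `R`. -/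
theorem IsIntegrallyClosed.exists_notMem_of_annihilator [IsIntegrallyClosed R] {a z w : R}
    (ha : a ≠ 0) (hz : ¬ a ∣ z) (P : Ideal R) (hP : ∀ r, r ∈ P ↔ a ∣ r * z)
    (hw : w ∈ P) (hw0 : w ≠ 0) : ∃ v ∈ P, ∃ u ∉ P, v * z = a * u := by
  by_contra! H
  have hstep : ∀ v ∈ P, ∃ u ∈ P, v * z = a * u := fun v hv ↦ by
    obtain ⟨u, hu⟩ := (hP v).1 hv
    exact ⟨u, by_contra fun h ↦ H v hv u h hu, hu⟩
  have hpow : ∀ k : ℕ, ∃ u ∈ P, w * z ^ k = a ^ k * u := by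
    intro k
    induction k with
    | zero => exact ⟨w, hw, by simp⟩
    | succ k ih =>
      obtain ⟨u, hu, h⟩ := ih
      obtain ⟨u', hu', h'⟩ := hstep u hu
      exact ⟨u', hu', by rw [pow_succ, ← mul_assoc, h, mul_assoc, h']; ring⟩
  have ha0 : algebraMap R (FractionRing R) a ≠ 0 := by simpa using ha
  have : IsAlmostIntegral R (algebraMap R (FractionRing R) z / algebraMap R _ a) := by
    refine ⟨w, mem_nonZeroDivisors_of_ne_zero hw0, fun k ↦ ?_⟩
    obtain ⟨u, -, h⟩ := hpow k
    refine ⟨u, ?_⟩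
    rw [Algebra.smul_def, div_pow, ← mul_div_assoc, ← map_pow, ← map_pow, ← map_mul, h, map_mul]
    field_simp
  obtain ⟨c, hc⟩ := IsIntegrallyClosed.isIntegral_iff.1 this.isIntegral
  refine hz ⟨c, FaithfulSMul.algebraMap_injective R (FractionRing R) ?_⟩
  rw [map_mul, hc]; field_simp

/-- With `w * z = a * u` and `u` outside `P`, every `v` in `P` satisfies `v * u ∈ (w)`. Thus `w`
generates `P` locally at `P`, and Krull's principal ideal theorem bounds the height. -/
theorem IsIntegrallyClosed.height_eq_one_of_annihilator [IsIntegrallyClosed R] {a z : R}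
    (ha : a ≠ 0) (P : Ideal R) [P.IsPrime] (hP : ∀ r, r ∈ P ↔ a ∣ r * z) : P.height = 1 := by
  have hz : ¬ a ∣ z := fun h ↦ ‹P.IsPrime›.ne_top
    ((Ideal.eq_top_iff_one P).2 ((hP 1).2 (by simpa using h)))
  have haP : a ∈ P := (hP a).2 (dvd_mul_right _ _)
  obtain ⟨w, hw, u, hu, h⟩ := exists_notMem_of_annihilator ha hz P hP haP ha
  have hmin : P ∈ (Ideal.span {w}).minimalPrimes := by
    refine ⟨⟨inferInstance, by simpa [Ideal.span_le] using hw⟩, ?_⟩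
    rintro q ⟨hq, hwq⟩ hqP v hv
    obtain ⟨u', hu'⟩ := (hP v).1 hv
    have : v * u = u' * w := mul_left_cancel₀ ha (by
      calc a * (v * u) = v * (a * u) := by ring
        _ = w * (v * z) := by rw [← h]; ring
        _ = a * (u' * w) := by rw [hu']; ring)
    have hmem : v * u ∈ q := this ▸ q.mul_mem_left _ (hwq (Ideal.mem_span_singleton_self w))
    exact (hq.mem_or_mem hmem).resolve_right fun h ↦ hu (hqP h)
  refine le_antisymm (Ideal.height_le_one_of_isPrincipal_of_mem_minimalPrimes _ P hmin) ?_
  rw [Order.one_le_iff_ne_zero, Ne, Ideal.height_eq_zero_iff, IsDomain.minimalPrimes_eq_singleton_bot]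
  rintro rfl
  exact ha haP

/-- A Noetherian normal domain is the intersection of its localizations at height one primes. -/
theorem IsIntegrallyClosed.dvd_of_forall_height_one [IsIntegrallyClosed R] {a y : R} (ha : a ≠ 0)
    (h : ∀ (q : Ideal R) [q.IsPrime], q.height = 1 → ∃ s ∉ q, a ∣ s * y) : a ∣ y := by
  by_contra hy
  have hmk : ∀ y : R, Ideal.Quotient.mk (Ideal.span {a}) y = 0 ↔ a ∣ y := fun y ↦ by
    rw [Ideal.Quotient.eq_zero_iff_mem, Ideal.mem_span_singleton]
  -- The annihilator of `y` modulo `a` lies in an associated prime of `R/a`. That prime has height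
  -- one, so the hypothesis supplies an annihilating element outside it.
  obtain ⟨P, hass, hle⟩ := exists_le_isAssociatedPrime_of_isNoetherianRing R
    (Ideal.Quotient.mk (Ideal.span {a}) y) (by rwa [Ne, hmk])
  obtain ⟨hPp, z, hz⟩ := isAssociatedPrime_iff.1 hass
  obtain ⟨z, rfl⟩ := Ideal.Quotient.mk_surjective z
  have hcol : ∀ z r : R, r ∈ (⊥ : Submodule R (R ⧸ Ideal.span {a})).colon
      {Ideal.Quotient.mk (Ideal.span {a}) z} ↔ a ∣ r * z := fun z r ↦ by
    rw [Submodule.mem_colon_singleton, Submodule.mem_bot, ← hmk, map_mul]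
    rfl
  obtain ⟨s, hs, hsy⟩ := h P (height_eq_one_of_annihilator (z := z) ha P fun r ↦ by rw [hz, hcol])
  exact hs (hle ((hcol _ _).2 hsy))

theorem IsDiscreteValuationRing.of_ringKrullDim_eq_one [IsLocalRing R] [IsIntegrallyClosed R]
    (h : ringKrullDim R = 1) : IsDiscreteValuationRing R := by
  have hf : ¬ IsField R := fun hf ↦ by
    rw [ringKrullDim_eq_zero_of_isField hf] at h
    exact zero_ne_one h
  rw [← maximalIdeal_height_eq_ringKrullDim] at h
  have h : (IsLocalRing.maximalIdeal R).height = 1 := by exact_mod_cast h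
  have : IsPrincipalIdealRing R := by
    refine ((tfae_of_isNoetherianRing_of_isLocalRing_of_isDomain R).out 0 3 :
      _ ↔ IsIntegrallyClosed R ∧
        ∀ P : Ideal R, P ≠ ⊥ → P.IsPrime → P = IsLocalRing.maximalIdeal R).2
      ⟨inferInstance, fun P hP hPp ↦ ?_⟩
    by_contra hne
    have h1 := Ideal.height_add_one_le_of_lt_of_isPrime
      ((le_maximalIdeal hPp.ne_top).lt_of_ne hne)
    rw [h] at h1
    have h0 : P.height = 0 := by
      by_contra h0
      have h2 := Order.one_le_iff_ne_zero.2 h0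
      have : (1 : ℕ∞) + 1 ≤ 1 := le_trans (by gcongr) h1
      norm_num at this
    rw [Ideal.height_eq_zero_iff, IsDomain.minimalPrimes_eq_singleton_bot] at h0
    exact hP h0
  have : ¬ IsLocalRing.maximalIdeal R = ⊥ := fun h ↦ hf (isField_iff_maximalIdeal_eq.2 h)
  exact { not_a_field' := this }

theorem IsLocalization.AtPrime.isDiscreteValuationRing_of_height_eq_one [IsIntegrallyClosed R]
    (q : Ideal R) [q.IsPrime] (hq : q.height = 1) (A : Type*) [CommRing A] [Algebra R A]
    [IsLocalization.AtPrime A q] [IsDomain A] : IsDiscreteValuationRing A := by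
  have := IsLocalization.AtPrime.isLocalRing A q
  have := IsLocalization.isNoetherianRing q.primeCompl A inferInstance
  have := isIntegrallyClosed_of_isLocalization A q.primeCompl q.primeCompl_le_nonZeroDivisors
  apply IsDiscreteValuationRing.of_ringKrullDim_eq_one
  rw [IsLocalization.AtPrime.ringKrullDim_eq_height q, hq]
  rfl

end NormalNoetherian

/-! ### Finite free resolutions over regular local rings -/

section FreeResolution

universe u

/-- `M` has a resolution of length at most `n` by finite free modules, except that the last module
is only required to be free. -/
def HasFreeResolutionLE (R : Type u) [CommRing R] :
    ℕ → ∀ (M : Type u) [AddCommGroup M] [Module R M], Prop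
  | 0, M, _, _ => Module.Free R M
  | n + 1, M, _, _ => ∃ (m : ℕ) (f : (Fin m → R) →ₗ[R] M), Function.Surjective f ∧
      HasFreeResolutionLE R n (LinearMap.ker f)

variable {R : Type u} [CommRing R]

theorem HasFreeResolutionLE.of_linearEquiv {n : ℕ} {M N : Type u} [AddCommGroup M] [Module R M]
    [AddCommGroup N] [Module R N] (e : M ≃ₗ[R] N) (h : HasFreeResolutionLE R n M) :
    HasFreeResolutionLE R n N := by
  cases n with
  | zero =>
    have : Module.Free R M := h
    exact Module.Free.of_equiv e
  | succ n =>
    obtain ⟨m, f, hf, hK⟩ := h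
    refine ⟨m, e.toLinearMap ∘ₗ f, e.surjective.comp hf, ?_⟩
    rwa [LinearEquiv.ker_comp]

open Pointwise in
-- Lift the generators of `M/xM`; by Nakayama they generate `M`. Since `x` is regular on `M`, the
-- kernel of the lifted map reduces modulo `x` exactly to the old kernel, and `x` is regular on it
-- as well, so induction applies to the syzygies.
theorem HasFreeResolutionLE.of_quotSMulTop [IsDomain R] [IsLocalRing R] [IsNoetherianRing R] {x : R}
    (hx0 : x ≠ 0) (hx : x ∈ maximalIdeal R) {n : ℕ} : ∀ (M : Type u) [AddCommGroup M] [Module R M]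
    [Module.Finite R M], IsSMulRegular M x →
      HasFreeResolutionLE (R ⧸ Ideal.span {x}) n (QuotSMulTop x M) → HasFreeResolutionLE R n M := by
  have hjac : x ∈ (⊥ : Ideal R).jacobson := maximalIdeal_le_jacobson _ hx
  induction n with
  | zero =>
    intro M _ _ _ hreg h
    have := Module.finitePresentation_of_finite R M
    exact (Module.free_quotSMulTop_iff_free R M hjac hreg).1 h
  | succ n ih =>
    rintro M _ _ _ hreg ⟨m, f, hf, hK⟩
    have hlift : ∀ i : Fin m, ∃ y : M, (Submodule.Quotient.mk y : QuotSMulTop x M) =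
      f (Pi.single i 1) := fun i ↦ Submodule.Quotient.mk_surjective _ _
    choose y hy using hlift
    let g : (Fin m → R) →ₗ[R] M := Fintype.linearCombination R y
    let π : (Fin m → R) →ₗ[R] (Fin m → R ⧸ Ideal.span {x}) :=
      LinearMap.pi fun i ↦ (Algebra.linearMap R (R ⧸ Ideal.span {x})) ∘ₗ LinearMap.proj i
    have hπ : ∀ v i, π v i = Ideal.Quotient.mk _ (v i) := fun v i ↦ rfl
    have hπs : Function.Surjective π := fun v ↦ by
      choose w hw using fun i ↦ Ideal.Quotient.mk_surjective (v i)
      exact ⟨w, funext fun i ↦ by rw [hπ, hw]⟩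
    have hfg : ∀ v, f (π v) = Submodule.Quotient.mk (g v) := by
      intro v
      have : (f.restrictScalars R) ∘ₗ π = (Submodule.mkQ (x • (⊤ : Submodule R M))) ∘ₗ g := by
        refine LinearMap.pi_ext' fun i ↦ LinearMap.ext_ring ?_
        have h1 : π (Pi.single i 1) = Pi.single i 1 := by
          ext j
          rw [hπ]
          by_cases hij : j = i
          · subst hij; simp
          · simp [hij]
        simp only [LinearMap.comp_apply, LinearMap.single_apply, LinearMap.restrictScalars_apply, h1]
        rw [← hy]
        simp [g, Fintype.linearCombination_apply_single]
      exact LinearMap.congr_fun this v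
    have hgs : Function.Surjective g := by
      refine g.surjective_of_surjective_comp_mkQ (Ideal.span {x}) (by simpa using hjac) ?_
      rw [Submodule.ideal_span_singleton_smul]
      intro v
      obtain ⟨w, rfl⟩ := hf v
      obtain ⟨u, rfl⟩ := hπs w
      exact ⟨u, (hfg u).symm⟩
    refine ⟨m, g, hgs, ih _ ?_ ?_⟩
    · have : IsSMulRegular (Fin m → R) x := smul_right_injective _ hx0
      exact this.submodule _ _
    · let ρ : LinearMap.ker g →ₗ[R] LinearMap.ker f :=
        LinearMap.codRestrict ((LinearMap.ker f).restrictScalars R) (π ∘ₗ Submodule.subtype _)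
          fun k ↦ by
            have : g k.1 = 0 := k.2
            simp [hfg, this]
      have hρs : Function.Surjective ρ := by
        rintro ⟨v, hv⟩
        obtain ⟨v', rfl⟩ := hπs v
        have hv : Submodule.Quotient.mk (g v') = (0 : QuotSMulTop x M) := by rw [← hfg]; exact hv
        rw [Submodule.Quotient.mk_eq_zero] at hv
        obtain ⟨m', -, hm'⟩ := (Submodule.mem_smul_pointwise_iff_exists _ _ _).1 hv
        obtain ⟨w, rfl⟩ := hgs m'
        refine ⟨⟨v' - x • w, by simp [← hm']⟩, Subtype.ext ?_⟩
        change π (v' - x • w) = π v'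
        ext i
        rw [hπ, hπ, Ideal.Quotient.eq]
        simp [Ideal.mem_span_singleton]
      have hρk : LinearMap.ker ρ = x • (⊤ : Submodule R (LinearMap.ker g)) := by
        ext ⟨k, hk⟩
        rw [LinearMap.mem_ker, Submodule.mem_smul_pointwise_iff_exists]
        constructor
        · intro h
          have h : π k = 0 := congrArg Subtype.val h
          have : ∀ i, ∃ r, k i = x * r := fun i ↦ by
            have := congrFun h i
            rw [hπ, Pi.zero_apply, Ideal.Quotient.eq_zero_iff_mem, Ideal.mem_span_singleton] at this
            exact this
          choose r hr using this
          have hkr : k = x • r := funext fun i ↦ by simp [hr]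
          refine ⟨⟨r, hreg ?_⟩, trivial, Subtype.ext hkr.symm⟩
          have hk : g k = 0 := hk
          rw [hkr, map_smul] at hk
          simpa using hk
        · rintro ⟨⟨r, hr⟩, -, h⟩
          have h : x • r = k := congrArg Subtype.val h
          apply Subtype.ext
          change π k = 0
          ext i
          rw [hπ, ← h, Pi.zero_apply, Ideal.Quotient.eq_zero_iff_mem, Ideal.mem_span_singleton]
          simp
      let e : QuotSMulTop x (LinearMap.ker g) ≃ₗ[R] LinearMap.ker f :=
        (Submodule.quotEquivOfEq _ _ hρk.symm).trans (ρ.quotKerEquivOfSurjective hρs)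
      exact hK.of_linearEquiv (e.extendScalarsOfSurjective Ideal.Quotient.mk_surjective).symm

/-- `M` itself may have `x`-torsion, but its first syzygy lies in a free module. So `x` is regular
on the syzygy and a resolution over `R/x` lifts to it; the syzygy accounts for the one extra step.
-/
theorem IsRegularLocalRing.hasFreeResolutionLE (n : ℕ) : ∀ (R : Type u) [CommRing R]
    [IsRegularLocalRing R], (maximalIdeal R).spanFinrank = n →
      ∀ (M : Type u) [AddCommGroup M] [Module R M] [Module.Finite R M],
        HasFreeResolutionLE R n M := by
  induction n with
  | zero =>
    intro R _ _ h M _ _ _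
    let _ := (spanFinrank_eq_zero_iff.1 h).toField
    exact Module.Free.of_divisionRing R M
  | succ n ih =>
    intro R _ _ h M _ _ _
    have hf : ¬ IsField R := by rw [← spanFinrank_eq_zero_iff]; omega
    obtain ⟨x, hx, hx2, -⟩ := exists_mem_maximalIdeal hf
    obtain ⟨_, hq⟩ := quotient_span_singleton hx hx2
    obtain ⟨m, f, hf⟩ := Module.Finite.exists_fin' R M
    have hx0 : x ≠ 0 := by rintro rfl; simp at hx2
    have : Module.Finite (R ⧸ Ideal.span {x}) (QuotSMulTop x (LinearMap.ker f)) :=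
      Module.Finite.of_restrictScalars_finite R _ _
    refine ⟨m, f, hf, .of_quotSMulTop hx0 hx _ ?_ (ih _ (by omega) _)⟩
    have : IsSMulRegular (Fin m → R) x := smul_right_injective _ hx0
    exact this.submodule _ _

end FreeResolution

/-! ### The first Chern class of a torsion module and the Auslander–Buchsbaum theorem -/

section LengthDet

theorem Ring.ord_prod {A : Type*} [CommRing A] [IsDomain A] {ι : Type*} (s : Finset ι) (a : ι → A)
    (ha : ∀ i ∈ s, a i ≠ 0) : Ring.ord A (∏ i ∈ s, a i) = ∑ i ∈ s, Ring.ord A (a i) := by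
  classical
  induction s using Finset.induction_on with
  | empty => simp
  | insert i s hi ih =>
    rw [Finset.prod_insert hi, Finset.sum_insert hi,
      Ring.ord_mul' A (mem_nonZeroDivisors_of_ne_zero (ha i (Finset.mem_insert_self _ _))),
      ih fun j hj ↦ ha j (Finset.mem_insert_of_mem hj)]

/-- Over a principal ideal domain, the length of the cokernel of an injective endomorphism of a
finite free module is the order of its determinant. -/
theorem LinearMap.length_quotient_range_eq_ord_det {A M : Type*} [CommRing A] [IsDomain A]
    [IsPrincipalIdealRing A] [AddCommGroup M] [Module A M] [Module.Free A M] [Module.Finite A M]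
    (g : M →ₗ[A] M) (hg : Function.Injective g) :
    Module.length A (M ⧸ LinearMap.range g) = Ring.ord A (LinearMap.det g) := by
  classical
  let e := LinearEquiv.ofInjective g hg
  obtain ⟨b', a, ab', hab⟩ := Submodule.exists_smith_normal_form_of_rank_eq
    (Module.Free.chooseBasis A M) (N := LinearMap.range g) e.symm.finrank_eq
  have ha0 : ∀ i, a i ≠ 0 := fun i h0 ↦ ab'.ne_zero i (Subtype.ext (by simp [hab, h0]))
  -- The preimages of the Smith basis of the range. From `c` to `b'` the map is diagonal, and
  -- passing from `c` to `b'` changes the determinant only by a unit.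
  let c := ab'.map e.symm
  have hgc : ∀ i, g (c i) = a i • b' i := fun i ↦ by
    rw [← hab]
    exact congrArg Subtype.val (e.apply_symm_apply (ab' i))
  have hmat : LinearMap.toMatrix c b' g = Matrix.diagonal a := by
    ext i j
    rw [LinearMap.toMatrix_apply, hgc, map_smul, b'.repr_self]
    by_cases h : i = j
    · subst h; simp
    · simp [h]
  have hdet : LinearMap.det g = (∏ i, a i) * (c.toMatrix b').det := by
    rw [← LinearMap.det_toMatrix b', ← linearMap_toMatrix_mul_basis_toMatrix b' c b', hmat,
      Matrix.det_mul, Matrix.det_diagonal]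
  have hunit : IsUnit (c.toMatrix b').det := by
    have := c.isUnit_det b'
    rwa [Module.Basis.det_apply] at this
  rw [hdet, Ring.ord_mul_of_isUnit_right hunit, Ring.ord_prod _ _ fun i _ ↦ ha0 i]
  let π : M →ₗ[A] (∀ i, A ⧸ Ideal.span {a i}) :=
    LinearMap.pi fun i ↦ (Submodule.mkQ (Ideal.span {a i})) ∘ₗ b'.coord i
  have hπ : ∀ m i, π m i = Ideal.Quotient.mk _ (b'.repr m i) := fun m i ↦ rfl
  have hπs : Function.Surjective π := fun v ↦ by
    choose w hw using fun i ↦ Ideal.Quotient.mk_surjective (v i)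
    refine ⟨b'.equivFun.symm w, funext fun i ↦ ?_⟩
    rw [hπ, ← hw, ← b'.equivFun_apply, LinearEquiv.apply_symm_apply]
  have hker : LinearMap.ker π = LinearMap.range g := by
    ext m
    rw [LinearMap.mem_ker]
    constructor
    · intro h
      have : ∀ i, ∃ r, b'.repr m i = a i * r := fun i ↦ by
        have := congrFun h i
        rwa [hπ, Pi.zero_apply, Ideal.Quotient.eq_zero_iff_mem, Ideal.mem_span_singleton] at this
      choose r hr using this
      refine ⟨∑ i, r i • c i, ?_⟩
      rw [map_sum, ← b'.sum_repr m]
      refine Finset.sum_congr rfl fun i _ ↦ ?_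
      rw [map_smul, hgc, hr, smul_smul, mul_comm]
    · rintro ⟨m, rfl⟩
      ext i
      rw [hπ, Pi.zero_apply, Ideal.Quotient.eq_zero_iff_mem, Ideal.mem_span_singleton,
        ← c.sum_repr m, map_sum, map_sum, Finsupp.finsetSum_apply]
      refine Finset.dvd_sum fun j _ ↦ ?_
      rw [map_smul, hgc, map_smul, map_smul, b'.repr_self]
      by_cases h : j = i
      · subst h; simp
      · simp [h]
  rw [((Submodule.quotEquivOfEq _ _ hker.symm).trans
    (π.quotKerEquivOfSurjective hπs)).length_eq, Module.length_pi_of_fintype]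
  rfl

end LengthDet

section LocalLength

open TensorProduct

variable {R : Type*} [CommRing R]

/-- The length of `M_q` over `R_q`. -/
noncomputable def Module.localLength (q : Ideal R) [q.IsPrime] (M : Type*) [AddCommGroup M]
    [Module R M] : ℕ∞ :=
  Module.length (Localization.AtPrime q) (Localization.AtPrime q ⊗[R] M)

theorem Module.localLength_eq_add_of_exact (q : Ideal R) [q.IsPrime] {M N P : Type*}
    [AddCommGroup M] [Module R M] [AddCommGroup N] [Module R N] [AddCommGroup P] [Module R P]
    (f : M →ₗ[R] N) (g : N →ₗ[R] P) (hf : Function.Injective f) (hg : Function.Surjective g)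
    (h : Function.Exact f g) : localLength q N = localLength q M + localLength q P :=
  Module.length_eq_add_of_exact (f.baseChange (Localization.AtPrime q))
    (g.baseChange (Localization.AtPrime q))
    (Module.Flat.lTensor_preserves_injective_linearMap f hf)
    (LinearMap.lTensor_surjective _ hg) (lTensor_exact _ h hg)

theorem Module.localLength_quotient (q : Ideal R) [q.IsPrime] (J : Ideal R) :
    localLength q (R ⧸ J) = Module.length (Localization.AtPrime q)
      (Localization.AtPrime q ⧸ J.map (algebraMap R (Localization.AtPrime q))) :=
  ((Algebra.TensorProduct.quotIdealMapEquivTensorQuot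
    (Localization.AtPrime q) J).toLinearEquiv.length_eq).symm

theorem Module.localLength_quotient_span_singleton (q : Ideal R) [q.IsPrime] (x : R) :
    localLength q (R ⧸ Ideal.span {x}) =
      Ring.ord (Localization.AtPrime q) (algebraMap R (Localization.AtPrime q) x) := by
  rw [localLength_quotient, Ideal.map_span, Set.image_singleton, Ring.ord]

theorem Module.localLength_quotient_range (q : Ideal R) [q.IsPrime] [IsDomain R]
    [IsPrincipalIdealRing (Localization.AtPrime q)] {F : Type*} [AddCommGroup F] [Module R F]
    [Module.Free R F] [Module.Finite R F] (g : F →ₗ[R] F) (hg : Function.Injective g) :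
    localLength q (F ⧸ LinearMap.range g) =
      Ring.ord (Localization.AtPrime q)
        (algebraMap R (Localization.AtPrime q) (LinearMap.det g)) := by
  rw [← LinearMap.det_baseChange, ← LinearMap.length_quotient_range_eq_ord_det _
    (Module.Flat.lTensor_preserves_injective_linearMap g hg)]
  have hex : Function.Exact (g.baseChange (Localization.AtPrime q))
      ((LinearMap.range g).mkQ.baseChange (Localization.AtPrime q)) :=
    lTensor_exact _ (LinearMap.exact_map_mkQ_range g) (Submodule.mkQ_surjective _)
  have hs : Function.Surjective ((LinearMap.range g).mkQ.baseChange (Localization.AtPrime q)) :=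
    LinearMap.lTensor_surjective _ (Submodule.mkQ_surjective _)
  exact (((Submodule.quotEquivOfEq _ _ (LinearMap.exact_iff.1 hex).symm).trans
    (LinearMap.quotKerEquivOfSurjective _ hs)).length_eq).symm

end LocalLength

section ChernClass

open Module

theorem Module.localLength_quotient_prime {R : Type*} [CommRing R] (q p : Ideal R) [q.IsPrime] [p.IsPrime]
    (hq : q.height = 1) (hp : p.height = 1) :
    (p ≠ q → localLength q (R ⧸ p) = 0) ∧ (p = q → localLength q (R ⧸ p) = 1) := by
  rw [localLength_quotient]
  constructor
  · intro hne
    have hle : ¬ p ≤ q := fun hle ↦ by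
      have := Ideal.height_add_one_le_of_lt_of_isPrime (hle.lt_of_ne hne)
      rw [hp, hq] at this
      norm_num at this
    obtain ⟨s, hsp, hsq⟩ := SetLike.not_le_iff_exists.1 hle
    have : p.map (algebraMap R (Localization.AtPrime q)) = ⊤ :=
      Ideal.eq_top_of_isUnit_mem _ (Ideal.mem_map_of_mem _ hsp)
        (IsLocalization.map_units _ (⟨s, hsq⟩ : q.primeCompl))
    rw [this, Module.length_eq_zero_iff]
    exact Ideal.Quotient.subsingleton_iff.2 rfl
  · rintro rfl
    rw [Localization.AtPrime.map_eq_maximalIdeal, Module.length_eq_one_iff]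
    exact isSimpleModule_iff_isCoatom.2 (Ideal.isMaximal_def.1 (maximalIdeal.isMaximal _))

variable {R : Type*} [CommRing R] [IsDomain R]

theorem Submodule.exists_free_le_of_domain (M : Type*) [AddCommGroup M] [Module R M] :
    ∃ N : Submodule R M, Module.Free R N ∧ ∀ m : M, ∃ c : R, c ≠ 0 ∧ c • m ∈ N := by
  obtain ⟨s, hs, h⟩ := exists_maximal_linearIndepOn R (id : M → M)
  refine ⟨Submodule.span R s, ?_, fun m ↦ ?_⟩
  · have hs : LinearIndependent R ((↑) : s → M) := hs
    have := Module.Free.of_basis (Module.Basis.span hs)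
    rwa [Subtype.range_coe] at this
  · by_cases hm : m ∈ s
    · exact ⟨1, one_ne_zero, by simpa using Submodule.subset_span hm⟩
    · simpa using h m hm

/-- The divisor `∑ ℓ_q(M) [q]` over the height one primes is the divisor of a nonzero fraction. -/
def Module.IsPrincipalLength (M : Type*) [AddCommGroup M] [Module R M] : Prop :=
  ∃ a b : R, a ≠ 0 ∧ b ≠ 0 ∧ ∀ (q : Ideal R) [q.IsPrime], q.height = 1 →
    localLength q M + Ring.ord (Localization.AtPrime q) (algebraMap R _ b) =
      Ring.ord (Localization.AtPrime q) (algebraMap R _ a)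

variable [IsNoetherianRing R] [IsIntegrallyClosed R]

/-- `N` and `F` have the same rank, so the inclusion becomes an injective endomorphism of `F`. Its
determinant computes the length at every height one prime simultaneously. -/
theorem Module.isPrincipalLength_quotient_of_free {F : Type*} [AddCommGroup F] [Module R F]
    [Module.Free R F] [Module.Finite R F] (N : Submodule R F) [Module.Free R N]
    (hN : ∀ m : F, ∃ c : R, c ≠ 0 ∧ c • m ∈ N) :
    ∃ a : R, a ≠ 0 ∧ ∀ (q : Ideal R) [q.IsPrime], q.height = 1 →
      localLength q (F ⧸ N) = Ring.ord (Localization.AtPrime q) (algebraMap R _ a) := by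
  have htor : Module.IsTorsion R (F ⧸ N) := by
    intro x
    obtain ⟨m, rfl⟩ := Submodule.Quotient.mk_surjective _ x
    obtain ⟨c, hc, hcm⟩ := hN m
    exact ⟨⟨c, mem_nonZeroDivisors_of_ne_zero hc⟩, (Submodule.Quotient.mk_eq_zero _).2 hcm⟩
  have hrank : finrank R F = finrank R N := by
    have := Submodule.finrank_quotient_add_finrank N
    rw [htor.finrank_eq_zero] at this
    omega
  let u := LinearEquiv.ofFinrankEq F N hrank
  let g : F →ₗ[R] F := N.subtype ∘ₗ u.toLinearMap
  have hg : Function.Injective g := N.subtype_injective.comp u.injective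
  have hrange : LinearMap.range g = N := by
    rw [LinearMap.range_comp, LinearEquiv.range, Submodule.map_top, Submodule.range_subtype]
  refine ⟨LinearMap.det g, fun h ↦ LinearMap.det_eq_zero_iff_ker_ne_bot.1 h
    (LinearMap.ker_eq_bot.2 hg), fun q _ hq ↦ ?_⟩
  have := IsLocalization.AtPrime.isDiscreteValuationRing_of_height_eq_one q hq
    (Localization.AtPrime q)
  rw [← localLength_quotient_range q g hg, hrange]

/-- Induction on the length of the resolution. For a surjection from `R ^ m` onto `M` with kernel
`L`, lift the free module `N` to `R ^ m` and choose a free `N'` of full rank in `L`. The quotient of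
`R ^ m` by `N' ⊕ N` is an extension of `M/N` by `L/N'`, so the divisor of `M/N` is a determinant
divided by the fraction known for `L/N'`. -/
theorem HasFreeResolutionLE.isPrincipalLength {R : Type*} [CommRing R] [IsDomain R]
    [IsNoetherianRing R] [IsIntegrallyClosed R] (n : ℕ) : ∀ (M : Type _) [AddCommGroup M]
    [Module R M] [Module.Finite R M], HasFreeResolutionLE R n M → ∀ N : Submodule R M,
      Module.Free R N → (∀ m : M, ∃ c : R, c ≠ 0 ∧ c • m ∈ N) →
        IsPrincipalLength (R := R) (M ⧸ N) := by
  induction n with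
  | zero =>
    intro M _ _ _ hM N _ hN
    have : Module.Free R M := hM
    obtain ⟨a, ha, h⟩ := isPrincipalLength_quotient_of_free N hN
    exact ⟨a, 1, ha, one_ne_zero, fun q _ hq ↦ by simp [h q hq]⟩
  | succ n ih =>
    rintro M _ _ _ ⟨m, f, hf, hK⟩ N _ hN
    obtain ⟨N', hN'f, hN'⟩ := Submodule.exists_free_le_of_domain (R := R) (LinearMap.ker f)
    obtain ⟨a, b, ha, hb, h1⟩ := ih _ hK N' hN'f hN'
    obtain ⟨s, hs⟩ := Module.projective_lifting_property f N.subtype hf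
    have hs : ∀ x : N, f (s x) = x := fun x ↦ LinearMap.congr_fun hs x
    let t : (N' × N) →ₗ[R] (Fin m → R) :=
      ((LinearMap.ker f).subtype ∘ₗ N'.subtype).coprod s
    have ht : ∀ x, t x = x.1.1.1 + s x.2 := fun x ↦ rfl
    have hker : ∀ x : LinearMap.ker f, f x.1 = 0 := fun x ↦ x.2
    have hft : ∀ x, f (t x) = x.2 := fun x ↦ by rw [ht, map_add, hker, hs, zero_add]
    have hti : Function.Injective t := by
      rw [injective_iff_map_eq_zero]
      rintro ⟨x, y⟩ hxy
      have hy : y = 0 := Subtype.ext (by rw [← hft (x, y), hxy]; simp)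
      subst hy
      have hx : x = 0 := Subtype.ext (Subtype.ext (by simpa [ht] using hxy))
      rw [hx]; rfl
    have : Module.Free R (LinearMap.range t) := .of_equiv (LinearEquiv.ofInjective t hti)
    -- The quotient is torsion: scale `v` by `c` until its image lies in `N`, subtract the lift of
    -- that image, and scale the difference, which is in the kernel, into `N'`.
    obtain ⟨a0, ha0, h0⟩ := isPrincipalLength_quotient_of_free (LinearMap.range t) fun v ↦ by
      obtain ⟨c, hc, hcv⟩ := hN (f v)
      let w : LinearMap.ker f := ⟨c • v - s ⟨_, hcv⟩, by
        rw [LinearMap.mem_ker, map_sub, hs, map_smul, sub_self]⟩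
      obtain ⟨d, hd, hdw⟩ := hN' w
      refine ⟨d * c, mul_ne_zero hd hc, ⟨(⟨_, hdw⟩, d • ⟨_, hcv⟩), ?_⟩⟩
      have hsd : s (d • ⟨_, hcv⟩) = d • s ⟨_, hcv⟩ := map_smul _ _ _
      rw [ht, hsd]
      simp [w, smul_sub, mul_smul]
    refine ⟨a0 * b, a, mul_ne_zero ha0 hb, ha, fun q _ hq ↦ ?_⟩
    have hadd : localLength q ((Fin m → R) ⧸ LinearMap.range t) =
        localLength q (LinearMap.ker f ⧸ N') + localLength q (M ⧸ N) := by
      let α : (LinearMap.ker f ⧸ N') →ₗ[R] ((Fin m → R) ⧸ LinearMap.range t) :=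
        N'.mapQ _ (LinearMap.ker f).subtype fun x hx ↦ ⟨(⟨x, hx⟩, 0), by simp [ht]⟩
      let β : ((Fin m → R) ⧸ LinearMap.range t) →ₗ[R] M ⧸ N :=
        (LinearMap.range t).mapQ N f (by
          rintro _ ⟨x, rfl⟩
          rw [Submodule.mem_comap, hft]
          exact x.2.2)
      refine localLength_eq_add_of_exact q α β ?_ ?_ ?_
      · rw [injective_iff_map_eq_zero]
        intro x hx
        obtain ⟨x, rfl⟩ := Submodule.Quotient.mk_surjective _ x
        obtain ⟨⟨y, z⟩, hyz⟩ := (Submodule.Quotient.mk_eq_zero _).1 hx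
        have hyz : t (y, z) = x.1 := hyz
        have hz : z = 0 := Subtype.ext (by rw [← hft (y, z), hyz, hker]; rfl)
        subst hz
        have : y.1 = x := Subtype.ext (by simpa [ht] using hyz)
        exact (Submodule.Quotient.mk_eq_zero _).2 (this ▸ y.2)
      · intro x
        obtain ⟨x, rfl⟩ := Submodule.Quotient.mk_surjective _ x
        obtain ⟨y, rfl⟩ := hf x
        exact ⟨Submodule.Quotient.mk y, rfl⟩
      · intro v
        obtain ⟨v, rfl⟩ := Submodule.Quotient.mk_surjective _ v
        constructor
        · intro hv
          have hv : f v ∈ N := (Submodule.Quotient.mk_eq_zero _).1 hv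
          refine ⟨Submodule.Quotient.mk ⟨v - s ⟨_, hv⟩, by
            rw [LinearMap.mem_ker, map_sub, hs, sub_self]⟩, ?_⟩
          refine (Submodule.Quotient.eq _).2 ⟨(0, -⟨_, hv⟩), ?_⟩
          rw [ht]; simp
        · rintro ⟨x, hx⟩
          obtain ⟨x, rfl⟩ := Submodule.Quotient.mk_surjective _ x
          rw [← hx]
          refine (Submodule.Quotient.mk_eq_zero _).2 ?_
          rw [Submodule.subtype_apply, hker]; exact N.zero_mem
    have hinj := FaithfulSMul.algebraMap_injective R (Localization.AtPrime q)
    rw [map_mul, Ring.ord_mul _ (mem_nonZeroDivisors_of_ne_zero (by simpa using hb)),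
      ← h0 q hq, hadd, ← h1 q hq]
    ring

theorem IsDiscreteValuationRing.dvd_of_ord_le {A : Type*} [CommRing A] [IsDomain A]
    [IsDiscreteValuationRing A] {x y : A} (h : Ring.ord A x ≤ Ring.ord A y) : x ∣ y := by
  rwa [Ring.ord_eq_addVal, Ring.ord_eq_addVal, IsDiscreteValuationRing.addVal_le_iff_dvd] at h

/-- The divisor of `x` is `[p]` plus that of `p/(x)`, so `[p]` is the divisor of a fraction.
Effectiveness and normality place that fraction in `R`, and comparison at height one primes shows
that it generates `p`. -/
theorem Ideal.isPrincipal_of_isPrincipalLength (p : Ideal R) [p.IsPrime] (hp : p.height = 1)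
    {x : R} (hx : x ∈ p) (hx0 : x ≠ 0)
    (h : IsPrincipalLength (R := R) (p ⧸ Submodule.span R {(⟨x, hx⟩ : p)})) :
    p.IsPrincipal := by
  obtain ⟨a, b, ha, hb, h⟩ := h
  have hadd : ∀ (q : Ideal R) [q.IsPrime],
      localLength q (R ⧸ Ideal.span {x}) =
        localLength q (p ⧸ Submodule.span R {(⟨x, hx⟩ : p)}) + localLength q (R ⧸ p) := by
    intro q _
    have hspan : ∀ y : p, y ∈ Submodule.span R {(⟨x, hx⟩ : p)} ↔ y.1 ∈ Ideal.span {x} := fun y ↦ by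
      rw [Submodule.mem_span_singleton, Ideal.mem_span_singleton']
      exact ⟨fun ⟨c, hc⟩ ↦ ⟨c, congrArg Subtype.val hc⟩, fun ⟨c, hc⟩ ↦ ⟨c, Subtype.ext hc⟩⟩
    let α : (p ⧸ Submodule.span R {(⟨x, hx⟩ : p)}) →ₗ[R] (R ⧸ Ideal.span {x}) :=
      Submodule.mapQ _ _ p.subtype fun y hy ↦ (hspan y).1 hy
    let β : (R ⧸ Ideal.span {x}) →ₗ[R] (R ⧸ p) :=
      Submodule.factor ((Ideal.span_singleton_le_iff_mem p).2 hx)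
    refine localLength_eq_add_of_exact q α β ?_ (Submodule.factor_surjective _) ?_
    · rw [injective_iff_map_eq_zero]
      intro y hy
      obtain ⟨y, rfl⟩ := Submodule.Quotient.mk_surjective _ y
      exact (Submodule.Quotient.mk_eq_zero _).2
        ((hspan y).2 ((Submodule.Quotient.mk_eq_zero _).1 hy))
    · intro v
      obtain ⟨v, rfl⟩ := Submodule.Quotient.mk_surjective _ v
      constructor
      · intro hv
        exact ⟨Submodule.Quotient.mk ⟨v, (Submodule.Quotient.mk_eq_zero _).1 hv⟩, rfl⟩
      · rintro ⟨y, hy⟩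
        obtain ⟨y, rfl⟩ := Submodule.Quotient.mk_surjective _ y
        rw [← hy]
        exact (Submodule.Quotient.mk_eq_zero _).2 y.2
  have hord : ∀ (q : Ideal R) [q.IsPrime], q.height = 1 →
      Ring.ord (Localization.AtPrime q) (algebraMap R _ (x * b)) =
        Ring.ord (Localization.AtPrime q) (algebraMap R _ a) + localLength q (R ⧸ p) := by
    intro q _ hq
    rw [map_mul, Ring.ord_mul _ (mem_nonZeroDivisors_of_ne_zero (by simpa using hb)),
      ← localLength_quotient_span_singleton, hadd, ← h q hq]
    ring
  have hdvd : ∀ u v : R, (∀ (q : Ideal R) [q.IsPrime], q.height = 1 →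
      Ring.ord (Localization.AtPrime q) (algebraMap R _ u) ≤
        Ring.ord (Localization.AtPrime q) (algebraMap R _ v)) → u ≠ 0 → u ∣ v := by
    intro u v huv hu
    refine IsIntegrallyClosed.dvd_of_forall_height_one hu fun q _ hq ↦ ?_
    have := IsLocalization.AtPrime.isDiscreteValuationRing_of_height_eq_one q hq
      (Localization.AtPrime q)
    obtain ⟨w, hw⟩ := IsDiscreteValuationRing.dvd_of_ord_le (huv q hq)
    obtain ⟨w, s, rfl⟩ := IsLocalization.exists_mk'_eq q.primeCompl w
    refine ⟨s, s.2, w, FaithfulSMul.algebraMap_injective R (Localization.AtPrime q) ?_⟩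
    rw [map_mul, map_mul, hw, mul_left_comm, IsLocalization.mk'_spec']
  -- The fraction `x * b / a` has divisor `[p]`, which is effective, so it is an element `c` of `R`.
  obtain ⟨c, hc⟩ := hdvd a (x * b) (fun q _ hq ↦ by rw [hord q hq]; exact le_self_add) ha
  have hc0 : c ≠ 0 := by
    rintro rfl
    exact mul_ne_zero hx0 hb (by simpa using hc)
  have hordc : ∀ (q : Ideal R) [q.IsPrime], q.height = 1 →
      Ring.ord (Localization.AtPrime q) (algebraMap R _ c) = localLength q (R ⧸ p) := by
    intro q _ hq
    have := IsLocalization.AtPrime.isDiscreteValuationRing_of_height_eq_one q hq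
      (Localization.AtPrime q)
    have h1 := hord q hq
    have ha' : algebraMap R (Localization.AtPrime q) a ∈ nonZeroDivisors _ :=
      mem_nonZeroDivisors_of_ne_zero (by simpa using ha)
    rw [hc, map_mul, Ring.ord_mul' _ ha'] at h1
    exact ENat.add_right_injective_of_ne_top (Ring.ord_ne_top ha') h1
  have hunit : ∀ (q : Ideal R) [q.IsPrime] (u : R),
      Ring.ord (Localization.AtPrime q) (algebraMap R _ u) = 0 ↔ u ∉ q := by
    intro q _ u
    rw [Ring.ord, Module.length_eq_zero_iff, Ideal.Quotient.subsingleton_iff,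
      Ideal.span_singleton_eq_top, IsLocalization.AtPrime.isUnit_to_map_iff _ q]
    rfl
  refine ⟨c, le_antisymm (fun y hy ↦ ?_) ((Ideal.span_singleton_le_iff_mem p).2 ?_)⟩
  · refine Ideal.mem_span_singleton.2 (hdvd c y (fun q _ hq ↦ ?_) hc0)
    rw [hordc q hq]
    by_cases hpq : p = q
    · rw [(localLength_quotient_prime q p hq hp).2 hpq, Order.one_le_iff_ne_zero, Ne, hunit]
      simpa [hpq] using hy
    · rw [(localLength_quotient_prime q p hq hp).1 hpq]
      exact zero_le
  · by_contra hcp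
    rw [← hunit, hordc p hp, (localLength_quotient_prime p p hp hp).2 rfl] at hcp
    exact one_ne_zero hcp

/-- The Auslander–Buchsbaum theorem: a regular local ring is a unique factorization domain. -/
theorem IsRegularLocalRing.uniqueFactorizationMonoid (R : Type*) [CommRing R]
    [IsRegularLocalRing R] : UniqueFactorizationMonoid R := by
  have := IsRegularLocalRing.isIntegrallyClosed (R := R)
  refine UniqueFactorizationMonoid.of_forall_isPrincipal_of_height_eq_one fun p _ hp ↦ ?_
  obtain ⟨x, hx, hx0⟩ := p.ne_bot_iff.1 (p.ne_bot_of_height_eq_one hp)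
  have hx0' : (⟨x, hx⟩ : p) ≠ 0 := fun h ↦ hx0 (congrArg Subtype.val h)
  -- `p` has rank one: a single nonzero element spans a free submodule, and multiplication by `x`
  -- carries `p` into it.
  refine p.isPrincipal_of_isPrincipalLength hp hx hx0
    ((IsRegularLocalRing.hasFreeResolutionLE _ R rfl p).isPrincipalLength _ _ _
      (.of_equiv (LinearEquiv.toSpanNonzeroSingleton R p _ hx0')) fun m ↦ ⟨x, hx0, ?_⟩)
  exact Submodule.mem_span_singleton.2 ⟨m.1, Subtype.ext (mul_comm _ _)⟩

end ChernClass

/-! ### Charts of the blowup of the closed point of a regular local ring -/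

section Chart

/-- A prime ideal of a regular ring is locally generated by height many elements. -/
theorem IsRegularRing.exists_finset_span_le {A : Type*} [CommRing A] [IsRegularRing A] (Q : Ideal A)
    [Q.IsPrime] : ∃ S : Finset A, (∀ a ∈ S, a ∈ Q) ∧ (S.card : ℕ∞) ≤ Q.height ∧
      ∀ q ∈ Q, ∃ s ∉ Q, s * q ∈ Ideal.span (S : Set A) := by
  classical
  let L := Localization.AtPrime Q
  obtain ⟨U, hU, hspan⟩ := (IsNoetherian.noetherian (maximalIdeal L)).exists_span_finset_card_eq_spanFinrank
  have hch : ∀ u : L, ∃ b : A, u ∈ maximalIdeal L → b ∈ Q ∧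
      ∃ s : Q.primeCompl, u * algebraMap A L s = algebraMap A L b := by
    intro u
    obtain ⟨⟨b, s⟩, h⟩ := IsLocalization.surj Q.primeCompl u
    refine ⟨b, fun hu => ⟨?_, s, h⟩⟩
    rw [← IsLocalization.AtPrime.to_map_mem_maximal_iff L Q, ← h]
    exact Ideal.mul_mem_right _ _ hu
  choose b hb using hch
  have hUm : ∀ u ∈ U, u ∈ maximalIdeal L := fun u hu => by
    rw [← hspan]; exact Submodule.subset_span hu
  refine ⟨U.image b, ?_, ?_, ?_⟩
  · intro a ha
    obtain ⟨u, hu, rfl⟩ := Finset.mem_image.mp ha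
    exact (hb u (hUm u hu)).1
  · have h1 := IsLocalization.AtPrime.ringKrullDim_eq_height Q L
    rw [← IsRegularLocalRing.spanFinrank_maximalIdeal, ← hU] at h1
    have h2 : ((U.card : ℕ∞) : WithBot ℕ∞) = Q.height := by exact_mod_cast h1
    rw [← WithBot.coe_inj.mp h2]
    exact_mod_cast Finset.card_image_le
  · intro q hq
    have h1 : maximalIdeal L ≤ (Ideal.span ((U.image b : Finset A) : Set A)).map (algebraMap A L) := by
      rw [← hspan]
      refine Submodule.span_le.mpr fun u hu => ?_
      obtain ⟨_, s, hs⟩ := hb u (hUm u hu)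
      have : algebraMap A L (b u) ∈ (Ideal.span ((U.image b : Finset A) : Set A)).map (algebraMap A L) :=
        Ideal.mem_map_of_mem _ (Ideal.subset_span (by simpa using ⟨u, hu, rfl⟩))
      rw [← hs] at this
      exact (Ideal.mul_unit_mem_iff_mem _ (IsLocalization.map_units L s)).mp this
    have h2 := h1 ((IsLocalization.AtPrime.to_map_mem_maximal_iff L Q q).mpr hq)
    obtain ⟨⟨c, s⟩, h⟩ := (IsLocalization.mem_map_algebraMap_iff Q.primeCompl L).mp h2
    simp only at h
    rw [← map_mul] at h
    obtain ⟨s', hs'⟩ := (IsLocalization.eq_iff_exists Q.primeCompl L).mp h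
    refine ⟨s' * s, (s' * s).2, ?_⟩
    have : (s' * s : A) * q = s' * c := by rw [← hs']; ring
    rw [this]
    exact Ideal.mul_mem_left _ _ c.2

variable {R : Type*} [CommRing R] [IsLocalRing R] {ι : Type*}

instance MvPolynomial.isRegularRing_quotient_map_C [Finite ι] :
    IsRegularRing (MvPolynomial ι R ⧸ (maximalIdeal R).map (MvPolynomial.C (σ := ι))) :=
  haveI : IsRegularRing (R ⧸ maximalIdeal R) :=
    letI := Ideal.Quotient.field (maximalIdeal R)
    inferInstance
  IsRegularRing.of_ringEquiv
    (MvPolynomial.quotientEquivQuotientMvPolynomial (σ := ι) (maximalIdeal R)).toRingEquiv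

theorem MvPolynomial.isPrime_map_C_maximalIdeal :
    ((maximalIdeal R).map (MvPolynomial.C (σ := ι))).IsPrime := by
  rw [← Ideal.Quotient.isDomain_iff_prime]
  exact MulEquiv.isDomain _ (MvPolynomial.quotientEquivQuotientMvPolynomial (σ := ι)
    (maximalIdeal R)).symm.toRingEquiv.toMulEquiv

/-- The fibre over the closed point is a polynomial ring over the residue field, hence regular, so
the image of `Q` there is locally generated by height many elements. Going down for the polynomial
extension adds the height of the base to that of the fibre. -/
theorem MvPolynomial.exists_finset_span_le_of_comap_C [IsNoetherianRing R] [Finite ι]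
    (Q : Ideal (MvPolynomial ι R))
    [Q.IsPrime] (hQ : Q.comap MvPolynomial.C = maximalIdeal R) :
    ∃ S : Finset (MvPolynomial ι R), (∀ a ∈ S, a ∈ Q) ∧
      (maximalIdeal R).height + S.card ≤ Q.height ∧
      ∀ q ∈ Q, ∃ s ∉ Q, s * q ∈ (maximalIdeal R).map (MvPolynomial.C (σ := ι)) ⊔
        Ideal.span (S : Set (MvPolynomial ι R)) := by
  classical
  set J := (maximalIdeal R).map (MvPolynomial.C (σ := ι)) with hJ
  have hJQ : J ≤ Q := Ideal.map_le_iff_le_comap.mpr hQ.ge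
  have hker : RingHom.ker (Ideal.Quotient.mk J) ≤ Q := by rwa [Ideal.mk_ker]
  have : Q.LiesOver (maximalIdeal R) := ⟨hQ.symm⟩
  have hht := Ideal.height_eq_height_add_of_liesOver_of_hasGoingDown (maximalIdeal R) Q
  change Q.height = _ + (Q.map (Ideal.Quotient.mk J)).height at hht
  have hp : (Q.map (Ideal.Quotient.mk J)).IsPrime :=
    Ideal.map_isPrime_of_surjective Ideal.Quotient.mk_surjective hker
  obtain ⟨S, hS, hcard, hgen⟩ := IsRegularRing.exists_finset_span_le (Q.map (Ideal.Quotient.mk J))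
  have hmem : ∀ a, Ideal.Quotient.mk J a ∈ Q.map (Ideal.Quotient.mk J) ↔ a ∈ Q := by
    intro a
    rw [← Ideal.mem_comap, Ideal.comap_map_of_surjective' _ Ideal.Quotient.mk_surjective,
      Ideal.mk_ker, sup_eq_left.mpr hJQ]
  let l : MvPolynomial ι R ⧸ J → MvPolynomial ι R := Function.surjInv Ideal.Quotient.mk_surjective
  have hl : ∀ a, Ideal.Quotient.mk J (l a) = a := Function.surjInv_eq _
  refine ⟨S.image l, ?_, ?_, ?_⟩
  · intro a ha
    obtain ⟨u, hu, rfl⟩ := Finset.mem_image.mp ha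
    rw [← hmem, hl]
    exact hS u hu
  · rw [hht]
    gcongr
    exact le_trans (by exact_mod_cast Finset.card_image_le) hcard
  · intro q hq
    obtain ⟨s, hs, h⟩ := hgen _ ((hmem q).mpr hq)
    obtain ⟨s, rfl⟩ := Ideal.Quotient.mk_surjective s
    refine ⟨s, fun h => hs ((hmem s).mpr h), ?_⟩
    have h3 : (Ideal.span (S : Set (MvPolynomial ι R ⧸ J))) =
        (Ideal.span ((S.image l : Finset _) : Set (MvPolynomial ι R))).map (Ideal.Quotient.mk J) := by
      rw [Ideal.map_span, Finset.coe_image, ← Set.image_comp]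
      congr 1
      ext a
      simp [hl]
    rw [h3, ← map_mul, ← Ideal.mem_comap,
      Ideal.comap_map_of_surjective' _ Ideal.Quotient.mk_surjective, Ideal.mk_ker] at h
    rwa [sup_comm]

end Chart

/-! ### Presentation of a blowup chart by its obvious relations. -/

section BlowupChart

open MvPolynomial

theorem IsLocalRing.ringKrullDim_le_ringKrullDim_quotient_add_card_of_range {L : Type*} [CommRing L]
    [IsLocalRing L] [IsNoetherianRing L] {ι : Type*} [Fintype ι] (f : ι → L)
    (hf : Ideal.span (Set.range f) ≤ maximalIdeal L) :
    ringKrullDim L ≤ ringKrullDim (L ⧸ Ideal.span (Set.range f)) + (Fintype.card ι : ℕ) := by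
  have h2 := ringKrullDim_le_ringKrullDim_quotient_add_spanFinrank (Ideal.span (Set.range f))
      (hf.trans (by rw [IsLocalRing.ringJacobson_eq_maximalIdeal]))
  refine h2.trans ?_
  gcongr
  refine (Submodule.spanFinrank_span_le_ncard_of_finite (Set.finite_range _)).trans ?_
  rw [← Set.image_univ]
  refine (Set.ncard_image_le Set.finite_univ).trans ?_
  simp [Set.ncard_univ]

/-- `T` is a localization of the chart `R[𝔪/x]` of the blowup of the maximal ideal `𝔪` of the
regular local ring `R`, where `x` and the `g i` form a minimal system of generators of `𝔪` and
`t i = g i / x`. -/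
structure IsBlowupChart {R T : Type*} [CommRing R] [IsLocalRing R] [CommRing T] [IsLocalRing T]
    [Algebra R T] {ι : Type*} [Fintype ι] (x : R) (g : ι → R) (t : ι → T) : Prop where
  injective : Function.Injective (algebraMap R T)
  isLocalHom : IsLocalHom (algebraMap R T)
  span_eq : Ideal.span (insert x (Set.range g)) = maximalIdeal R
  card_add_one : Fintype.card ι + 1 = (maximalIdeal R).spanFinrank
  mul_eq : ∀ i, algebraMap R T x * t i = algebraMap R T (g i)
  exists_mul_eq : ∀ u : T, ∃ f s : MvPolynomial ι R, IsUnit (aeval t s) ∧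
    u * aeval t s = aeval t f

namespace IsBlowupChart

variable {R T : Type*} [CommRing R] [CommRing T] [IsLocalRing T]
    [Algebra R T] {ι : Type*} {x : R} {g : ι → R} {t : ι → T}

section

/-- The prime ideal of the polynomial ring at which the chart is localized. -/
noncomputable def prime (R : Type*) [CommRing R] [Algebra R T] (t : ι → T) : Ideal (MvPolynomial ι R) :=
  (maximalIdeal T).comap (aeval t : MvPolynomial ι R →ₐ[R] T)

instance : (prime R t).IsPrime := by unfold prime; infer_instance

/-- The ideal of the obvious relations between the generators of the chart. -/
noncomputable def relations (x : R) (g : ι → R) : Ideal (MvPolynomial ι R) :=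
  Ideal.span (Set.range fun i => C x * X i - C (g i))

theorem mem_prime {f : MvPolynomial ι R} : f ∈ prime R t ↔ ¬ IsUnit (aeval t f : T) := by
  simp [prime]

/-- Each variable times `x` is a constant modulo the relations, so powers of `x` clear all
variables. This reduces questions about vanishing in the chart to `R`. -/
theorem exists_pow_mul_sub_mem (x : R) (g : ι → R) (f : MvPolynomial ι R) :
    ∃ N : ℕ, ∃ r : R, C x ^ N * f - C r ∈ relations x g := by
  induction f using MvPolynomial.induction_on with
  | C a => exact ⟨0, a, by simp⟩
  | add p q hp hq =>
    obtain ⟨n, r, h⟩ := hp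
    obtain ⟨m, s, h'⟩ := hq
    refine ⟨n + m, x ^ m * r + x ^ n * s, ?_⟩
    have : C x ^ (n + m) * (p + q) - C (x ^ m * r + x ^ n * s) =
      C x ^ m * (C x ^ n * p - C r) + C x ^ n * (C x ^ m * q - C s) := by
      simp only [C_add, C_mul, C_pow]; ring
    rw [this]
    exact add_mem (Ideal.mul_mem_left _ _ h) (Ideal.mul_mem_left _ _ h')
  | mul_X p i hp =>
    obtain ⟨n, r, h⟩ := hp
    refine ⟨n + 1, r * g i, ?_⟩
    have : C x ^ (n + 1) * (p * X i) - C (r * g i) =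
      C x * X i * (C x ^ n * p - C r) + C r * (C x * X i - C (g i)) := by
      simp only [C_mul]; ring
    rw [this]
    exact add_mem (Ideal.mul_mem_left _ _ h) (Ideal.mul_mem_left _ _ (Ideal.subset_span ⟨i, rfl⟩))

variable [Fintype ι] [IsLocalRing R]

theorem comap_C (h : IsBlowupChart x g t) : (prime R t).comap C = maximalIdeal R := by
  have := h.isLocalHom
  ext r
  simp only [Ideal.mem_comap, mem_prime, mem_maximalIdeal, mem_nonunits_iff]
  rw [← algebraMap_eq, AlgHom.commutes, isUnit_map_iff]

theorem mem_maximalIdeal_left (h : IsBlowupChart x g t) : x ∈ maximalIdeal R := by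
  rw [← h.span_eq]; exact Ideal.subset_span (Set.mem_insert _ _)

theorem mem_maximalIdeal_right (h : IsBlowupChart x g t) (i : ι) : g i ∈ maximalIdeal R := by
  rw [← h.span_eq]; exact Ideal.subset_span (Set.mem_insert_of_mem _ ⟨i, rfl⟩)

theorem map_C_le_prime (h : IsBlowupChart x g t) : (maximalIdeal R).map C ≤ prime R t :=
  Ideal.map_le_iff_le_comap.mpr h.comap_C.ge

theorem relations_le (h : IsBlowupChart x g t) : relations x g ≤ (maximalIdeal R).map C := by
  refine Ideal.span_le.mpr ?_
  rintro _ ⟨i, rfl⟩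
  exact Ideal.sub_mem _ (Ideal.mul_mem_right _ _ (Ideal.mem_map_of_mem _ h.mem_maximalIdeal_left))
    (Ideal.mem_map_of_mem _ (h.mem_maximalIdeal_right i))

theorem aeval_relations (h : IsBlowupChart x g t) {f : MvPolynomial ι R} (hf : f ∈ relations x g) :
    (aeval t f : T) = 0 := by
  have : relations x g ≤ RingHom.ker (aeval t : MvPolynomial ι R →ₐ[R] T) := by
    refine Ideal.span_le.mpr ?_
    rintro _ ⟨i, rfl⟩
    simp [h.mul_eq]
  exact this hf

theorem map_C_le_sup (h : IsBlowupChart x g t) :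
    (maximalIdeal R).map (C (σ := ι)) ≤ Ideal.span {C x} ⊔ relations x g := by
  rw [← h.span_eq, Ideal.map_span]
  refine Ideal.span_le.mpr ?_
  rintro _ ⟨a, ha, rfl⟩
  rcases ha with rfl | ⟨i, rfl⟩
  · exact Ideal.mem_sup_left (Ideal.mem_span_singleton_self _)
  · have : C (g i) = X i * C x - (C x * X i - C (g i)) := by ring
    rw [SetLike.mem_coe, this]
    exact Ideal.sub_mem _ (Ideal.mem_sup_left (Ideal.mul_mem_left _ _ (Ideal.mem_span_singleton_self _)))
      (Ideal.mem_sup_right (Ideal.subset_span ⟨i, rfl⟩))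

theorem aeval_map_C (h : IsBlowupChart x g t) {f : MvPolynomial ι R}
    (hf : f ∈ (maximalIdeal R).map C) : algebraMap R T x ∣ aeval t f := by
  have h1 := h.map_C_le_sup hf
  obtain ⟨a, ha, b, hb, rfl⟩ := Submodule.mem_sup.mp h1
  obtain ⟨c, rfl⟩ := Ideal.mem_span_singleton'.mp ha
  rw [map_add, h.aeval_relations hb, add_zero, map_mul, ← algebraMap_eq, AlgHom.commutes]
  exact dvd_mul_left _ _

variable (R) in
/-- The localization of the polynomial ring that maps onto the chart. -/
abbrev Loc (t : ι → T) := Localization.AtPrime (prime R t)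

/-- The presentation of the chart by the obvious relations. -/
abbrev Pres (x : R) (g : ι → R) (t : ι → T) := Loc R t ⧸ (relations x g).map (algebraMap _ (Loc R t))

theorem relations_map_le (h : IsBlowupChart x g t) :
    (relations x g).map (algebraMap _ (Loc R t)) ≤ maximalIdeal (Loc R t) := by
  rw [Ideal.map_le_iff_le_comap]
  intro f hf
  rw [Ideal.mem_comap, IsLocalization.AtPrime.to_map_mem_maximal_iff (Loc R t) (prime R t)]
  exact h.map_C_le_prime (h.relations_le hf)

theorem isLocalRing_pres (h : IsBlowupChart x g t) : IsLocalRing (Pres x g t) :=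
  haveI : Nontrivial (Pres x g t) := Ideal.Quotient.nontrivial_iff.mpr
    (ne_top_of_le_ne_top (Ideal.IsPrime.ne_top inferInstance) h.relations_map_le)
  IsLocalRing.of_surjective' (Ideal.Quotient.mk _) Ideal.Quotient.mk_surjective

end

variable [Fintype ι] [IsRegularLocalRing R]

/-- The height of the maximal ideal of `R` is one more than the number of relations, and each
relation lowers the dimension by at most one. -/
theorem card_add_one_le_ringKrullDim_pres (h : IsBlowupChart x g t) {n : ℕ}
    (hn : (maximalIdeal R).height + n ≤ (prime R t).height) :
    (n + 1 : WithBot ℕ∞) ≤ ringKrullDim (Pres x g t) := by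
  have := h.isLocalRing_pres
  have h1 : ringKrullDim (Loc R t) ≤ ringKrullDim (Pres x g t) + (Fintype.card ι : ℕ) := by
    have h2 := h.relations_map_le
    unfold Pres
    unfold relations at h2 ⊢
    rw [Ideal.map_span, ← Set.range_comp] at h2 ⊢
    exact IsLocalRing.ringKrullDim_le_ringKrullDim_quotient_add_card_of_range _ h2
  rw [IsLocalization.AtPrime.ringKrullDim_eq_height (prime R t)] at h1
  have h3 : ((maximalIdeal R).height : WithBot ℕ∞) = (Fintype.card ι : ℕ) + 1 := by
    rw [IsLocalRing.maximalIdeal_height_eq_ringKrullDim,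
      ← IsRegularLocalRing.spanFinrank_maximalIdeal, ← h.card_add_one]
    push_cast; rfl
  have h4 : (((maximalIdeal R).height + n : ℕ∞) : WithBot ℕ∞) ≤
    ringKrullDim (Pres x g t) + (Fintype.card ι : ℕ) := (WithBot.coe_le_coe.mpr hn).trans h1
  rw [WithBot.coe_add, h3] at h4
  have h0 : 0 ≤ ringKrullDim (Pres x g t) := ringKrullDim_nonneg_of_nontrivial
  generalize ringKrullDim (Pres x g t) = d at *
  cases d with
  | bot => exact absurd h0 (by simp)
  | coe d =>
    have h5 : ((Fintype.card ι : ℕ) : ℕ∞) + 1 + n ≤ d + (Fintype.card ι : ℕ) := by exact_mod_cast h4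
    have h6 : ((n : ℕ∞) + 1) + (Fintype.card ι : ℕ) ≤ d + (Fintype.card ι : ℕ) := by
      convert h5 using 1; ring
    have := (ENat.add_le_add_iff_right (ENat.natCast_ne_top _)).mp h6
    exact_mod_cast this

/-- Modulo the relations the extended maximal ideal of `R` is generated by `x`. So `x` and the fibre
generators, one more than the number of the latter, generate the maximal ideal, and the dimension is
at least that large. The same count excludes `x = 0`. -/
theorem isRegularLocalRing_pres (h : IsBlowupChart x g t) :
    IsRegularLocalRing (Pres x g t) ∧
      algebraMap (MvPolynomial ι R) (Pres x g t) (C x) ≠ 0 := by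
  classical
  have := h.isLocalRing_pres
  obtain ⟨S, hSQ, hcard, hS⟩ := exists_finset_span_le_of_comap_C (prime R t) h.comap_C
  have hdim := h.card_add_one_le_ringKrullDim_pres hcard
  let θ : MvPolynomial ι R →+* Pres x g t := algebraMap _ _
  have hθ : ∀ f, θ f = Ideal.Quotient.mk _ (algebraMap _ (Loc R t) f) := fun f => rfl
  have hrel : ∀ f ∈ relations x g, θ f = 0 := fun f hf => by
    rw [hθ, Ideal.Quotient.eq_zero_iff_mem]; exact Ideal.mem_map_of_mem _ hf
  have hunit : ∀ f ∉ prime R t, IsUnit (θ f) := fun f hf => by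
    rw [hθ]
    exact (IsLocalization.map_units (Loc R t) (⟨f, hf⟩ : (prime R t).primeCompl)).map _
  have hθm : ∀ f ∈ prime R t, θ f ∈ Ideal.span (insert (θ (C x)) (θ '' S)) := by
    intro q hq
    obtain ⟨s, hs, hsq⟩ := hS q hq
    rw [← Ideal.unit_mul_mem_iff_mem _ (hunit s hs), ← map_mul, ← Ideal.mem_comap]
    refine (sup_le (h.map_C_le_sup.trans (sup_le ?_ ?_)) ?_) hsq
    · rw [Ideal.span_singleton_le_iff_mem]
      exact Ideal.subset_span (Set.mem_insert _ _)
    · intro f hf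
      rw [Ideal.mem_comap, hrel f hf]
      exact zero_mem _
    · refine Ideal.span_le.mpr fun f hf => ?_
      exact Ideal.subset_span (Set.mem_insert_of_mem _ ⟨f, hf, rfl⟩)
  have hm : maximalIdeal (Pres x g t) ≤ Ideal.span (insert (θ (C x)) (θ '' S)) := by
    rw [← map_maximalIdeal_eq_of_surjective (Ideal.Quotient.mk _) Ideal.Quotient.mk_surjective,
      ← Localization.AtPrime.map_eq_maximalIdeal, Ideal.map_map, Ideal.map_le_iff_le_comap]
    exact hθm
  have hm' : Ideal.span (insert (θ (C x)) (θ '' S)) = maximalIdeal (Pres x g t) := by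
    refine le_antisymm (Ideal.span_le.mpr ?_) hm
    have hle : ∀ f ∈ prime R t, θ f ∈ maximalIdeal (Pres x g t) := by
      intro f hf
      rw [← map_maximalIdeal_eq_of_surjective (Ideal.Quotient.mk _) Ideal.Quotient.mk_surjective]
      exact Ideal.mem_map_of_mem _
        ((IsLocalization.AtPrime.to_map_mem_maximal_iff (Loc R t) (prime R t) f).mpr hf)
    rintro _ (rfl | ⟨f, hf, rfl⟩)
    · exact hle _ (h.map_C_le_prime (Ideal.mem_map_of_mem _ h.mem_maximalIdeal_left))
    · exact hle _ (hSQ f hf)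
  have hcardS : (θ '' (S : Set (MvPolynomial ι R))).ncard ≤ S.card := by
    rw [← Set.ncard_coe_finset]; exact Set.ncard_image_le S.finite_toSet
  have hfr : (maximalIdeal (Pres x g t)).spanFinrank ≤ S.card + 1 := by
    rw [← hm']
    refine (Submodule.spanFinrank_span_le_ncard_of_finite
      ((S.finite_toSet.image _).insert _)).trans ?_
    exact (Set.ncard_insert_le _ _).trans (by omega)
  have hreg : IsRegularLocalRing (Pres x g t) :=
    IsRegularLocalRing.of_spanFinrank_maximalIdeal_le _ (le_trans (by exact_mod_cast hfr) hdim)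
  refine ⟨hreg, fun h0 => ?_⟩
  have hdim := hdim.trans hreg.spanFinrank_maximalIdeal.ge
  rw [← hm'] at hdim
  have h0' : θ (C x) = 0 := h0
  rw [h0', Ideal.span_insert_zero] at hdim
  have h7 := (Submodule.spanFinrank_span_le_ncard_of_finite (R := Pres x g t)
    (S.finite_toSet.image θ)).trans hcardS
  have h8 : S.card + 1 ≤ (Ideal.span (θ '' (S : Set (MvPolynomial ι R)))).spanFinrank := by
    exact_mod_cast hdim
  have : S.card + 1 ≤ S.card := h8.trans h7
  omega

end IsBlowupChart

end BlowupChart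

/-! ### The exceptional divisor of a chart and the order function. -/

section BlowupChartRegular

open MvPolynomial

namespace IsBlowupChart

variable {R T : Type*} [CommRing R] [IsRegularLocalRing R] [CommRing T] [IsLocalRing T]
    [Algebra R T] {ι : Type*} [Fintype ι] {x : R} {g : ι → R} {t : ι → T}

/-- Locally there are no relations beyond the obvious ones: `x ^ N * f` is congruent to a constant,
which vanishes in `T` and so in `R`, and `x` may be cancelled because `Pres x g t` is a domain where
`x` is nonzero. -/
theorem exists_mul_mem_relations (h : IsBlowupChart x g t) {f : MvPolynomial ι R}
    (hf : (aeval t f : T) = 0) : ∃ s ∉ prime R t, s * f ∈ relations x g := by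
  obtain ⟨hreg, hx⟩ := h.isRegularLocalRing_pres
  have hdom : IsDomain (Pres x g t) := @IsRegularLocalRing.isDomain (Pres x g t) _ hreg
  obtain ⟨N, r, hr⟩ := exists_pow_mul_sub_mem x g f
  have h0 := h.aeval_relations hr
  rw [map_sub, map_mul, hf, mul_zero, zero_sub, neg_eq_zero, ← algebraMap_eq, AlgHom.commutes] at h0
  rw [(injective_iff_map_eq_zero _).mp h.injective r h0, C_0, sub_zero] at hr
  let θ : MvPolynomial ι R →+* Pres x g t := algebraMap _ _
  have h1 : θ (C x ^ N * f) = 0 := by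
    change Ideal.Quotient.mk _ (algebraMap _ (Loc R t) _) = 0
    rw [Ideal.Quotient.eq_zero_iff_mem]; exact Ideal.mem_map_of_mem _ hr
  rw [map_mul, map_pow, mul_eq_zero] at h1
  have h2 : θ f = 0 := h1.resolve_left (pow_ne_zero _ hx)
  have h3 : algebraMap _ (Loc R t) f ∈ (relations x g).map (algebraMap _ (Loc R t)) :=
    Ideal.Quotient.eq_zero_iff_mem.mp h2
  obtain ⟨⟨c, s⟩, h⟩ := (IsLocalization.mem_map_algebraMap_iff (prime R t).primeCompl _).mp h3
  simp only at h
  rw [← map_mul] at h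
  obtain ⟨s', hs'⟩ := (IsLocalization.eq_iff_exists (prime R t).primeCompl _).mp h
  refine ⟨s' * s, (s' * s).2, ?_⟩
  have : (s' * s : MvPolynomial ι R) * f = s' * c := by rw [← hs']; ring
  rw [this]
  exact Ideal.mul_mem_left _ _ c.2

/-- The exceptional divisor is an open piece of affine space over the residue field: the extension
of the maximal ideal to the polynomial ring is prime and lies in `prime R t`, so denominators of the
chart cancel. -/
theorem dvd_aeval_iff (h : IsBlowupChart x g t) {f : MvPolynomial ι R} :
    algebraMap R T x ∣ aeval t f ↔ f ∈ (maximalIdeal R).map C := by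
  refine ⟨?_, h.aeval_map_C⟩
  rintro ⟨u, hu⟩
  obtain ⟨f', s, hs, hs'⟩ := h.exists_mul_eq u
  have hJ := MvPolynomial.isPrime_map_C_maximalIdeal (R := R) (ι := ι)
  have h0 : (aeval t (s * f - C x * f') : T) = 0 := by
    rw [map_sub, map_mul, map_mul, hu, ← hs', ← algebraMap_eq, AlgHom.commutes]
    ring
  obtain ⟨s', hs'', h1⟩ := h.exists_mul_mem_relations h0
  have h2 := (hJ.mem_or_mem (h.relations_le h1)).resolve_left fun h' => hs'' (h.map_C_le_prime h')
  have h3 : s * f ∈ (maximalIdeal R).map (C (σ := ι)) := by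
    have := Ideal.add_mem _ h2 (Ideal.mul_mem_right f' _
      (Ideal.mem_map_of_mem C h.mem_maximalIdeal_left))
    simpa using this
  exact (hJ.mem_or_mem h3).resolve_left fun h' => mem_prime.mp (h.map_C_le_prime h') hs

theorem ne_zero (h : IsBlowupChart x g t) : x ≠ 0 := by
  rintro rfl
  have h1 := h.span_eq
  rw [Ideal.span_insert_zero] at h1
  have h2 : (Ideal.span (Set.range g)).spanFinrank ≤ Fintype.card ι := by
    refine (Submodule.spanFinrank_span_le_ncard_of_finite (Set.finite_range _)).trans ?_
    rw [← Set.image_univ]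
    refine (Set.ncard_image_le Set.finite_univ).trans ?_
    simp [Set.ncard_univ]
  have := h.card_add_one
  rw [h1] at h2
  omega

theorem prime_algebraMap (h : IsBlowupChart x g t) : Prime (algebraMap R T x) := by
  have hJ := MvPolynomial.isPrime_map_C_maximalIdeal (R := R) (ι := ι)
  have := h.isLocalHom
  refine ⟨fun h0 => h.ne_zero (h.injective (by rw [h0, map_zero])), ?_, ?_⟩
  · rw [isUnit_map_iff]
    exact h.mem_maximalIdeal_left
  · intro a b hab
    obtain ⟨f, s, hs, hf⟩ := h.exists_mul_eq a
    obtain ⟨f', s', hs', hf'⟩ := h.exists_mul_eq b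
    have h1 : algebraMap R T x ∣ aeval t (f * f') := by
      rw [map_mul, ← hf, ← hf']
      exact hab.trans ⟨aeval t s * aeval t s', by ring⟩
    rw [h.dvd_aeval_iff] at h1
    refine (hJ.mem_or_mem h1).imp (fun h2 => ?_) (fun h2 => ?_)
    · rwa [← h.dvd_aeval_iff, ← hf, hs.dvd_mul_right] at h2
    · rwa [← h.dvd_aeval_iff, ← hf', hs'.dvd_mul_right] at h2

/-- The chart is isomorphic to the quotient of a localized polynomial ring by the
obvious relations. -/
theorem nonempty_ringEquiv (h : IsBlowupChart x g t) : Nonempty (Pres x g t ≃+* T) := by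
  let ψ : Loc R t →+* T := IsLocalization.lift (M := (prime R t).primeCompl)
    (g := ((aeval t : MvPolynomial ι R →ₐ[R] T) : MvPolynomial ι R →+* T))
    fun s => by
      by_contra hs
      exact s.2 (mem_prime.mpr hs)
  have hψ : ∀ f, ψ (algebraMap _ _ f) = aeval t f := fun f => IsLocalization.lift_eq _ f
  have hker : ∀ a ∈ (relations x g).map (algebraMap _ (Loc R t)), ψ a = 0 := by
    have : (relations x g).map (algebraMap _ (Loc R t)) ≤ RingHom.ker ψ := by
      rw [Ideal.map_le_iff_le_comap]
      intro f hf
      rw [Ideal.mem_comap, RingHom.mem_ker, hψ, h.aeval_relations hf]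
    exact this
  refine ⟨RingEquiv.ofBijective (Ideal.Quotient.lift _ ψ hker) ⟨?_, ?_⟩⟩
  · rw [injective_iff_map_eq_zero]
    intro a ha
    obtain ⟨a, rfl⟩ := Ideal.Quotient.mk_surjective a
    rw [Ideal.Quotient.lift_mk] at ha
    obtain ⟨⟨f, s⟩, hfs⟩ := IsLocalization.surj (prime R t).primeCompl a
    simp only at hfs
    have h1 : (aeval t f : T) = 0 := by rw [← hψ, ← hfs, map_mul, ha, zero_mul]
    obtain ⟨s', hs', hm⟩ := h.exists_mul_mem_relations h1
    rw [Ideal.Quotient.eq_zero_iff_mem]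
    have h2 := Ideal.mem_map_of_mem (algebraMap _ (Loc R t)) hm
    rw [map_mul, ← hfs, Ideal.unit_mul_mem_iff_mem _
      (IsLocalization.map_units (Loc R t) (⟨s', hs'⟩ : (prime R t).primeCompl)),
      Ideal.mul_unit_mem_iff_mem _ (IsLocalization.map_units (Loc R t) s)] at h2
    exact h2
  · refine Ideal.Quotient.lift_surjective_of_surjective _ _ fun u => ?_
    obtain ⟨f, s, hs, hf⟩ := h.exists_mul_eq u
    have hsp : s ∉ prime R t := fun h' => mem_prime.mp h' hs
    refine ⟨IsLocalization.mk' _ f (⟨s, hsp⟩ : (prime R t).primeCompl), ?_⟩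
    have h1 := congrArg ψ (IsLocalization.mk'_spec (Loc R t) f (⟨s, hsp⟩ : (prime R t).primeCompl))
    rw [map_mul, hψ, hψ, ← hf] at h1
    exact hs.mul_right_cancel h1

theorem isRegularLocalRing (h : IsBlowupChart x g t) : IsRegularLocalRing T :=
  haveI := h.isRegularLocalRing_pres.1
  IsRegularLocalRing.of_ringEquiv (R := Pres x g t) h.nonempty_ringEquiv.some

theorem exists_pow_mul_aeval_eq (h : IsBlowupChart x g t) {n : ℕ} {y : R}
    (hy : y ∈ maximalIdeal R ^ n) : ∃ f : MvPolynomial ι R, f.totalDegree ≤ n ∧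
      algebraMap R T x ^ n * aeval t f = algebraMap R T y := by
  induction n generalizing y with
  | zero => exact ⟨C y, by simp, by rw [← algebraMap_eq, AlgHom.commutes, pow_zero, one_mul]⟩
  | succ n ih =>
    rw [pow_succ] at hy
    refine Submodule.mul_induction_on hy ?_ ?_
    · intro a ha b hb
      obtain ⟨f, hf, hfa⟩ := ih ha
      rw [← h.span_eq] at hb
      induction hb using Submodule.span_induction with
      | mem b hb =>
        rcases hb with rfl | ⟨i, rfl⟩
        · exact ⟨f, hf.trans n.le_succ, by rw [map_mul, ← hfa]; ring⟩
        · refine ⟨f * X i, (totalDegree_mul _ _).trans (add_le_add hf (totalDegree_X i).le), ?_⟩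
          rw [map_mul, map_mul, ← hfa, ← h.mul_eq, aeval_X]
          ring
      | zero => exact ⟨0, by simp, by simp⟩
      | add b c _ _ hb hc =>
        obtain ⟨p, hp, hpa⟩ := hb
        obtain ⟨q, hq, hqa⟩ := hc
        exact ⟨p + q, (totalDegree_add _ _).trans (max_le hp hq), by
          rw [mul_add a, map_add, map_add, ← hpa, ← hqa]; ring⟩
      | smul r b _ hb =>
        obtain ⟨p, hp, hpa⟩ := hb
        refine ⟨C r * p, (totalDegree_mul _ _).trans (by simpa using hp), ?_⟩
        rw [smul_eq_mul, mul_left_comm, map_mul, map_mul, ← hpa, ← algebraMap_eq, AlgHom.commutes]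
        ring
    · rintro b c ⟨p, hp, hpa⟩ ⟨q, hq, hqa⟩
      exact ⟨p + q, (totalDegree_add _ _).trans (max_le hp hq), by
        rw [map_add, map_add, ← hpa, ← hqa]; ring⟩

/-- The degree bound lets `x ^ n` turn every monomial into an element of the `n`th power of the
maximal ideal; the coefficients contribute one more factor. -/
theorem mem_pow_succ_of_mem_map_C (h : IsBlowupChart x g t) {n : ℕ} {y : R}
    {f : MvPolynomial ι R} (hf : f.totalDegree ≤ n) (hfm : f ∈ (maximalIdeal R).map C)
    (hy : algebraMap R T x ^ n * aeval t f = algebraMap R T y) :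
    y ∈ maximalIdeal R ^ (n + 1) := by
  classical
  rw [MvPolynomial.mem_map_C_iff] at hfm
  have h1 : algebraMap R T x ^ n * aeval t f = algebraMap R T (∑ d ∈ f.support,
      coeff d f * (x ^ (n - d.degree) * ∏ i ∈ d.support, g i ^ d i)) := by
    rw [aeval_def, eval₂_eq, Finset.mul_sum, map_sum]
    refine Finset.sum_congr rfl fun d hd => ?_
    have hdn : d.degree ≤ n := by
      refine le_trans ?_ hf
      rw [Finsupp.degree_apply]
      exact le_totalDegree hd
    obtain ⟨k, hk⟩ := Nat.exists_eq_add_of_le hdn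
    have h2 : algebraMap R T x ^ d.degree * ∏ i ∈ d.support, t i ^ d i =
        algebraMap R T (∏ i ∈ d.support, g i ^ d i) := by
      rw [Finsupp.degree_apply, ← Finset.prod_pow_eq_pow_sum, ← Finset.prod_mul_distrib, map_prod]
      refine Finset.prod_congr rfl fun i _ => ?_
      rw [← mul_pow, h.mul_eq, map_pow]
    rw [map_mul, map_mul, ← h2, map_pow, hk, Nat.add_sub_cancel_left, pow_add]
    ring
  rw [h.injective (hy.symm.trans h1)]
  refine Ideal.sum_mem _ fun d hd => ?_
  have hdn : d.degree ≤ n := by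
    refine le_trans ?_ hf
    rw [Finsupp.degree_apply]
    exact le_totalDegree hd
  rw [pow_succ']
  refine Ideal.mul_mem_mul (hfm d) ?_
  have h3 : ∏ i ∈ d.support, g i ^ d i ∈ maximalIdeal R ^ d.degree := by
    rw [Finsupp.degree_apply, ← Finset.prod_pow_eq_pow_sum]
    exact Ideal.prod_mem_prod fun i _ => Ideal.pow_mem_pow (h.mem_maximalIdeal_right i) _
  have h4 := Ideal.mul_mem_mul (Ideal.pow_mem_pow h.mem_maximalIdeal_left (n - d.degree)) h3
  rwa [← pow_add, Nat.sub_add_cancel hdn] at h4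

/-- The order function of `R` is the `x`-adic order in the chart. -/
theorem mem_pow_iff (h : IsBlowupChart x g t) {n : ℕ} {y : R} :
    y ∈ maximalIdeal R ^ n ↔ algebraMap R T x ^ n ∣ algebraMap R T y := by
  constructor
  · intro hy
    obtain ⟨f, -, hf⟩ := h.exists_pow_mul_aeval_eq hy
    exact ⟨_, hf.symm⟩
  · have := h.isRegularLocalRing
    induction n with
    | zero => simp
    | succ n ih =>
      intro hd
      obtain ⟨f, hdeg, hf⟩ := h.exists_pow_mul_aeval_eq (ih ((pow_dvd_pow _ n.le_succ).trans hd))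
      refine h.mem_pow_succ_of_mem_map_C hdeg ?_ hf
      rw [← h.dvd_aeval_iff]
      rw [← hf, pow_succ] at hd
      exact (mul_dvd_mul_iff_left (pow_ne_zero _ h.prime_algebraMap.ne_zero)).mp hd

end IsBlowupChart

end BlowupChartRegular

/-! ### Local subrings of a field -/

section LocalSubringBasic

namespace LocalSubring

variable {K : Type*} [Field K]

theorem isUnit_iff_inv_mem {T : LocalSubring K} {s : T.toSubring} :
    IsUnit s ↔ (s : K) ≠ 0 ∧ (s : K)⁻¹ ∈ T.toSubring := by
  constructor
  · intro h
    obtain ⟨r, hr⟩ := h.exists_right_inv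
    have h1 : (s : K) * r = 1 := congrArg Subtype.val hr
    have h0 : (s : K) ≠ 0 := left_ne_zero_of_mul_eq_one h1
    exact ⟨h0, by rw [inv_eq_of_mul_eq_one_right h1]; exact r.2⟩
  · rintro ⟨h0, h⟩
    exact IsUnit.of_mul_eq_one ⟨_, h⟩ (Subtype.ext (mul_inv_cancel₀ h0))

theorem mem_maximalIdeal_iff {T : LocalSubring K} {s : T.toSubring} :
    s ∈ maximalIdeal T.toSubring ↔ ((s : K) = 0 ∨ (s : K)⁻¹ ∉ T.toSubring) := by
  rw [mem_maximalIdeal, mem_nonunits_iff, isUnit_iff_inv_mem]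
  tauto

/-- Domination expressed without maximal ideals: the larger ring inverts no further elements of the
smaller one. This allows computing in `K`. -/
theorem le_iff_inv_mem {S T : LocalSubring K} : S ≤ T ↔ S.toSubring ≤ T.toSubring ∧
    ∀ s ∈ S.toSubring, s⁻¹ ∈ T.toSubring → s⁻¹ ∈ S.toSubring := by
  rw [le_def]
  constructor
  · rintro ⟨h, hl⟩
    refine ⟨h, fun s hs hs' => ?_⟩
    by_cases h0 : s = 0
    · subst h0; rwa [inv_zero]
    · have h1 : IsUnit (Subring.inclusion h ⟨s, hs⟩) := isUnit_iff_inv_mem.mpr ⟨h0, hs'⟩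
      exact (isUnit_iff_inv_mem.mp (hl.map_nonunit _ h1)).2
  · rintro ⟨h, hi⟩
    refine ⟨h, ⟨fun s hs => ?_⟩⟩
    have h1 := isUnit_iff_inv_mem.mp hs
    exact isUnit_iff_inv_mem.mpr ⟨h1.1, hi _ s.2 h1.2⟩

theorem eq_of_le_of_subset {S T : LocalSubring K} (h : S ≤ T) (h' : T.toSubring ≤ S.toSubring) :
    T = S :=
  toSubring_injective (le_antisymm h' h.1)

theorem mem_ofPrime_iff {A : Subring K} {P : Ideal A} [P.IsPrime] {z : K} :
    z ∈ (ofPrime A P).toSubring ↔ ∃ a s : A, s ∉ P ∧ z = a * (s : K)⁻¹ := by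
  constructor
  · intro hz
    obtain ⟨⟨a, s⟩, h⟩ := IsLocalization.surj P.primeCompl (⟨z, hz⟩ : (ofPrime A P).toSubring)
    have h1 : z * (s : A) = a := congrArg Subtype.val h
    have h0 : ((s : A) : K) ≠ 0 := fun h => s.2 (by
      rw [show (s : A) = 0 from Subtype.ext h]; exact zero_mem _)
    exact ⟨a, s, s.2, by rw [← h1, mul_inv_cancel_right₀ h0]⟩
  · rintro ⟨a, s, hs, rfl⟩
    have h1 : IsUnit (algebraMap A (ofPrime A P).toSubring s) :=
      IsLocalization.map_units _ (⟨s, hs⟩ : P.primeCompl)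
    exact mul_mem (le_ofPrime A P a.2) (isUnit_iff_inv_mem.mp h1).2

theorem inv_mem_ofPrime_iff {A : Subring K} {P : Ideal A} [P.IsPrime] {s : A} (h0 : s ≠ 0) :
    (s : K)⁻¹ ∈ (ofPrime A P).toSubring ↔ s ∉ P := by
  change _ ↔ s ∈ P.primeCompl
  rw [← IsLocalization.AtPrime.isUnit_to_map_iff (ofPrime A P).toSubring P s, isUnit_iff_inv_mem]
  exact ⟨fun h => ⟨fun h' => h0 (Subtype.ext h'), h⟩, fun h => h.2⟩

theorem ofPrime_le_of_forall {A : Subring K} {P : Ideal A} [P.IsPrime] {T : LocalSubring K}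
    (hA : A ≤ T.toSubring) (h : ∀ s : A, s ∉ P → (s : K)⁻¹ ∈ T.toSubring) :
    (ofPrime A P).toSubring ≤ T.toSubring := by
  intro z hz
  obtain ⟨a, s, hs, rfl⟩ := mem_ofPrime_iff.mp hz
  exact mul_mem (hA a.2) (h s hs)

end LocalSubring

end LocalSubringBasic

/-! ### Affine models, centres and iterated localization. -/

namespace BlowupModel

open LocalSubring

variable {K : Type*} [Field K]

/-- The prime is recovered as the set of elements of `A` that are nonunits in `T`, so membership
becomes a condition on fractions in `K`. -/
theorem mem_affineModel_iff {A : Subring K} {T : LocalSubring K} :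
    T ∈ affineModel A ↔ A ≤ T.toSubring ∧ ∀ z ∈ T.toSubring, ∃ a ∈ A, ∃ s ∈ A, s ≠ 0 ∧
      s⁻¹ ∈ T.toSubring ∧ z = a * s⁻¹ := by
  constructor
  · rintro ⟨P, hP, rfl⟩
    refine ⟨le_ofPrime A P, fun z hz => ?_⟩
    obtain ⟨a, s, hs, rfl⟩ := mem_ofPrime_iff.mp hz
    have h0 : s ≠ 0 := by rintro rfl; exact hs (zero_mem _)
    exact ⟨a, a.2, s, s.2, fun h => h0 (Subtype.ext h), (inv_mem_ofPrime_iff h0).mpr hs, rfl⟩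
  · rintro ⟨hA, h⟩
    let P : Ideal A := (maximalIdeal T.toSubring).comap (Subring.inclusion hA)
    have hP : ∀ s : A, s ∉ P ↔ (s : K) ≠ 0 ∧ (s : K)⁻¹ ∈ T.toSubring := by
      intro s
      rw [Ideal.mem_comap, mem_maximalIdeal, mem_nonunits_iff, not_not, isUnit_iff_inv_mem]
      rfl
    refine ⟨P, inferInstance, toSubring_injective (le_antisymm (fun z hz => ?_) ?_)⟩
    · obtain ⟨a, ha, s, hs, h0, hi, rfl⟩ := h z hz
      exact mem_ofPrime_iff.mpr ⟨⟨a, ha⟩, ⟨s, hs⟩, (hP _).mpr ⟨h0, hi⟩, rfl⟩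
    · exact ofPrime_le_of_forall hA fun s hs => ((hP s).mp hs).2

theorem exists_mem_affineModel_le {A : Subring K} {V : LocalSubring K} (hA : A ≤ V.toSubring) :
    ∃ T ∈ affineModel A, T ≤ V := by
  let P : Ideal A := (maximalIdeal V.toSubring).comap (Subring.inclusion hA)
  have hP : ∀ s : A, s ∉ P ↔ (s : K) ≠ 0 ∧ (s : K)⁻¹ ∈ V.toSubring := by
    intro s
    rw [Ideal.mem_comap, mem_maximalIdeal, mem_nonunits_iff, not_not, isUnit_iff_inv_mem]
    rfl
  refine ⟨ofPrime A P, ⟨P, inferInstance, rfl⟩, le_iff_inv_mem.mpr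
    ⟨ofPrime_le_of_forall hA fun s hs => ((hP s).mp hs).2, ?_⟩⟩
  intro z hz hz'
  obtain ⟨a, s, hs, rfl⟩ := mem_ofPrime_iff.mp hz
  by_cases h0 : (a : K) = 0
  · simp [h0]
  have ha : a ∉ P := by
    rw [hP]
    refine ⟨h0, ?_⟩
    have h1 : (a : K)⁻¹ = (a * (s : K)⁻¹)⁻¹ * (s : K)⁻¹ := by
      have := ((hP s).mp hs).1
      field_simp
    rw [h1]
    exact mul_mem hz' ((hP s).mp hs).2
  rw [mul_inv, inv_inv, mul_comm]
  exact mem_ofPrime_iff.mpr ⟨s, a, ha, rfl⟩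

/-- Localizing a localization. -/
theorem affineModel_trans {A : Subring K} {B W : LocalSubring K} (hB : B ∈ affineModel A)
    (hW : W ∈ affineModel B.toSubring) : W ∈ affineModel A := by
  rw [mem_affineModel_iff] at hB hW ⊢
  refine ⟨hB.1.trans hW.1, fun z hz => ?_⟩
  obtain ⟨b, hb, c, hc, hc0, hci, rfl⟩ := hW.2 z hz
  obtain ⟨a, ha, s, hs, hs0, hsi, rfl⟩ := hB.2 b hb
  obtain ⟨a', ha', s', hs', hs0', hsi', rfl⟩ := hB.2 c hc
  have ha0' : a' ≠ 0 := left_ne_zero_of_mul hc0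
  refine ⟨a * s', mul_mem ha hs', s * a', mul_mem hs ha', mul_ne_zero hs0 ha0', ?_, ?_⟩
  · have : (s * a')⁻¹ = s⁻¹ * s'⁻¹ * (a' * s'⁻¹)⁻¹ := by field_simp
    rw [this]
    exact mul_mem (mul_mem (hW.1 hsi) (hW.1 hsi')) hci
  · field_simp

end BlowupModel

/-! ### Local quadratic transforms as charts. -/

namespace BlowupModel

open LocalSubring

variable {K : Type*} [Field K]

theorem div_mem_blowupChart {A : Subring K} {J : Ideal A} {a x : A} (hx : x ∈ J) :
    (x : K) / a ∈ blowupChart A J a :=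
  Algebra.subset_adjoin ⟨x, hx, rfl⟩

theorem le_blowupChart (A : Subring K) (J : Ideal A) (a : A) : A ≤ blowupChart A J a :=
  fun z hz => (Algebra.adjoin A {z : K | ∃ x ∈ J, z = (x : K) / (a : K)}).algebraMap_mem ⟨z, hz⟩

theorem blowupChart_le {A : Subring K} {J : Ideal A} {a : A} {B : Subring K} (hA : A ≤ B)
    (hJ : ∀ x ∈ J, (x : K) / a ∈ B) : blowupChart A J a ≤ B := by
  intro z hz
  change z ∈ Algebra.adjoin A _ at hz
  induction hz using Algebra.adjoin_induction with
  | mem z hz => obtain ⟨x, hx, rfl⟩ := hz; exact hJ x hx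
  | algebraMap r => exact hA r.2
  | add _ _ _ _ h1 h2 => exact add_mem h1 h2
  | mul _ _ _ _ h1 h2 => exact mul_mem h1 h2

/-- The given denominator `a` need not belong to a minimal system of generators. It is exchanged for
a minimal generator `x` that differs from it by a unit of `T`. -/
theorem IsLocalQuadraticTransform.exists_isBlowupChart {S T : LocalSubring K}
    [IsRegularLocalRing S.toSubring] (h : IsLocalQuadraticTransform S T) :
    letI := (Subring.inclusion h.1.1).toAlgebra
    ∃ (n : ℕ) (x : S.toSubring) (g : Fin n → S.toSubring) (t : Fin n → T.toSubring),
      IsBlowupChart x g t := by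
  let := (Subring.inclusion h.1.1).toAlgebra
  have hcoe : ∀ s : S.toSubring, ((algebraMap S.toSubring T.toSubring s : T.toSubring) : K) = s :=
    fun _ => rfl
  obtain ⟨a, ha, ha0, hT⟩ := h.2
  rw [mem_affineModel_iff] at hT
  have ha0K : (a : K) ≠ 0 := fun h => ha0 (Subtype.ext h)
  obtain ⟨U, hU, hspan⟩ := (IsNoetherian.noetherian
    (maximalIdeal S.toSubring)).exists_span_finset_card_eq_spanFinrank
  have hUm : ∀ u ∈ U, u ∈ maximalIdeal S.toSubring := fun u hu => by
    rw [← hspan]; exact Submodule.subset_span hu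
  have hdiv : ∀ u ∈ maximalIdeal S.toSubring, (u : K) / a ∈ T.toSubring :=
    fun u hu => hT.1 (div_mem_blowupChart hu)
  -- If every generator divided by `a` were a nonunit of `T`, all of the maximal ideal of `S`,
  -- including `a` itself, would lie in `a` times the maximal ideal of `T`.
  obtain ⟨x, hxU, hx0, hxu⟩ : ∃ x ∈ U, (x : K) ≠ 0 ∧ (a : K) / x ∈ T.toSubring := by
    by_contra hcon
    push Not at hcon
    have h1 : ∀ u ∈ maximalIdeal S.toSubring, ∃ b ∈ maximalIdeal T.toSubring, (u : K) = a * b := by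
      intro u hu
      rw [← hspan] at hu
      induction hu using Submodule.span_induction with
      | mem u hu =>
        refine ⟨⟨u / a, hdiv u (hUm u hu)⟩, ?_, by simp only; field_simp⟩
        rw [mem_maximalIdeal_iff, or_iff_not_imp_left]
        intro h0
        simp only [inv_div]
        exact hcon u hu fun h => h0 (by simp [h])
      | zero => exact ⟨0, zero_mem _, by simp⟩
      | add u v _ _ hu hv =>
        obtain ⟨b, hb, hb'⟩ := hu
        obtain ⟨c, hc, hc'⟩ := hv
        exact ⟨b + c, add_mem hb hc, by push_cast; rw [hb', hc']; ring⟩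
      | smul r u _ hu =>
        obtain ⟨b, hb, hb'⟩ := hu
        exact ⟨algebraMap _ _ r * b, Ideal.mul_mem_left _ _ hb, by
          rw [smul_eq_mul, Subring.coe_mul, Subring.coe_mul, hcoe, hb']; ring⟩
    obtain ⟨b, hb, hb'⟩ := h1 a ha
    have h2 : (b : K) = 1 := by
      have := mul_left_cancel₀ ha0K (show (a : K) * 1 = a * b by rw [mul_one]; exact hb')
      exact this.symm
    rw [show b = 1 from Subtype.ext h2] at hb
    exact (Ideal.ne_top_iff_one _).mp (Ideal.IsPrime.ne_top inferInstance) hb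
  classical
  obtain ⟨n, e⟩ : ∃ n, Nonempty (Fin n ≃ (U.erase x : Finset S.toSubring)) :=
    ⟨_, ⟨(U.erase x).equivFin.symm⟩⟩
  obtain ⟨e⟩ := e
  let g : Fin n → S.toSubring := fun i => (e i).1
  have hgU : ∀ i, g i ∈ U := fun i => Finset.mem_of_mem_erase (e i).2
  have hxm := hUm x hxU
  have htm : ∀ u ∈ maximalIdeal S.toSubring, (u : K) / x ∈ T.toSubring := by
    intro u hu
    have : (u : K) / x = u / a * (a / x) := by field_simp
    rw [this]
    exact mul_mem (hdiv u hu) hxu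
  let t : Fin n → T.toSubring := fun i => ⟨g i / x, htm _ (hUm _ (hgU i))⟩
  have hspan' : Ideal.span (insert x (Set.range g)) = maximalIdeal S.toSubring := by
    rw [← hspan, Ideal.span]
    congr 1
    ext u
    simp only [Set.mem_insert_iff, Set.mem_range, SetLike.mem_coe]
    constructor
    · rintro (rfl | ⟨i, rfl⟩)
      exacts [hxU, hgU i]
    · intro hu
      by_cases hux : u = x
      · exact Or.inl hux
      · exact Or.inr ⟨e.symm ⟨u, Finset.mem_erase.mpr ⟨hux, hu⟩⟩, by simp [g]⟩
  have hmul : ∀ i, algebraMap S.toSubring T.toSubring x * t i = algebraMap _ _ (g i) := fun i =>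
    Subtype.ext (by
      rw [Subring.coe_mul, hcoe, hcoe]
      exact mul_div_cancel₀ _ hx0)
  have hlin : ∀ u ∈ maximalIdeal S.toSubring, ∃ f : MvPolynomial (Fin n) S.toSubring,
      ((MvPolynomial.aeval t f : T.toSubring) : K) = u / x := by
    intro u hu
    rw [← hspan'] at hu
    induction hu using Submodule.span_induction with
    | mem u hu =>
      rcases hu with rfl | ⟨i, rfl⟩
      · exact ⟨1, by rw [map_one, Subring.coe_one, div_self hx0]⟩
      · exact ⟨MvPolynomial.X i, by rw [MvPolynomial.aeval_X]⟩
    | zero => exact ⟨0, by simp⟩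
    | add u v _ _ hu hv =>
      obtain ⟨b, hb⟩ := hu
      obtain ⟨c, hc⟩ := hv
      exact ⟨b + c, by rw [map_add, Subring.coe_add, hb, hc, Subring.coe_add, add_div]⟩
    | smul r u _ hu =>
      obtain ⟨b, hb⟩ := hu
      exact ⟨MvPolynomial.C r * b, by
        rw [map_mul, Subring.coe_mul, hb, ← MvPolynomial.algebraMap_eq, AlgHom.commutes, hcoe,
          smul_eq_mul, Subring.coe_mul, mul_div_assoc]⟩
  obtain ⟨l, hl⟩ := hlin a ha
  -- Multiplying by a power of the unit `a / x` converts denominators `a` into denominators `x`.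
  have hchart : ∀ α ∈ blowupChart S.toSubring (maximalIdeal S.toSubring) a,
      ∃ (N : ℕ) (f : MvPolynomial (Fin n) S.toSubring),
        α * ((a : K) / x) ^ N = ((MvPolynomial.aeval t f : T.toSubring) : K) := by
    intro α hα
    change α ∈ Algebra.adjoin _ _ at hα
    induction hα using Algebra.adjoin_induction with
    | mem α hα =>
      obtain ⟨u, hu, rfl⟩ := hα
      obtain ⟨f, hf⟩ := hlin u hu
      exact ⟨1, f, by rw [hf]; field_simp⟩
    | algebraMap r =>
      exact ⟨0, MvPolynomial.C r, by
        rw [← MvPolynomial.algebraMap_eq, AlgHom.commutes, hcoe, pow_zero, mul_one]; rfl⟩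
    | add α β _ _ h1 h2 =>
      obtain ⟨N, f, hf⟩ := h1
      obtain ⟨M, f', hf'⟩ := h2
      refine ⟨N + M, f * l ^ M + f' * l ^ N, ?_⟩
      rw [map_add, map_mul, map_mul, map_pow, map_pow, Subring.coe_add, Subring.coe_mul,
        Subring.coe_mul, Subring.coe_pow, Subring.coe_pow, ← hf, ← hf', hl]
      ring
    | mul α β _ _ h1 h2 =>
      obtain ⟨N, f, hf⟩ := h1
      obtain ⟨M, f', hf'⟩ := h2
      refine ⟨N + M, f * f', ?_⟩
      rw [map_mul, Subring.coe_mul, ← hf, ← hf']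
      ring
  have hax : (a : K) / x ≠ 0 := div_ne_zero ha0K hx0
  have hax' : ((a : K) / x)⁻¹ ∈ T.toSubring := by rw [inv_div]; exact hdiv x hxm
  refine ⟨n, x, g, t, ?_, h.1.2, hspan', ?_, hmul, ?_⟩
  · exact Subring.inclusion_injective _
  · rw [← hU, ← Finset.card_erase_add_one hxU, Fintype.card_fin]
    simpa using Fintype.card_congr e
  · intro u
    obtain ⟨α, hα, s, hs, hs0, hsi, hu⟩ := hT.2 u u.2
    obtain ⟨N, f, hf⟩ := hchart α hα
    obtain ⟨M, f', hf'⟩ := hchart s hs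
    have hden : ((MvPolynomial.aeval t (f' * l ^ N) : T.toSubring) : K) =
        s * (a / x) ^ M * (a / x) ^ N := by
      rw [map_mul, map_pow, Subring.coe_mul, Subring.coe_pow, ← hf', hl]
    refine ⟨f * l ^ M, f' * l ^ N, isUnit_iff_inv_mem.mpr ⟨?_, ?_⟩, Subtype.ext ?_⟩
    · rw [hden]
      exact mul_ne_zero (mul_ne_zero hs0 (pow_ne_zero _ hax)) (pow_ne_zero _ hax)
    · rw [hden, mul_inv, mul_inv, ← inv_pow, ← inv_pow]
      exact mul_mem (mul_mem hsi (pow_mem hax' _)) (pow_mem hax' _)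
    · rw [Subring.coe_mul, hden, hu, map_mul, map_pow, Subring.coe_mul, Subring.coe_pow, ← hf, hl]
      field_simp

end BlowupModel

/-! ### Order valuation rings and the divisors created by a blowup. -/

namespace BlowupModel

open LocalSubring

variable {K : Type*} [Field K]

theorem natCast_le_order_iff {S : LocalSubring K} {x : S.toSubring} {n : ℕ} :
    (n : ℕ∞) ≤ order S x ↔ x ∈ maximalIdeal S.toSubring ^ n := by
  constructor
  · intro h
    by_contra hx
    cases n with
    | zero => simp at hx
    | succ n =>
      have h1 : order S x ≤ n := by
        refine iSup₂_le fun m hm => ?_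
        by_contra hmn
        have hmn : n + 1 ≤ m := by
          rw [Nat.cast_le, not_le] at hmn
          exact hmn
        exact hx (Ideal.pow_le_pow_right hmn hm)
      have h2 : ((n + 1 : ℕ) : ℕ∞) ≤ n := h.trans h1
      rw [Nat.cast_le] at h2
      omega
  · intro h
    exact le_iSup₂ (f := fun (n : ℕ) (_ : n ∈ {n : ℕ | x ∈ maximalIdeal S.toSubring ^ n}) => (n : ℕ∞))
      n h

theorem order_le_order_iff {S : LocalSubring K} {x y : S.toSubring} :
    order S y ≤ order S x ↔
      ∀ n : ℕ, y ∈ maximalIdeal S.toSubring ^ n → x ∈ maximalIdeal S.toSubring ^ n := by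
  simp only [← natCast_le_order_iff]
  exact ENat.forall_natCast_le_iff_le.symm

theorem exists_mul_pow_mem_of_mem_blowupChart {A : Subring K} {J : Ideal A} {a : A} (ha : a ≠ 0)
    {z : K} (hz : z ∈ blowupChart A J a) : ∃ n : ℕ, z * (a : K) ^ n ∈ A := by
  have ha' : (a : K) ≠ 0 := fun h => ha (Subtype.ext h)
  change z ∈ Algebra.adjoin A _ at hz
  induction hz using Algebra.adjoin_induction with
  | mem z hz => obtain ⟨x, hx, rfl⟩ := hz; exact ⟨1, by rw [pow_one, div_mul_cancel₀ _ ha']; exact x.2⟩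
  | algebraMap r => exact ⟨0, by rw [pow_zero, mul_one]; exact r.2⟩
  | add y z _ _ h1 h2 =>
    obtain ⟨n, hn⟩ := h1
    obtain ⟨m, hm⟩ := h2
    refine ⟨n + m, ?_⟩
    have : (y + z) * (a : K) ^ (n + m) = y * a ^ n * a ^ m + z * a ^ m * a ^ n := by ring
    rw [this]
    exact add_mem (mul_mem hn (pow_mem a.2 _)) (mul_mem hm (pow_mem a.2 _))
  | mul y z _ _ h1 h2 =>
    obtain ⟨n, hn⟩ := h1
    obtain ⟨m, hm⟩ := h2
    refine ⟨n + m, ?_⟩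
    have : (y * z) * (a : K) ^ (n + m) = y * a ^ n * (z * a ^ m) := by ring
    rw [this]
    exact mul_mem hn hm

/-- A point of a chart where the chart coordinate is invertible is a point of the base. -/
theorem mem_affineModel_of_inv_mem {A : Subring K} {J : Ideal A} {a : A} (ha : a ≠ 0)
    {W : LocalSubring K} (hW : W ∈ affineModel (blowupChart A J a))
    (hi : (a : K)⁻¹ ∈ W.toSubring) : W ∈ affineModel A := by
  have ha' : (a : K) ≠ 0 := fun h => ha (Subtype.ext h)
  rw [mem_affineModel_iff] at hW ⊢
  refine ⟨(le_blowupChart A J a).trans hW.1, fun z hz => ?_⟩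
  obtain ⟨α, hα, s, hs, hs0, hsi, rfl⟩ := hW.2 z hz
  obtain ⟨n, hn⟩ := exists_mul_pow_mem_of_mem_blowupChart ha hα
  obtain ⟨m, hm⟩ := exists_mul_pow_mem_of_mem_blowupChart ha hs
  refine ⟨α * a ^ n * a ^ m, mul_mem hn (pow_mem a.2 _), s * a ^ m * a ^ n,
    mul_mem hm (pow_mem a.2 _), mul_ne_zero (mul_ne_zero hs0 (pow_ne_zero _ ha'))
      (pow_ne_zero _ ha'), ?_, by field_simp⟩
  rw [mul_inv, mul_inv, ← inv_pow, ← inv_pow]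
  exact mul_mem (mul_mem hsi (pow_mem hi _)) (pow_mem hi _)

namespace IsLocalQuadraticTransform

variable {S T : LocalSubring K} [IsRegularLocalRing S.toSubring]

theorem isRegularLocalRing (h : IsLocalQuadraticTransform S T) :
    IsRegularLocalRing T.toSubring := by
  let := (Subring.inclusion h.1.1).toAlgebra
  obtain ⟨n, x, g, t, hc⟩ := h.exists_isBlowupChart
  exact hc.isRegularLocalRing

theorem prime_and_mem_pow_iff (h : IsLocalQuadraticTransform S T)
    {a : S.toSubring} (ha : a ∈ maximalIdeal S.toSubring) (ha0 : a ≠ 0)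
    (hT : T ∈ affineModel (blowupChart S.toSubring (maximalIdeal S.toSubring) a)) :
    Prime (Subring.inclusion h.1.1 a) ∧ ∀ (n : ℕ) (y : S.toSubring),
      y ∈ maximalIdeal S.toSubring ^ n ↔
        Subring.inclusion h.1.1 a ^ n ∣ Subring.inclusion h.1.1 y := by
  let := (Subring.inclusion h.1.1).toAlgebra
  obtain ⟨n, x, g, t, hc⟩ := h.exists_isBlowupChart
  have h1 : algebraMap S.toSubring T.toSubring x ∣ algebraMap S.toSubring T.toSubring a := by
    have := (hc.mem_pow_iff (n := 1) (y := a)).mp (by rwa [pow_one])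
    rwa [pow_one] at this
  have h2 : algebraMap S.toSubring T.toSubring a ∣ algebraMap S.toSubring T.toSubring x := by
    refine ⟨⟨x / a, (mem_affineModel_iff.mp hT).1 (div_mem_blowupChart hc.mem_maximalIdeal_left)⟩,
      Subtype.ext ?_⟩
    exact (mul_div_cancel₀ _ fun h => ha0 (Subtype.ext h)).symm
  have hassoc : Associated (algebraMap S.toSubring T.toSubring x) (algebraMap _ _ a) :=
    associated_of_dvd_dvd h1 h2
  refine ⟨hassoc.prime hc.prime_algebraMap, fun n y => ?_⟩
  rw [hc.mem_pow_iff]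
  exact (hassoc.pow_pow).dvd_iff_dvd_left

/-- On the chart the order is the adic order along the prime `a`. Cancelling the power of `a` in the
denominator moves a quotient `x / y` into the localization; conversely, powers of `a` clear chart
denominators, and an `s` outside `P` contributes no order. -/
theorem orderValuationRing_eq (h : IsLocalQuadraticTransform S T)
    {a : S.toSubring} (ha : a ∈ maximalIdeal S.toSubring) (ha0 : a ≠ 0)
    (hT : T ∈ affineModel (blowupChart S.toSubring (maximalIdeal S.toSubring) a))
    (P : Ideal T.toSubring) [P.IsPrime] (hP : P = Ideal.span {Subring.inclusion h.1.1 a}) :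
    orderValuationRing S = ((ofPrime T.toSubring P).toSubring : Set K) := by
  have hreg := h.isRegularLocalRing
  obtain ⟨hp, hpow⟩ := h.prime_and_mem_pow_iff ha ha0 hT
  have ha' : (a : K) ≠ 0 := fun h => ha0 (Subtype.ext h)
  have hmemP : ∀ s, s ∈ P ↔ Subring.inclusion h.1.1 a ∣ s := fun s => by
    rw [hP, Ideal.mem_span_singleton]
  ext z
  simp only [orderValuationRing, Set.mem_ofPred_eq, SetLike.mem_coe, order_le_order_iff]
  constructor
  · rw [mem_ofPrime_iff]
    rintro ⟨x, y, hy0, hxy, rfl⟩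
    have hy0' : Subring.inclusion h.1.1 y ≠ 0 := fun h' => hy0 (Subring.inclusion_injective _
      (by rw [h', map_zero]))
    obtain ⟨y', hy', hyd⟩ := (FiniteMultiplicity.of_prime_left hp hy0').exists_eq_pow_mul_and_not_dvd
    set n := multiplicity (Subring.inclusion h.1.1 a) (Subring.inclusion h.1.1 y)
    obtain ⟨x', hx'⟩ := (hpow n x).mp (hxy n ((hpow n y).mpr ⟨y', hy'⟩))
    refine ⟨x', y', fun h' => hyd ((hmemP _).mp h'), ?_⟩
    have hx'' : (x : K) = (a : K) ^ n * x' := congrArg Subtype.val hx'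
    have hy'' : (y : K) = (a : K) ^ n * y' := congrArg Subtype.val hy'
    rw [hx'', hy'', mul_div_mul_left _ _ (pow_ne_zero _ ha'), div_eq_mul_inv]
  · intro hz
    have hW : ofPrime T.toSubring P ∈
        affineModel (blowupChart S.toSubring (maximalIdeal S.toSubring) a) :=
      affineModel_trans hT ⟨P, inferInstance, rfl⟩
    obtain ⟨α, hα, s, hs, hs0, hsi, rfl⟩ := (mem_affineModel_iff.mp hW).2 z hz
    have hαT := (mem_affineModel_iff.mp hT).1 hα
    have hsT := (mem_affineModel_iff.mp hT).1 hs
    have hsP : (⟨s, hsT⟩ : T.toSubring) ∉ P :=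
      (inv_mem_ofPrime_iff (fun h' => hs0 (congrArg Subtype.val h'))).mp hsi
    obtain ⟨n, hn⟩ := exists_mul_pow_mem_of_mem_blowupChart ha0 hα
    obtain ⟨m, hm⟩ := exists_mul_pow_mem_of_mem_blowupChart ha0 hs
    have hy0 : s * (a : K) ^ m * a ^ n ≠ 0 :=
      mul_ne_zero (mul_ne_zero hs0 (pow_ne_zero _ ha')) (pow_ne_zero _ ha')
    refine ⟨⟨α * a ^ n * a ^ m, mul_mem hn (pow_mem a.2 _)⟩,
      ⟨s * a ^ m * a ^ n, mul_mem hm (pow_mem a.2 _)⟩, fun h' => hy0 (congrArg Subtype.val h'),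
      fun k hk => ?_, by field_simp⟩
    rw [hpow] at hk ⊢
    have h1 : Subring.inclusion h.1.1 ⟨s * a ^ m * a ^ n, mul_mem hm (pow_mem a.2 _)⟩ =
        Subring.inclusion h.1.1 a ^ (m + n) * ⟨s, hsT⟩ :=
      Subtype.ext (show s * (a : K) ^ m * a ^ n = (a : K) ^ (m + n) * s by ring)
    have h2 : Subring.inclusion h.1.1 ⟨α * a ^ n * a ^ m, mul_mem hn (pow_mem a.2 _)⟩ =
        Subring.inclusion h.1.1 a ^ (m + n) * ⟨α, hαT⟩ :=
      Subtype.ext (show α * (a : K) ^ n * a ^ m = (a : K) ^ (m + n) * α by ring)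
    have hk' : k ≤ m + n := by
      rw [h1] at hk
      by_contra hlt
      have hlt : m + n + 1 ≤ k := by omega
      have h3 := (pow_dvd_pow _ hlt).trans hk
      rw [pow_succ, mul_dvd_mul_iff_left (pow_ne_zero _ hp.ne_zero)] at h3
      exact hsP ((hmemP _).mpr h3)
    rw [h2]
    exact (pow_dvd_pow _ hk').mul_right _

/-- A discrete valuation ring that is a localization of a local quadratic transform of `S` is
either a localization of `S` or the order valuation ring of `S`. -/
theorem mem_affineModel_or_eq_orderValuationRing (h : IsLocalQuadraticTransform S T)
    {W : LocalSubring K} (hW : W ∈ affineModel T.toSubring)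
    [IsDiscreteValuationRing W.toSubring] :
    W ∈ affineModel S.toSubring ∨ (W.toSubring : Set K) = orderValuationRing S := by
  have hreg := h.isRegularLocalRing
  obtain ⟨a, ha, ha0, hT⟩ := h.2
  by_cases hi : (a : K)⁻¹ ∈ W.toSubring
  · exact Or.inl (mem_affineModel_of_inv_mem ha0 (affineModel_trans hT hW) hi)
  · right
    obtain ⟨hp, -⟩ := h.prime_and_mem_pow_iff ha ha0 hT
    obtain ⟨P, hP, rfl⟩ := hW
    have haP : Subring.inclusion h.1.1 a ∈ P := by
      by_contra h'
      exact hi ((inv_mem_ofPrime_iff hp.ne_zero).mpr h')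
    have hht : P.height = 1 := by
      have h1 := IsLocalization.AtPrime.ringKrullDim_eq_height P (ofPrime T.toSubring P).toSubring
      rw [IsDiscreteValuationRing.ringKrullDim_eq_one] at h1
      exact_mod_cast h1.symm
    refine (h.orderValuationRing_eq ha ha0 hT P ?_).symm
    have hq : (Ideal.span {Subring.inclusion h.1.1 a}).IsPrime :=
      (Ideal.span_singleton_prime hp.ne_zero).mpr hp
    have hle : Ideal.span {Subring.inclusion h.1.1 a} ≤ P :=
      (Ideal.span_singleton_le_iff_mem _).mpr haP
    by_contra hne
    have hlt := Ideal.height_strict_mono_of_isPrime_of_isPrime (lt_of_le_of_ne hle (Ne.symm hne))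
    rw [hht, Order.lt_one_iff, Ideal.height_eq_zero_iff_eq_bot,
      Ideal.span_singleton_eq_bot] at hlt
    exact hp.ne_zero hlt

/-- A regular local ring of dimension at least two is not a local quadratic transform of itself. -/
theorem ne_of_two_le_ringKrullDim (h : IsLocalQuadraticTransform S T)
    (hdim : 2 ≤ ringKrullDim S.toSubring) : T ≠ S := by
  rintro rfl
  obtain ⟨a, ha, ha0, hT⟩ := h.2
  obtain ⟨-, hpow⟩ := h.prime_and_mem_pow_iff ha ha0 hT
  -- On its own quadratic transform, the ring would have a principal maximal ideal, which
  -- contradicts the dimension.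
  have h1 : maximalIdeal T.toSubring = Ideal.span {a} := by
    refine le_antisymm (fun y hy => ?_) ((Ideal.span_singleton_le_iff_mem _).mpr ha)
    have := (hpow 1 y).mp (by rwa [pow_one])
    rw [pow_one] at this
    rw [Ideal.mem_span_singleton]
    obtain ⟨c, hc⟩ := this
    exact ⟨c, Subtype.ext (congrArg Subtype.val hc)⟩
  have h2 : (maximalIdeal T.toSubring).spanFinrank ≤ 1 := by
    rw [h1]
    exact (Submodule.spanFinrank_span_le_ncard_of_finite (Set.finite_singleton a)).trans
      (Set.ncard_singleton a).le
  rw [← IsRegularLocalRing.spanFinrank_maximalIdeal] at hdim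
  have h3 : 2 ≤ (maximalIdeal T.toSubring).spanFinrank := by exact_mod_cast hdim
  omega

end IsLocalQuadraticTransform

end BlowupModel

/-! ### Stages of the blowup sequence and their divisorial rings. -/

namespace BlowupModel

open LocalSubring

variable {K : Type*} [Field K]

theorem ofPrime_maximalIdeal (R : LocalSubring K) :
    ofPrime R.toSubring (maximalIdeal R.toSubring) = R :=
  toSubring_injective (le_antisymm (ofPrime_le_of_forall le_rfl fun s hs =>
    (isUnit_iff_inv_mem.mp (by simpa using hs)).2) (le_ofPrime _ _))

/-- The points of the stages are localizations of `R`, or regular and obtained from `R` by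
a sequence of local quadratic transforms. -/
theorem exists_ofPrime_or_reflTransGen_of_mem_stage {R : LocalSubring K}
    [IsRegularLocalRing R.toSubring] {Γ : Set (LocalSubring K)}
    (hΓ : ∀ Q ∈ Γ, IsInfinitelyNear R Q) {k : ℕ} {T : LocalSubring K} (hT : T ∈ stage R Γ k) :
    (∃ (P : Ideal R.toSubring) (_ : P.IsPrime), P ≠ maximalIdeal R.toSubring ∧
      T = ofPrime R.toSubring P) ∨
    (IsRegularLocalRing T.toSubring ∧ Relation.ReflTransGen IsLocalQuadraticTransform R T) := by
  induction k generalizing T with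
  | zero =>
    obtain ⟨P, hP, rfl⟩ := hT
    by_cases h : P = maximalIdeal R.toSubring
    · subst h
      rw [ofPrime_maximalIdeal]
      exact Or.inr ⟨inferInstance, .refl⟩
    · exact Or.inl ⟨P, hP, h, rfl⟩
  | succ k ih =>
    rcases hT with ⟨hT, -⟩ | ⟨S, -, hSΓ, hST⟩
    · exact ih hT
    · obtain ⟨hreg, -, hRS⟩ := hΓ S hSΓ
      exact Or.inr ⟨hST.isRegularLocalRing, hRS.tail hST⟩

theorem le_of_mem_stage {R : LocalSubring K} {Γ : Set (LocalSubring K)} {k : ℕ}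
    {T : LocalSubring K} (hT : T ∈ stage R Γ k) : R.toSubring ≤ T.toSubring := by
  induction k generalizing T with
  | zero =>
    obtain ⟨P, hP, rfl⟩ := hT
    exact le_ofPrime _ _
  | succ k ih =>
    rcases hT with ⟨hT, -⟩ | ⟨S, hS, -, hST⟩
    · exact ih hT
    · exact (ih hS).trans hST.1.1

theorem isNoetherianRing_of_mem_stage {R : LocalSubring K}
    [IsRegularLocalRing R.toSubring] {Γ : Set (LocalSubring K)}
    (hΓ : ∀ Q ∈ Γ, IsInfinitelyNear R Q) {k : ℕ} {T : LocalSubring K} (hT : T ∈ stage R Γ k) :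
    IsNoetherianRing T.toSubring := by
  rcases exists_ofPrime_or_reflTransGen_of_mem_stage hΓ hT with ⟨P, hP, -, rfl⟩ | ⟨hreg, -⟩
  · exact IsLocalization.isNoetherianRing P.primeCompl _ inferInstance
  · infer_instance

theorem uniqueFactorizationMonoid_of_mem_stage {R : LocalSubring K}
    [IsRegularLocalRing R.toSubring] {Γ : Set (LocalSubring K)}
    (hΓ : ∀ Q ∈ Γ, IsInfinitelyNear R Q) {k : ℕ} {T : LocalSubring K} (hT : T ∈ stage R Γ k) :
    UniqueFactorizationMonoid T.toSubring := by
  rcases exists_ofPrime_or_reflTransGen_of_mem_stage hΓ hT with ⟨P, hP, -, rfl⟩ | ⟨hreg, -⟩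
  · have := IsRegularLocalRing.uniqueFactorizationMonoid R.toSubring
    exact UniqueFactorizationMonoid.of_isLocalization P.primeCompl _
  · exact IsRegularLocalRing.uniqueFactorizationMonoid _

/-- The discrete valuation rings that are localizations of `R` or order valuation rings of
points in `Γ`. -/
def divisorialRings (R : LocalSubring K) (Γ : Set (LocalSubring K)) : Set (LocalSubring K) :=
  {W | IsDiscreteValuationRing W.toSubring ∧ (W ∈ affineModel R.toSubring ∨
    ∃ Q ∈ Γ, (W.toSubring : Set K) = orderValuationRing Q)}

/-- Going down one stage, such a ring either remains a localization of the blown-up point or is that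
point's order valuation ring. -/
theorem mem_divisorialRings_of_mem_stage {R : LocalSubring K} {Γ : Set (LocalSubring K)}
    (hΓ : ∀ Q ∈ Γ, IsInfinitelyNear R Q) {k : ℕ} {T : LocalSubring K} (hT : T ∈ stage R Γ k)
    {W : LocalSubring K} (hW : W ∈ affineModel T.toSubring)
    [IsDiscreteValuationRing W.toSubring] : W ∈ divisorialRings R Γ := by
  refine ⟨inferInstance, ?_⟩
  induction k generalizing T with
  | zero => exact Or.inl (affineModel_trans hT hW)
  | succ k ih =>
    rcases hT with ⟨hT, -⟩ | ⟨S, hS, hSΓ, hST⟩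
    · exact ih hT hW
    · have := (hΓ S hSΓ).1
      rcases hST.mem_affineModel_or_eq_orderValuationRing hW with h | h
      · exact ih hS h
      · exact Or.inr ⟨S, hSΓ, h⟩

/-- Every valuation ring dominating `S` dominates a local quadratic transform of `S`. -/
theorem exists_isLocalQuadraticTransform_le {S : LocalSubring K} [IsNoetherianRing S.toSubring]
    (hS : maximalIdeal S.toSubring ≠ ⊥) {V : ValuationSubring K} (hV : S ≤ V.toLocalSubring) :
    ∃ T, IsLocalQuadraticTransform S T ∧ T ≤ V.toLocalSubring := by
  obtain ⟨U, hU⟩ := IsNoetherian.noetherian (maximalIdeal S.toSubring)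
  have hne : U.Nonempty := by
    rw [Finset.nonempty_iff_ne_empty]
    rintro rfl
    exact hS (by rw [← hU]; simp)
  -- The valuation is multiplicative, so the generator of largest value divides the others in `V`;
  -- its chart is the one contained in `V`.
  obtain ⟨a, haU, hmax⟩ := U.exists_max_image (fun u => V.valuation (u : K)) hne
  have ham : a ∈ maximalIdeal S.toSubring := by rw [← hU]; exact Submodule.subset_span haU
  have hle : ∀ u ∈ maximalIdeal S.toSubring, V.valuation (u : K) ≤ V.valuation (a : K) := by
    intro u hu
    rw [← hU] at hu
    induction hu using Submodule.span_induction with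
    | mem u hu => exact hmax u hu
    | zero => simp
    | add u v _ _ h1 h2 => exact (V.valuation.map_add _ _).trans (max_le h1 h2)
    | smul r u _ h =>
      rw [smul_eq_mul, Subring.coe_mul, map_mul]
      have h1 : V.valuation (r : K) ≤ 1 := (V.valuation_le_one_iff _).mpr (hV.1 r.2)
      exact (mul_le_of_le_one_left' h1).trans h
  have ha0 : a ≠ 0 := by
    rintro rfl
    refine hS ((Submodule.eq_bot_iff _).mpr fun u hu => ?_)
    have := hle u hu
    rw [Subring.coe_zero, map_zero, le_zero_iff, map_eq_zero] at this
    exact Subtype.ext this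
  have ha0' : (a : K) ≠ 0 := fun h => ha0 (Subtype.ext h)
  have hchart : blowupChart S.toSubring (maximalIdeal S.toSubring) a ≤ V.toLocalSubring.toSubring := by
    refine blowupChart_le hV.1 fun x hx => ?_
    change (x : K) / a ∈ V
    rw [← V.valuation_le_one_iff, map_div₀]
    exact div_le_one_of_le₀ (hle x hx) zero_le
  obtain ⟨T, hT, hTV⟩ := exists_mem_affineModel_le hchart
  have hST : S.toSubring ≤ T.toSubring := (le_blowupChart _ _ _).trans (mem_affineModel_iff.mp hT).1
  exact ⟨T, ⟨le_iff_inv_mem.mpr ⟨hST, fun s hs hs' => (le_iff_inv_mem.mp hV).2 s hs (hTV.1 hs')⟩,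
    a, ham, ha0, hT⟩, hTV⟩

/-- Every valuation ring containing `R` has a center outside `Γ` on some stage. -/
theorem exists_mem_stage_notMem_le {R : LocalSubring K} {Γ : Set (LocalSubring K)}
    (hΓ : ∀ Q ∈ Γ, IsInfinitelyNear R Q) (hfin : Γ.Finite) {V : ValuationSubring K}
    (hV : R.toSubring ≤ V.toSubring) :
    ∃ k, ∃ T ∈ stage R Γ k, T ∉ Γ ∧ T ≤ V.toLocalSubring := by
  obtain ⟨T₀, hT₀, hT₀V⟩ := exists_mem_affineModel_le (V := V.toLocalSubring) hV
  by_contra hcon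
  push Not at hcon
  have hmem : ∀ k, ∀ T ∈ stage R Γ k, T ≤ V.toLocalSubring → T ∈ Γ := fun k T hT hTV => by
    by_contra h
    exact hcon k T hT h hTV
  have hfin' : {T | T ∈ Γ ∧ ∃ k, T ∈ stage R Γ k ∧ T ≤ V.toLocalSubring}.Finite :=
    hfin.subset fun T hT => hT.1
  -- If all centres were in the finite set `Γ`, one would be maximal for domination; blowing it up
  -- gives a strictly larger centre on the next stage.
  obtain ⟨T, ⟨hTΓ, k, hTk, hTV⟩, hmax⟩ := hfin'.exists_maximal ⟨T₀, hmem 0 T₀ hT₀ hT₀V, 0, hT₀, hT₀V⟩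
  obtain ⟨hreg, hdim, -⟩ := hΓ T hTΓ
  have hne : maximalIdeal T.toSubring ≠ ⊥ := by
    intro h
    have h1 : ringKrullDim T.toSubring = 0 :=
      ringKrullDim_eq_zero_of_isField (IsLocalRing.isField_iff_maximalIdeal_eq.mpr h)
    rw [h1] at hdim
    exact absurd hdim (by decide)
  obtain ⟨T', hTT', hT'V⟩ := exists_isLocalQuadraticTransform_le hne hTV
  have hT'k : T' ∈ stage R Γ (k + 1) := Or.inr ⟨T, hTk, hTΓ, hTT'⟩
  have hle := hmax ⟨hmem _ T' hT'k hT'V, k + 1, hT'k, hT'V⟩ hTT'.1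
  exact hTT'.ne_of_two_le_ringKrullDim hdim (le_antisymm hle hTT'.1)

theorem mem_saturatedModel_of_notMem {R : LocalSubring K} {Γ : Set (LocalSubring K)} {k : ℕ}
    {T : LocalSubring K} (hT : T ∈ stage R Γ k) (hTΓ : T ∉ Γ) : T ∈ saturatedModel R Γ := by
  refine Filter.eventually_atTop.mpr ⟨k, fun j hj => ?_⟩
  induction j, hj using Nat.le_induction with
  | base => exact hT
  | succ j _ ih => exact Or.inl ⟨ih, hTΓ⟩

end BlowupModel

/-! ### Principal ideals in local and factorial rings. -/

section LocalPrincipal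

theorem Ideal.exists_eq_span_singleton_mul_of_le {T : Type*} [CommRing T] {J : Ideal T} {a : T}
    (h : J ≤ Ideal.span {a}) : ∃ L, J = Ideal.span {a} * L := by
  refine ⟨Submodule.comap (LinearMap.mulLeft T a) J, le_antisymm (fun x hx => ?_) ?_⟩
  · obtain ⟨c, rfl⟩ := Ideal.mem_span_singleton.mp (h hx)
    exact Ideal.mul_mem_mul (Ideal.mem_span_singleton_self a) hx
  · rw [Ideal.span_singleton_mul_le_iff]
    exact fun z hz => hz

/-- If elements of a local domain generate a nonzero principal ideal, one of them divides
the others. -/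
theorem IsLocalRing.exists_mem_forall_dvd_of_span_eq {T : Type*} [CommRing T] [IsLocalRing T]
    [IsDomain T] {X : Set T} {a : T} (ha : a ≠ 0) (h : Ideal.span X = Ideal.span {a}) :
    ∃ b ∈ X, ∀ x ∈ X, b ∣ x := by
  by_contra hcon
  push Not at hcon
  have hX : ∀ x ∈ X, a ∣ x := fun x hx => by
    rw [← Ideal.mem_span_singleton, ← h]; exact Ideal.subset_span hx
  have h1 : Ideal.span X ≤ Ideal.span {a} * maximalIdeal T := by
    refine Ideal.span_le.mpr fun x hx => ?_
    obtain ⟨c, rfl⟩ := hX x hx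
    refine Ideal.mul_mem_mul (Ideal.mem_span_singleton_self a) ?_
    rw [mem_maximalIdeal, mem_nonunits_iff]
    intro hc
    obtain ⟨y, hy, hy'⟩ := hcon _ hx
    exact hy' (hc.mul_right_dvd.mpr (hX y hy))
  rw [h, Ideal.span_singleton_le_iff_mem, Ideal.mem_span_singleton_mul] at h1
  obtain ⟨c, hc, hac⟩ := h1
  have : c = 1 := mul_left_cancel₀ ha (by rw [hac, mul_one])
  rw [this] at hc
  exact (Ideal.ne_top_iff_one _).mp (Ideal.IsPrime.ne_top inferInstance) hc

/-- Principal ideals containing `J` correspond to common divisors of its generators, so the greatest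
common divisor gives the smallest one. -/
theorem UniqueFactorizationMonoid.exists_isLeast_span_singleton {T : Type*} [CommRing T]
    [IsDomain T] [IsNoetherianRing T] [UniqueFactorizationMonoid T] (J : Ideal T) (hJ : J ≠ ⊥) :
    ∃ a ≠ 0, IsLeast {L : Ideal T | J ≤ L ∧ ∃ b, L = Ideal.span {b}} (Ideal.span {a}) := by
  classical
  let _ : StrongNormalizationMonoid T := UniqueFactorizationMonoid.strongNormalizationMonoid
  let _ := UniqueFactorizationMonoid.toNormalizedGCDMonoid T
  obtain ⟨s, hs⟩ := IsNoetherian.noetherian J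
  have hle : ∀ b, J ≤ Ideal.span {b} ↔ b ∣ s.gcd id := fun b => by
    rw [← hs, Finset.dvd_gcd_iff, Submodule.span_le]
    simp [Set.subset_def, Ideal.mem_span_singleton]
  refine ⟨s.gcd id, fun h0 => hJ ?_, ⟨(hle _).mpr dvd_rfl, _, rfl⟩, ?_⟩
  · have := (hle 0).mpr h0.symm.dvd
    rw [Ideal.span_singleton_eq_bot.mpr rfl] at this
    exact le_bot_iff.mp this
  · rintro _ ⟨h, b, rfl⟩
    exact Ideal.span_singleton_le_span_singleton.mpr ((hle b).mp h)

theorem IsRegularLocalRing.isPrincipalIdealRing_of_ringKrullDim_lt_two {T : Type*} [CommRing T]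
    [IsRegularLocalRing T] (h : ¬ 2 ≤ ringKrullDim T) : IsPrincipalIdealRing T := by
  rw [← IsRegularLocalRing.spanFinrank_maximalIdeal] at h
  have h1 : ¬ 2 ≤ (maximalIdeal T).spanFinrank := fun h' => h (by exact_mod_cast h')
  refine ((tfae_of_isNoetherianRing_of_isLocalRing_of_isDomain T).out 0 5).mpr ?_
  rw [← spanFinrank_maximalIdeal_eq_finrank_cotangentSpace]
  omega

end LocalPrincipal

/-! ### Normality of the charts, and principality of `I` away from the base points. -/

namespace BlowupModel

open LocalSubring

variable {K : Type*} [Field K]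

theorem isFractionRing_of_le {A B : Subring K} (h : A ≤ B) [IsFractionRing A K] :
    IsFractionRing B K := by
  refine IsFractionRing.of_field B K fun z => ?_
  obtain ⟨x, y, -, rfl⟩ := IsFractionRing.div_surjective (A := A) z
  exact ⟨Subring.inclusion h x, Subring.inclusion h y, rfl⟩

theorem mem_of_isIntegral_of_le {A B : Subring K} (h : A ≤ B) [IsFractionRing B K]
    [IsIntegrallyClosed B] {z : K} (hz : IsIntegral A z) : z ∈ B := by
  let := (Subring.inclusion h).toAlgebra
  have : IsScalarTower A B K := .of_algebraMap_eq fun _ => rfl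
  obtain ⟨y, rfl⟩ := IsIntegrallyClosed.isIntegral_iff.mp (hz.tower_top : IsIntegral B z)
  exact y.2

theorem blowupChart_le_normalizedChart (A : Subring K) (J : Ideal A) (a : A) :
    blowupChart A J a ≤ normalizedChart A J a := fun z hz =>
  (integralClosure (blowupChart A J a) K).algebraMap_mem ⟨z, hz⟩

theorem mem_normalizedChart_iff {A : Subring K} {J : Ideal A} {a : A} {z : K} :
    z ∈ normalizedChart A J a ↔ IsIntegral (blowupChart A J a) z := Iff.rfl

theorem mem_normalizedChart_of_isIntegral {A : Subring K} {J : Ideal A} {a : A} {z : K}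
    (hz : IsIntegral (normalizedChart A J a) z) : z ∈ normalizedChart A J a := by
  have hz' : IsIntegral (integralClosure (blowupChart A J a) K) z := hz
  exact isIntegral_trans (R := blowupChart A J a) z hz'

theorem isIntegrallyClosedIn_of_mem_normalizedBlowup {A : Subring K} {J : Ideal A}
    {S : LocalSubring K} (hS : S ∈ normalizedBlowup A J) : IsIntegrallyClosedIn S.toSubring K := by
  obtain ⟨a, -, -, P, hP, rfl⟩ := hS
  rw [isIntegrallyClosedIn_iff]
  refine ⟨Subtype.val_injective, fun {z} hz => ?_⟩
  obtain ⟨m, hm⟩ := hz.exists_multiple_integral_of_isLocalization (R := normalizedChart A J a)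
    P.primeCompl z
  have h1 := mem_normalizedChart_of_isIntegral hm
  have hm0 : ((m : normalizedChart A J a) : K) ≠ 0 := fun h => m.2 (by
    rw [show (m : normalizedChart A J a) = 0 from Subtype.ext h]; exact zero_mem _)
  have h2 : z ∈ (ofPrime (normalizedChart A J a) P).toSubring := by
    refine mem_ofPrime_iff.mpr ⟨⟨_, h1⟩, m, m.2, ?_⟩
    change z = ((m : normalizedChart A J a) : K) * z * _
    field_simp
  exact ⟨⟨z, h2⟩, rfl⟩

/-- In a local ring the generator of a principal extension can be chosen in `I` itself, so it can
serve as the denominator of a chart of the blowup. -/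
theorem exists_mem_forall_div_mem {R : LocalSubring K} {I : Ideal R.toSubring} {T : LocalSubring K}
    {a : T.toSubring} (ha : a ≠ 0)
    (h : extendIdeal R.toSubring I T.toSubring = Ideal.span {a}) :
    ∃ b ∈ I, b ≠ 0 ∧ ∀ x ∈ I, (x : K) ∈ T.toSubring → (x : K) / b ∈ T.toSubring := by
  obtain ⟨b', ⟨b, hb, hbb⟩, hdvd⟩ := IsLocalRing.exists_mem_forall_dvd_of_span_eq ha h
  have hb0 : b' ≠ 0 := by
    rintro rfl
    have h1 : extendIdeal R.toSubring I T.toSubring = ⊥ := by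
      refine Ideal.span_eq_bot.mpr fun x hx => ?_
      exact zero_dvd_iff.mp (hdvd x hx)
    rw [h1] at h
    exact ha (Ideal.span_singleton_eq_bot.mp h.symm)
  have hb0K : (b' : K) ≠ 0 := fun h => hb0 (Subtype.ext h)
  refine ⟨b, hb, fun h => hb0 (Subtype.ext (by rw [hbb, h]; rfl)), fun x hx hxT => ?_⟩
  obtain ⟨c, hc⟩ := hdvd ⟨x, hxT⟩ ⟨x, hx, rfl⟩
  have : (x : K) = b' * c := congrArg Subtype.val hc
  rw [this, ← hbb, mul_div_cancel_left₀ _ hb0K]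
  exact c.2

theorem maximalIdeal_ne_bot_of_two_le {R : LocalSubring K} (hdim : 2 ≤ ringKrullDim R.toSubring) :
    maximalIdeal R.toSubring ≠ ⊥ := by
  intro h
  rw [ringKrullDim_eq_zero_of_isField (IsLocalRing.isField_iff_maximalIdeal_eq.mpr h)] at hdim
  exact absurd hdim (by decide)

theorem exists_mem_notMem_of_ne_maximalIdeal {R : LocalSubring K} {I : Ideal R.toSubring}
    (hI : I.radical = maximalIdeal R.toSubring) {P : Ideal R.toSubring} [hP : P.IsPrime]
    (hPm : P ≠ maximalIdeal R.toSubring) : ∃ x ∈ I, x ∉ P := by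
  by_contra hcon
  push Not at hcon
  have h1 : maximalIdeal R.toSubring ≤ P := by
    rw [← hI]
    exact hP.radical_le_iff.mpr hcon
  exact hPm (le_antisymm (IsLocalRing.le_maximalIdeal hP.ne_top) h1)

section Primary

variable {R : LocalSubring K} [IsRegularLocalRing R.toSubring]
  {I : Ideal R.toSubring}

/-- `I T` is principal for one of three reasons: `T` is a localization of `R` away from the closed
point, where `I` is the unit ideal; or `T` has dimension at least two and the transform, being
improper, leaves only the principal factor; or `T` has dimension at most one and is a principal
ideal ring. -/
theorem exists_div_mem_of_mem_stage_of_notMem (hdim : 2 ≤ ringKrullDim R.toSubring)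
    (hI : I.radical = maximalIdeal R.toSubring) {k : ℕ} {T : LocalSubring K}
    (hT : T ∈ stage R (basePoints R I) k) (hTΓ : T ∉ basePoints R I) :
    ∃ b ∈ I, b ≠ 0 ∧ ∀ x ∈ I, (x : K) / b ∈ T.toSubring := by
  have hRT := le_of_mem_stage hT
  have hI0 : I ≠ ⊥ := by
    rintro rfl
    refine maximalIdeal_ne_bot_of_two_le hdim ?_
    rw [← hI]
    exact Ideal.radical_bot_of_isReduced
  have hJ0 : extendIdeal R.toSubring I T.toSubring ≠ ⊥ := by
    obtain ⟨x, hx, hx0⟩ := Submodule.exists_mem_ne_zero_of_ne_bot hI0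
    intro h
    have h1 := Ideal.span_eq_bot.mp h (Subring.inclusion hRT x) ⟨x, hx, rfl⟩
    exact hx0 (Subring.inclusion_injective hRT (by rw [h1, map_zero]))
  rcases exists_ofPrime_or_reflTransGen_of_mem_stage (fun Q hQ => hQ.1) hT with
    ⟨P, hP, hPm, rfl⟩ | ⟨hreg, htrans⟩
  · obtain ⟨b, hb, hbP⟩ := exists_mem_notMem_of_ne_maximalIdeal hI hPm
    have hb0 : b ≠ 0 := by rintro rfl; exact hbP (zero_mem _)
    refine ⟨b, hb, hb0, fun x _ => ?_⟩
    rw [div_eq_mul_inv]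
    exact mul_mem (hRT x.2) ((inv_mem_ofPrime_iff hb0).mpr hbP)
  · suffices ∃ a ≠ 0, extendIdeal R.toSubring I T.toSubring = Ideal.span {a} by
      obtain ⟨a, ha, h⟩ := this
      obtain ⟨b, hb, hb0, h'⟩ := exists_mem_forall_div_mem ha h
      exact ⟨b, hb, hb0, fun x hx => h' x hx (hRT x.2)⟩
    by_cases hdimT : 2 ≤ ringKrullDim T.toSubring
    · have := IsRegularLocalRing.uniqueFactorizationMonoid T.toSubring
      obtain ⟨a, ha0, hleast⟩ := UniqueFactorizationMonoid.exists_isLeast_span_singleton _ hJ0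
      obtain ⟨J, hJ⟩ := Ideal.exists_eq_span_singleton_mul_of_le hleast.1.1
      refine ⟨a, ha0, ?_⟩
      have hJtop : J = ⊤ := by
        by_contra hne
        exact hTΓ ⟨⟨hreg, hdimT, htrans⟩, J, ⟨a, ha0, hleast, hJ⟩, hne⟩
      rw [hJ, hJtop, Ideal.mul_top]
    · have := IsRegularLocalRing.isPrincipalIdealRing_of_ringKrullDim_lt_two hdimT
      obtain ⟨a, ha⟩ := IsPrincipalIdealRing.principal (extendIdeal R.toSubring I T.toSubring)
      refine ⟨a, ?_, ha⟩
      rintro rfl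
      exact hJ0 (ha.trans (Ideal.span_singleton_eq_bot.mpr rfl))

end Primary

end BlowupModel

/-! ### Points of the normalized blowup as intersections of divisorial rings. -/

namespace BlowupModel

open LocalSubring

variable {K : Type*} [Field K]

/-- From `a⁻¹ = x / y` one gets `y = a * x`. As `x` has at least the order of `y`, it lies in every
power of the maximal ideal, so Krull's intersection theorem makes it zero. -/
theorem inv_notMem_orderValuationRing {Q : LocalSubring K} [IsRegularLocalRing Q.toSubring]
    {a : Q.toSubring} (ha : a ∈ maximalIdeal Q.toSubring) (ha0 : a ≠ 0) :
    (a : K)⁻¹ ∉ orderValuationRing Q := by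
  rintro ⟨x, y, hy0, hxy, h⟩
  have ha0K : (a : K) ≠ 0 := fun h => ha0 (Subtype.ext h)
  have hy0K : (y : K) ≠ 0 := fun h => hy0 (Subtype.ext h)
  have hyax : y = a * x := Subtype.ext (by
    rw [Subring.coe_mul]; field_simp at h; exact h)
  rw [order_le_order_iff] at hxy
  have hx : ∀ n, x ∈ maximalIdeal Q.toSubring ^ n := by
    intro n
    induction n with
    | zero => simp
    | succ n ih =>
      refine hxy _ ?_
      rw [hyax, pow_succ']
      exact Ideal.mul_mem_mul ha ih
  have hx0 : x = 0 := by
    have := Ideal.iInf_pow_eq_bot_of_isLocalRing (maximalIdeal Q.toSubring)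
      (Ideal.IsPrime.ne_top inferInstance)
    rw [← Ideal.mem_bot, ← this, Ideal.mem_iInf]
    exact hx
  exact hy0 (by rw [hyax, hx0, mul_zero])

theorem le_of_isInfinitelyNear {R Q : LocalSubring K} (h : IsInfinitelyNear R Q) : R ≤ Q := by
  obtain ⟨-, -, h⟩ := h
  induction h with
  | refl => exact le_rfl
  | tail _ h ih => exact ih.trans h.1

section Primary

variable {R : LocalSubring K} [IsRegularLocalRing R.toSubring]
  {I : Ideal R.toSubring}

theorem isIntegrallyClosed_of_mem_stage {k : ℕ} {T : LocalSubring K}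
    (hT : T ∈ stage R (basePoints R I) k) : IsIntegrallyClosed T.toSubring := by
  have := uniqueFactorizationMonoid_of_mem_stage (fun Q (hQ : Q ∈ basePoints R I) => hQ.1) hT
  infer_instance

/-- A divisorial ring that is a localization of `R` inverts the generators of `I`
on every chart it contains, and one of any two relatively prime elements of `R`. -/
theorem inv_mem_of_mem_affineModel (hdim : 2 ≤ ringKrullDim R.toSubring)
    (hI : I.radical = maximalIdeal R.toSubring)
    {W : LocalSubring K} (hW : W ∈ affineModel R.toSubring)
    [IsDiscreteValuationRing W.toSubring] :
    (∀ a : R.toSubring, (∀ x ∈ I, (x : K) / a ∈ W.toSubring) → (a : K)⁻¹ ∈ W.toSubring) ∧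
    ∀ y w : R.toSubring, IsRelPrime y w → y ≠ 0 → w ≠ 0 →
      (y : K)⁻¹ ∈ W.toSubring ∨ (w : K)⁻¹ ∈ W.toSubring := by
  obtain ⟨P, hP, rfl⟩ := hW
  have hht : P.height = 1 := by
    have h1 := IsLocalization.AtPrime.ringKrullDim_eq_height P (ofPrime R.toSubring P).toSubring
    rw [IsDiscreteValuationRing.ringKrullDim_eq_one] at h1
    exact_mod_cast h1.symm
  constructor
  · intro a ha
    have hPm : P ≠ maximalIdeal R.toSubring := by
      rintro rfl
      rw [← IsLocalRing.maximalIdeal_height_eq_ringKrullDim, hht] at hdim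
      exact absurd hdim (by decide)
    obtain ⟨x, hx, hxP⟩ := exists_mem_notMem_of_ne_maximalIdeal hI hPm
    have hx0 : x ≠ 0 := by rintro rfl; exact hxP (zero_mem _)
    have hx0K : (x : K) ≠ 0 := fun h => hx0 (Subtype.ext h)
    have : (a : K)⁻¹ = (x : K)⁻¹ * (x / a) := by field_simp
    rw [this]
    exact mul_mem ((inv_mem_ofPrime_iff hx0).mpr hxP) (ha x hx)
  · intro y w hyw hy hw
    rw [inv_mem_ofPrime_iff hy, inv_mem_ofPrime_iff hw]
    by_contra! hcon
    have := IsRegularLocalRing.uniqueFactorizationMonoid R.toSubring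
    obtain ⟨p, hp⟩ := UniqueFactorizationMonoid.isPrincipal_of_height_eq_one hht
    have hmem : ∀ r, r ∈ P ↔ p ∣ r := fun r => by
      rw [hp]; exact Ideal.mem_span_singleton
    have h1 := hyw ((hmem y).mp hcon.1) ((hmem w).mp hcon.2)
    exact hP.ne_top (Ideal.eq_top_of_isUnit_mem _ ((hmem p).mpr dvd_rfl) h1)

theorem ofPrime_mem_divisorialRings_of_mem_stage {k : ℕ} {T : LocalSubring K}
    (hT : T ∈ stage R (basePoints R I) k) (q : Ideal T.toSubring) [q.IsPrime]
    (hq : q.height = 1) : ofPrime T.toSubring q ∈ divisorialRings R (basePoints R I) := by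
  have := isIntegrallyClosed_of_mem_stage hT
  have := isNoetherianRing_of_mem_stage (fun Q (hQ : Q ∈ basePoints R I) => hQ.1) hT
  have := IsLocalization.AtPrime.isDiscreteValuationRing_of_height_eq_one q hq
    (ofPrime T.toSubring q).toSubring
  exact mem_divisorialRings_of_mem_stage (fun Q hQ => hQ.1) hT ⟨q, inferInstance, rfl⟩

variable [IsFractionRing R.toSubring K]

/-- Every valuation ring dominating a point `S` of the normalized blowup dominates
a point outside the base points on some stage, which dominates `S`. -/
theorem exists_mem_stage_notMem_le_of_le (hdim : 2 ≤ ringKrullDim R.toSubring)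
    (hI : I.radical = maximalIdeal R.toSubring) (hfin : (basePoints R I).Finite)
    {S : LocalSubring K} (hS : S ∈ normalizedBlowup R.toSubring I)
    {V : ValuationSubring K} (hV : S ≤ V.toLocalSubring) :
    ∃ k, ∃ T ∈ stage R (basePoints R I) k, T ∉ basePoints R I ∧ T ≤ V.toLocalSubring ∧ S ≤ T := by
  obtain ⟨a, haI, ha0, P, hP, rfl⟩ := hS
  have haK : (a : K) ≠ 0 := fun h => ha0 (Subtype.ext h)
  have hchartS := (blowupChart_le_normalizedChart R.toSubring I a).trans (le_ofPrime _ P)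
  have hRV : R.toSubring ≤ V.toSubring :=
    ((le_blowupChart R.toSubring I a).trans hchartS).trans hV.1
  obtain ⟨k, T, hT, hTΓ, hTV⟩ := exists_mem_stage_notMem_le (fun Q hQ => hQ.1) hfin hRV
  obtain ⟨b, hb, hb0, hdiv⟩ := exists_div_mem_of_mem_stage_of_notMem hdim hI hT hTΓ
  have hbK : (b : K) ≠ 0 := fun h => hb0 (Subtype.ext h)
  have hRT := le_of_mem_stage hT
  -- `a / b` lies in `T` because `b` generates `I T`, and its inverse lies in `V` because `S` lies
  -- over the chart of `a`. Since `V` dominates `T`, the inverse is already in `T`.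
  have hba : (b : K) / a ∈ T.toSubring := by
    rw [← inv_div]
    refine (le_iff_inv_mem.mp hTV).2 _ (hdiv a haI) ?_
    rw [inv_div]
    exact hV.1 (hchartS (div_mem_blowupChart hb))
  have := isFractionRing_of_le hRT
  have := isIntegrallyClosed_of_mem_stage hT
  have hchartT : blowupChart R.toSubring I a ≤ T.toSubring := by
    refine blowupChart_le hRT fun x hx => ?_
    have : (x : K) / a = x / b * (b / a) := by field_simp
    rw [this]
    exact mul_mem (hdiv x hx) hba
  have hBT : normalizedChart R.toSubring I a ≤ T.toSubring := fun z hz =>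
    mem_of_isIntegral_of_le hchartT (mem_normalizedChart_iff.mp hz)
  have hST : (ofPrime (normalizedChart R.toSubring I a) P).toSubring ≤ T.toSubring := by
    refine ofPrime_le_of_forall hBT fun s hs => (le_iff_inv_mem.mp hTV).2 _ (hBT s.2) (hV.1 ?_)
    have hs0 : s ≠ 0 := by rintro rfl; exact hs (zero_mem _)
    exact (inv_mem_ofPrime_iff hs0).mpr hs
  exact ⟨k, T, hT, hTΓ, hTV, le_iff_inv_mem.mpr
    ⟨hST, fun s hs hs' => (le_iff_inv_mem.mp hV).2 s hs (hTV.1 hs')⟩⟩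

/-- A point of the normalized blowup is the intersection of the divisorial rings containing it. -/
theorem mem_of_forall_mem_divisorialRings (hdim : 2 ≤ ringKrullDim R.toSubring)
    (hI : I.radical = maximalIdeal R.toSubring) (hfin : (basePoints R I).Finite)
    {S : LocalSubring K} (hS : S ∈ normalizedBlowup R.toSubring I) {z : K}
    (hz : ∀ W ∈ divisorialRings R (basePoints R I), S.toSubring ≤ W.toSubring → z ∈ W.toSubring) :
    z ∈ S.toSubring := by
  by_contra hzS
  have := isIntegrallyClosedIn_of_mem_normalizedBlowup hS
  -- By normality of `S`, some valuation ring dominating `S` omits `z`. Its centre `T` over `S` is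
  -- normal and Noetherian, and its height one localizations are divisorial rings over `S`; so `z`
  -- would lie in `T`, and hence in `V`.
  obtain ⟨V, hSV, hzV⟩ := exists_le_valuationSubring_of_isIntegrallyClosedIn hzS
  obtain ⟨k, T, hT, hTΓ, hTV, hST⟩ := exists_mem_stage_notMem_le_of_le hdim hI hfin hS hSV
  have hRT := le_of_mem_stage hT
  have := isIntegrallyClosed_of_mem_stage hT
  have := isNoetherianRing_of_mem_stage (fun Q (hQ : Q ∈ basePoints R I) => hQ.1) hT
  have := isFractionRing_of_le hRT
  obtain ⟨y, x, hx, rfl⟩ := IsFractionRing.div_surjective (A := T.toSubring) z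
  have hx0 : x ≠ 0 := nonZeroDivisors.ne_zero hx
  have hx0K : (x : K) ≠ 0 := fun h => hx0 (Subtype.ext h)
  suffices x ∣ y by
    obtain ⟨c, rfl⟩ := this
    refine hzV (hTV.1 ?_)
    change ((x : K) * c) / x ∈ T.toSubring
    rw [mul_div_cancel_left₀ _ hx0K]
    exact c.2
  refine IsIntegrallyClosed.dvd_of_forall_height_one hx0 fun q hqp hq => ?_
  obtain ⟨α, s, hs, h⟩ := mem_ofPrime_iff.mp (hz _ (ofPrime_mem_divisorialRings_of_mem_stage hT q hq)
    (hST.1.trans (le_ofPrime _ _)))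
  have hs0 : (s : K) ≠ 0 := fun h => hs (by rw [show s = 0 from Subtype.ext h]; exact zero_mem _)
  refine ⟨s, hs, α, Subtype.ext ?_⟩
  change (s : K) * y = x * α
  change (y : K) / x = α * (s : K)⁻¹ at h
  field_simp at h
  rw [mul_comm]; exact h

end Primary

end BlowupModel

/-! ### Uniqueness of the point over `S`, and triviality of its class group. -/

namespace BlowupModel

open LocalSubring

variable {K : Type*} [Field K]

section DiscreteValuationRing

variable {W : LocalSubring K} [IsDiscreteValuationRing W.toSubring]

/-- In a rank one discrete value group, take `N` to be the value of `a`, nonzero since `a` is a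
nonunit, and `j` the value of `w`. -/
theorem exists_pow_div_pow_mem {a w : K} (ha : a ∈ W.toSubring) (ha0 : a ≠ 0)
    (hai : a⁻¹ ∉ W.toSubring) (hw : w ∈ W.toSubring) (hw0 : w ≠ 0) :
    ∃ N ≠ 0, ∃ j : ℕ, w ^ N / a ^ j ∈ W.toSubring ∧ (w ^ N / a ^ j)⁻¹ ∈ W.toSubring := by
  obtain ⟨p, hp⟩ := IsDiscreteValuationRing.exists_irreducible W.toSubring
  have ha0' : (⟨a, ha⟩ : W.toSubring) ≠ 0 := fun h => ha0 (congrArg Subtype.val h)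
  have hw0' : (⟨w, hw⟩ : W.toSubring) ≠ 0 := fun h => hw0 (congrArg Subtype.val h)
  obtain ⟨n, hn⟩ := IsDiscreteValuationRing.associated_pow_irreducible ha0' hp
  obtain ⟨m, hm⟩ := IsDiscreteValuationRing.associated_pow_irreducible hw0' hp
  have hassoc : Associated ((⟨a, ha⟩ : W.toSubring) ^ m) (⟨w, hw⟩ ^ n) := by
    refine (hn.pow_pow (n := m)).trans ?_
    rw [← pow_mul, mul_comm, pow_mul]
    exact hm.symm.pow_pow
  obtain ⟨u, hu⟩ := hassoc
  have hu' : w ^ n / a ^ m = ((u : W.toSubring) : K) := by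
    have : a ^ m * ((u : W.toSubring) : K) = w ^ n := congrArg Subtype.val hu
    rw [← this, mul_div_cancel_left₀ _ (pow_ne_zero _ ha0)]
  refine ⟨n, ?_, m, ?_, ?_⟩
  · rintro rfl
    rw [pow_zero, associated_one_iff_isUnit, isUnit_iff_inv_mem] at hn
    exact hai hn.2
  · rw [hu']; exact (u : W.toSubring).2
  · rw [hu']; exact (isUnit_iff_inv_mem.mp u.isUnit).2

/-- Normalize the element of smaller value to a unit; the other quotient is then integral. -/
theorem exists_pow_div_pow_mem_pair {a w y : K} (ha : a ∈ W.toSubring) (ha0 : a ≠ 0)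
    (hai : a⁻¹ ∉ W.toSubring) (hw : w ∈ W.toSubring) (hw0 : w ≠ 0) (hy : y ∈ W.toSubring)
    (hy0 : y ≠ 0) : ∃ N ≠ 0, ∃ j : ℕ, w ^ N / a ^ j ∈ W.toSubring ∧ y ^ N / a ^ j ∈ W.toSubring ∧
      ((w ^ N / a ^ j)⁻¹ ∈ W.toSubring ∨ (y ^ N / a ^ j)⁻¹ ∈ W.toSubring) := by
  rcases ValuationRing.dvd_total (⟨w, hw⟩ : W.toSubring) ⟨y, hy⟩ with ⟨c, hc⟩ | ⟨c, hc⟩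
  · obtain ⟨N, hN, j, h1, h2⟩ := exists_pow_div_pow_mem ha ha0 hai hw hw0
    have hc' : y = w * c := congrArg Subtype.val hc
    refine ⟨N, hN, j, h1, ?_, Or.inl h2⟩
    rw [hc', mul_pow, mul_div_right_comm]
    exact mul_mem h1 (pow_mem c.2 _)
  · obtain ⟨N, hN, j, h1, h2⟩ := exists_pow_div_pow_mem ha ha0 hai hy hy0
    have hc' : w = y * c := congrArg Subtype.val hc
    refine ⟨N, hN, j, ?_, h1, Or.inr h2⟩
    rw [hc', mul_pow, mul_div_right_comm]
    exact mul_mem h1 (pow_mem c.2 _)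

end DiscreteValuationRing

section Primary

variable {R : LocalSubring K} [IsFractionRing R.toSubring K] [IsRegularLocalRing R.toSubring]
  {I : Ideal R.toSubring}

/-- A point of a stage that dominates `S` is equal to `S`, if `S` is contained in the order
valuation ring of at most one base point. -/
theorem eq_of_mem_stage_of_le (hdim : 2 ≤ ringKrullDim R.toSubring)
    (hI : I.radical = maximalIdeal R.toSubring) (hfin : (basePoints R I).Finite)
    {S : LocalSubring K} (hS : S ∈ normalizedBlowup R.toSubring I)
    (hone : ∀ Q ∈ basePoints R I, ∀ Q' ∈ basePoints R I,
      (S.toSubring : Set K) ⊆ orderValuationRing Q →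
      (S.toSubring : Set K) ⊆ orderValuationRing Q' → Q = Q')
    {k : ℕ} {T : LocalSubring K} (hT : T ∈ stage R (basePoints R I) k) (hST : S ≤ T) : T = S := by
  refine eq_of_le_of_subset hST fun z hz => ?_
  have hufd := IsRegularLocalRing.uniqueFactorizationMonoid R.toSubring
  obtain ⟨a, haI, ha0, hSa⟩ := id hS
  have haK : (a : K) ≠ 0 := fun h => ha0 (Subtype.ext h)
  have hchartS := (blowupChart_le_normalizedChart R.toSubring I a).trans
    (mem_affineModel_iff.mp hSa).1
  have hRS : R.toSubring ≤ S.toSubring := (le_blowupChart R.toSubring I a).trans hchartS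
  have hIm : I ≤ maximalIdeal R.toSubring := hI ▸ Ideal.le_radical
  obtain ⟨y, w, hrel, hz'⟩ := IsFractionRing.exists_reduced_fraction R.toSubring z
  have hw0 : (w : R.toSubring) ≠ 0 := nonZeroDivisors.ne_zero w.2
  rw [IsFractionRing.mk'_eq_div] at hz'
  generalize (w : R.toSubring) = w at *
  change (y : K) / w = z at hz'
  subst hz'
  by_cases hy0 : y = 0
  · subst hy0
    rw [Subring.coe_zero, zero_div]
    exact zero_mem _
  have hwK : (w : K) ≠ 0 := fun h => hw0 (Subtype.ext h)
  have hyK : (y : K) ≠ 0 := fun h => hy0 (Subtype.ext h)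
  -- At most one order valuation ring is relevant, so one pair of exponents serves. The powers of
  -- `a` correct the values there and are units in the relevant localizations of `R`. If no such
  -- ring exists, the exponents `1` and `0` do.
  obtain ⟨N, hN, j, hord⟩ : ∃ N ≠ 0, ∃ j : ℕ, ∀ W : LocalSubring K,
      IsDiscreteValuationRing W.toSubring → S.toSubring ≤ W.toSubring →
      (∃ Q ∈ basePoints R I, (W.toSubring : Set K) = orderValuationRing Q) →
      (w : K) ^ N / (a : K) ^ j ∈ W.toSubring ∧ (y : K) ^ N / (a : K) ^ j ∈ W.toSubring ∧
      (((w : K) ^ N / (a : K) ^ j)⁻¹ ∈ W.toSubring ∨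
        ((y : K) ^ N / (a : K) ^ j)⁻¹ ∈ W.toSubring) := by
    by_cases hex : ∃ W : LocalSubring K, IsDiscreteValuationRing W.toSubring ∧
        S.toSubring ≤ W.toSubring ∧
        ∃ Q ∈ basePoints R I, (W.toSubring : Set K) = orderValuationRing Q
    · obtain ⟨W₀, hW₀, hSW₀, Q₀, hQ₀, hWQ₀⟩ := hex
      -- `a` lies in the maximal ideal of `R`, which `Q₀` dominates, so `a` has positive order at
      -- `Q₀`.
      have hai : (a : K)⁻¹ ∉ W₀.toSubring := by
        obtain ⟨hle, hloc⟩ := le_of_isInfinitelyNear hQ₀.1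
        have := hQ₀.1.1
        have haQ : Subring.inclusion hle a ∈ maximalIdeal Q₀.toSubring := by
          rw [mem_maximalIdeal, mem_nonunits_iff, isUnit_map_iff]
          exact hIm haI
        rw [← SetLike.mem_coe, hWQ₀]
        exact inv_notMem_orderValuationRing haQ fun h => haK (congrArg Subtype.val h)
      have hR : ∀ r : R.toSubring, (r : K) ∈ W₀.toSubring := fun r => hSW₀ (hRS r.2)
      obtain ⟨N, hN, j, h⟩ := exists_pow_div_pow_mem_pair (hR a) haK hai (hR w) hwK (hR y) hyK
      refine ⟨N, hN, j, fun W _ hSW ⟨Q, hQ, hWQ⟩ => ?_⟩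
      have hQQ : Q = Q₀ := hone Q hQ Q₀ hQ₀ (hWQ ▸ hSW) (hWQ₀ ▸ hSW₀)
      have hWW : W = W₀ := toSubring_injective (SetLike.coe_injective (by rw [hWQ, hWQ₀, hQQ]))
      rwa [hWW]
    · exact ⟨1, one_ne_zero, 0, fun W h1 h2 h3 => absurd ⟨W, h1, h2, h3⟩ hex⟩
  set c : K := (w : K) ^ N / (a : K) ^ j with hc
  set d : K := (y : K) ^ N / (a : K) ^ j with hd
  have hall : ∀ W ∈ divisorialRings R (basePoints R I), S.toSubring ≤ W.toSubring →
      c ∈ W.toSubring ∧ d ∈ W.toSubring ∧ (c⁻¹ ∈ W.toSubring ∨ d⁻¹ ∈ W.toSubring) := by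
    rintro W ⟨hW, hWR | hWQ⟩ hSW
    · obtain ⟨h1, h2⟩ := inv_mem_of_mem_affineModel hdim hI hWR
      have hai := h1 a fun x hx => hSW (hchartS (div_mem_blowupChart hx))
      have hR : ∀ r : R.toSubring, (r : K) ∈ W.toSubring := fun r => hSW (hRS r.2)
      rw [hc, hd, div_eq_mul_inv, div_eq_mul_inv, mul_inv, mul_inv, inv_inv, ← inv_pow, ← inv_pow,
        ← inv_pow]
      refine ⟨mul_mem (pow_mem (hR w) _) (pow_mem hai _),
        mul_mem (pow_mem (hR y) _) (pow_mem hai _), ?_⟩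
      refine (h2 y w hrel hy0 hw0).symm.imp (fun h => ?_) (fun h => ?_)
      all_goals exact mul_mem (pow_mem h _) (pow_mem (hR a) _)
    · exact hord W hW hSW hWQ
  have hcS : c ∈ S.toSubring :=
    mem_of_forall_mem_divisorialRings hdim hI hfin hS fun W hW hSW => (hall W hW hSW).1
  have hdS : d ∈ S.toSubring :=
    mem_of_forall_mem_divisorialRings hdim hI hfin hS fun W hW hSW => (hall W hW hSW).2.1
  have hc0 : c ≠ 0 := div_ne_zero (pow_ne_zero _ hwK) (pow_ne_zero _ haK)
  have hd0 : d ≠ 0 := div_ne_zero (pow_ne_zero _ hyK) (pow_ne_zero _ haK)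
  have hzcd : ((y : K) / w) ^ N = d * c⁻¹ := by
    rw [hc, hd, div_pow]; field_simp
  -- Otherwise `c` is a nonunit of `T` by domination. A height one prime of `T` over `c` contains
  -- `d`, a multiple of `c` in `T`, but its localization is a divisorial ring over `S`, in which `c`
  -- or `d` is a unit.
  have hcinv : c⁻¹ ∈ S.toSubring := by
    by_contra hcon
    have hcT : c⁻¹ ∉ T.toSubring := fun h => hcon ((le_iff_inv_mem.mp hST).2 c hcS h)
    have hcu : ¬ IsUnit (⟨c, hST.1 hcS⟩ : T.toSubring) := fun h =>
      hcT (isUnit_iff_inv_mem.mp h).2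
    have := isNoetherianRing_of_mem_stage (fun Q (hQ : Q ∈ basePoints R I) => hQ.1) hT
    obtain ⟨q, hq⟩ := Ideal.nonempty_minimalPrimes
      (I := Ideal.span {(⟨c, hST.1 hcS⟩ : T.toSubring)}) (by rwa [Ne, Ideal.span_singleton_eq_top])
    have hqp : q.IsPrime := hq.1.1
    have hcq : (⟨c, hST.1 hcS⟩ : T.toSubring) ∈ q := hq.1.2 (Ideal.mem_span_singleton_self _)
    have hcT0 : (⟨c, hST.1 hcS⟩ : T.toSubring) ≠ 0 := fun h => hc0 (congrArg Subtype.val h)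
    have hht : q.height = 1 := by
      refine le_antisymm (Ideal.height_le_one_of_isPrincipal_of_mem_minimalPrimes _ q hq) ?_
      rw [Order.one_le_iff_ne_zero, Ne, Ideal.height_eq_zero_iff_eq_bot]
      rintro rfl
      exact hcT0 hcq
    have hdq : (⟨d, hST.1 hdS⟩ : T.toSubring) ∈ q := by
      have : (⟨d, hST.1 hdS⟩ : T.toSubring) = ⟨(y : K) / w, hz⟩ ^ N * ⟨c, hST.1 hcS⟩ :=
        Subtype.ext (by
          change d = ((y : K) / w) ^ N * c
          rw [hzcd, inv_mul_cancel_right₀ hc0])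
      rw [this]
      exact Ideal.mul_mem_left _ _ hcq
    have hdT0 : (⟨d, hST.1 hdS⟩ : T.toSubring) ≠ 0 := fun h => hd0 (congrArg Subtype.val h)
    rcases (hall _ (ofPrime_mem_divisorialRings_of_mem_stage hT q hht)
      (hST.1.trans (le_ofPrime _ _))).2.2 with h | h
    · exact (inv_mem_ofPrime_iff hcT0).mp h hcq
    · exact (inv_mem_ofPrime_iff hdT0).mp h hdq
  have := isIntegrallyClosedIn_of_mem_normalizedBlowup hS
  -- Only the `N`th power is known to lie in `S`; the root is recovered by normality.
  have hint : IsIntegral S.toSubring ((y : K) / w) := by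
    refine IsIntegral.of_pow (Nat.pos_of_ne_zero hN) ?_
    rw [hzcd]
    exact isIntegral_algebraMap (x := (⟨_, mul_mem hdS hcinv⟩ : S.toSubring))
  obtain ⟨s, hs⟩ := IsIntegrallyClosedIn.algebraMap_eq_of_integral hint
  rw [← hs]
  exact s.2

end Primary

theorem single_mem_principalDivisors {A : Type*} [CommRing A] [IsDomain A] [IsNoetherianRing A]
    [UniqueFactorizationMonoid A] (P : HeightOnePrime A) :
    Finsupp.single P 1 ∈ principalDivisors A := by
  classical
  have hP := P.2.1
  obtain ⟨p, hp⟩ := UniqueFactorizationMonoid.isPrincipal_of_height_eq_one P.2.2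
  have hp' : P.1 = Ideal.span {p} := hp
  have hp0 : p ≠ 0 := by
    rintro rfl
    have h1 := P.2.2
    rw [hp', Ideal.span_singleton_eq_bot.mpr rfl, Ideal.height_bot] at h1
    exact zero_ne_one h1
  have hpP : p ∈ P.1 := by rw [hp']; exact Ideal.mem_span_singleton_self p
  refine AddSubgroup.subset_closure ⟨p, hp0, fun P' => ?_⟩
  by_cases h : P' = P
  · subst h
    refine ⟨1, ?_, by simp⟩
    have := IsLocalization.AtPrime.isDiscreteValuationRing_of_height_eq_one P'.1 P'.2.2
      (Localization.AtPrime P'.1)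
    rw [Nat.cast_one]
    refine Ring.ord_of_irreducible ?_
    rw [IsDiscreteValuationRing.irreducible_iff_uniformizer,
      ← Localization.AtPrime.map_eq_maximalIdeal, ← Set.image_singleton, ← Ideal.map_span, ← hp']
  · refine ⟨0, ?_, by simp [Ne.symm h]⟩
    have hP'' := P'.2.1
    rw [Nat.cast_zero]
    refine Ring.ord_of_isUnit ?_
    refine (IsLocalization.AtPrime.isUnit_to_map_iff (Localization.AtPrime P'.1) P'.1 p).mpr ?_
    intro hpP'
    refine h (Subtype.ext ?_)
    have hle : P.1 ≤ P'.1 := by rw [hp']; exact (Ideal.span_singleton_le_iff_mem _).mpr hpP'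
    by_contra hne
    have hlt := Ideal.height_strict_mono_of_isPrime_of_isPrime (lt_of_le_of_ne hle (Ne.symm hne))
    rw [P.2.2, P'.2.2] at hlt
    exact lt_irrefl _ hlt

theorem subsingleton_divisorClassGroup (A : Type*) [CommRing A] [IsDomain A] [IsNoetherianRing A]
    [UniqueFactorizationMonoid A] : Subsingleton (DivisorClassGroup A) := by
  rw [QuotientAddGroup.subsingleton_iff, eq_top_iff]
  intro D _
  induction D using Finsupp.induction_linear with
  | zero => exact zero_mem _
  | add f g hf hg => exact add_mem (hf trivial) (hg trivial)
  | single P n =>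
    have := (principalDivisors A).zsmul_mem (single_mem_principalDivisors P) n
    simpa using this

end BlowupModel
theorem mainTheorem7 {K : Type*} [Field K] (R : LocalSubring K)
    [IsFractionRing R.toSubring K] [IsRegularLocalRing R.toSubring]
    (hdim : 2 ≤ ringKrullDim R.toSubring)
    (I : Ideal R.toSubring) (hI : I.radical = IsLocalRing.maximalIdeal R.toSubring)
    (hfin : (BlowupModel.basePoints R I).Finite)
    (hRees : ∀ Q ∈ BlowupModel.basePoints R I,
      ∃ V ∈ BlowupModel.reesValuationRings R.toSubring I,
        (V.toSubring : Set K) = BlowupModel.orderValuationRing Q)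
    (S : LocalSubring K) (hS : S ∈ BlowupModel.normalizedBlowup R.toSubring I)
    (hone : ∀ Q ∈ BlowupModel.basePoints R I, ∀ Q' ∈ BlowupModel.basePoints R I,
      (S.toSubring : Set K) ⊆ BlowupModel.orderValuationRing Q →
      (S.toSubring : Set K) ⊆ BlowupModel.orderValuationRing Q' → Q = Q') :
    IsAddTorsion (BlowupModel.DivisorClassGroup S.toSubring) ∧
      BlowupModel.IsBiregularAt
        (BlowupModel.saturatedModel R (BlowupModel.basePoints R I)) S := by
  obtain ⟨V, hV⟩ := S.exists_le_valuationSubring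
  obtain ⟨k, T, hT, hTΓ, -, hST⟩ :=
    BlowupModel.exists_mem_stage_notMem_le_of_le hdim hI hfin hS hV
  -- Now `S` is a stage point outside the base points: it is factorial and remains on all later
  -- stages.
  obtain rfl := BlowupModel.eq_of_mem_stage_of_le hdim hI hfin hS hone hT hST
  constructor
  · have := BlowupModel.isNoetherianRing_of_mem_stage
      (fun Q (hQ : Q ∈ BlowupModel.basePoints R I) => hQ.1) hT
    have := BlowupModel.uniqueFactorizationMonoid_of_mem_stage
      (fun Q (hQ : Q ∈ BlowupModel.basePoints R I) => hQ.1) hT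
    have := BlowupModel.subsingleton_divisorClassGroup T.toSubring
    intro D
    rw [Subsingleton.elim D 0]
    exact .zero
  · refine Set.eq_singleton_iff_unique_mem.mpr
      ⟨⟨BlowupModel.mem_saturatedModel_of_notMem hT hTΓ, le_rfl⟩, ?_⟩
    rintro T' ⟨hT', hle⟩
    -- A point of the final model lies on some stage, and uniqueness holds on each stage separately.
    obtain ⟨j, hj⟩ := hT'.exists
    exact BlowupModel.eq_of_mem_stage_of_le hdim hI hfin hS hone hj hle
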